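/- **Theorem (precise large deviations for the discrete Hawkes process).** Let $\nu>0$ and let $\alpha=(\alpha_i)_{i\ge 0}$ be nonnegative reals with $\alpha_0=0$ and $m:=\|\alpha\|_1=\sum_{i\ge0}\alpha_i\le 1$. Let $(X_t)_{t\ge 0}$ be $\mathbb N$-valued random variables with $X_0=0$ such that for every integer $t\ge1$, conditionally on $X_1,\dots,X_{t-1}$, $X_t$ is Poisson with mean $\nu+\sum_{s=1}^{t-1}\alpha_sX_{t-s}$, and let $N_t=\sum_{s=1}^tX_s$. Let $v\in\mathbb N$ and assume $\sum_{i\ge1}i^{v+1}\alpha_i<\infty$. Put $f_0(z)=z$, $f_s(z)=z+\sum_{i=1}^{s}\alpha_i\,(e^{f_{s-i}(z)}-1)$ for $s\ge 1$, and $\theta_c=m-1-\log m$ (with $\theta_c=+\infty$ if $m=0$). For $\Re z\le\theta_c$ the limit $f_\infty(z)=\lim_s f_s(z)$ exists, and $x(z):=e^{f_\infty(z)}$ satisfies $x(z)=e^{z+m(x(z)-1)}$. For $\Re z<\theta_c$ the series $\varphi(z)=\sum_{i\ge0}\left(e^{f_i(z)}-x(z)\right)$ converges, and $x$, $\varphi$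 and $\psi:=e^{\nu\varphi}$ are analytic on $\{\Re z<\theta_c\}$. Put $\eta(z)=\nu(x(z)-1)$. For $x>0$ put $$I(x)=x\log\frac{x}{\nu+mx}-x+mx+\nu,\qquad \theta^*=\log\frac{x}{\nu+mx}-\frac{mx}{\nu+mx}+m ;$$ then $I''(x)=\dfrac{\nu^2}{x(\nu+mx)^2}$. Let $\mathcal S_l$ be the set of $l$-tuples $(m_1,\dots,m_l)$ of nonnegative integers with $\sum_{j=1}^l j\,m_j=l$, and write $|\mathbf m|=m_1+\dots+m_l$. For $k\ge1$ and $l\ge0$ put $$A_{k,l}=\sum_{\mathbf m\in\mathcal S_l}\frac{(-1)^{|\mathbf m|}}{\prod_{j=1}^l m_j!\,j!^{m_j}}\prod_{j=1}^l\left(\frac{1}{\eta''(\theta^*)}\frac{\eta^{(j+2)}(\theta^*)}{(j+2)(j+1)}\right)^{m_j}\frac{(-1)^k\,(2(k+|\mathbf m|)-1)!!}{\eta''(\theta^*)^k},$$ $$a_k=\sum_{l=0}^{2k}\frac{\psi^{(2k-l)}(\theta^*)}{(2k-l)!}A_{k,l},$$ $$b_k=\sum_{n=0}^{2k}\left(\sum_{\mathbf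 m\in\mathcal S_n}\frac{e^{-|\mathbf m|\theta^*}\,|\mathbf m|!\,(1-e^{-\theta^*})^{-|\mathbf m|}}{\prod_{j=1}^n m_j!\,j!^{m_j}}\prod_{j=1}^n(-1)^{j m_j}\right)\sum_{l=0}^{2k-n}\frac{\psi^{(2k-n-l)}(\theta^*)}{(2k-n-l)!}A_{k,l}.$$ (i) For every fixed $x>0$, as $t\to\infty$ along the integers $t\ge1$ with $tx\in\mathbb N$, $$\mathbb P(N_t=tx)=e^{-tI(x)}\sqrt{\frac{I''(x)}{2\pi t}}\left(\psi(\theta^*)+\frac{a_1}{t}+\dots+\frac{a_{v-1}}{t^{v-1}}+O\!\left(\frac1{t^v}\right)\right).$$ (ii) If $m<1$, then for every fixed $x>\frac{\nu}{1-m}$, as $t\to\infty$ along the integers $t\ge1$ with $tx\in\mathbb N$, $$\mathbb P(N_t\ge tx)=e^{-tI(x)}\sqrt{\frac{I''(x)}{2\pi t}}\,\frac{1}{1-e^{-\theta^*}}\left(\psi(\theta^*)+\frac{b_1}{t}+\dots+\frac{b_{v-1}}{t^{v-1}}+O\!\left(\frac1{t^v}\right)\right).$$ For $v\in\{0,1\}$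 there are no terms $a_k/t^k$, $b_k/t^k$. -/

import Mathlib

open MeasureTheory ProbabilityTheory Filter Topology Asymptotics

noncomputable section

namespace DiscreteHawkes

/-- The mean `ν + ∑_{s=1}^{t-1} α_s x_{t-s}` of the `t`-th arrival number after the history `x`. -/
def intensity (ν : ℝ) (α : ℕ → ℝ) (x : ℕ → ℕ) (t : ℕ) : ℝ :=
  ν + ∑ s ∈ Finset.Ico 1 t, α s * (x (t - s) : ℝ)

/-- The event that the arrival numbers at the times `1, …, t - 1` are `x 1, …, x (t - 1)`. -/
def history {Ω : Type*} (X : ℕ → Ω → ℕ) (t : ℕ) (x : ℕ → ℕ) : Set Ω :=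
  {ω | ∀ s ∈ Finset.Ico 1 t, X s ω = x s}

/-- `X` is a discrete Hawkes process with Poisson arrivals: `X_0 = 0` and, for every `t ≥ 1`, the
law of `X_t` conditional on `X_1, …, X_{t-1}` is Poisson with mean
`ν + ∑_{s=1}^{t-1} α_s X_{t-s}`. As all variables are discrete, conditioning is elementary. -/
structure IsDiscreteHawkes {Ω : Type*} [MeasurableSpace Ω] (P : Measure Ω)
    (ν : ℝ) (α : ℕ → ℝ) (X : ℕ → Ω → ℕ) : Prop where
  measurable : ∀ t, Measurable (X t)
  zero : ∀ᵐ ω ∂P, X 0 ω = 0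
  condLaw : ∀ t, 1 ≤ t → ∀ (x : ℕ → ℕ) (k : ℕ),
    P (history X t x ∩ {ω | X t ω = k}) =
      P (history X t x) * poissonMeasure (intensity ν α x t).toNNReal {k}

/-- The counting process `N_t = X_1 + ⋯ + X_t`. -/
def count {Ω : Type*} (X : ℕ → Ω → ℕ) (t : ℕ) (ω : Ω) : ℕ :=
  ∑ s ∈ Finset.Icc 1 t, X s ω

/-- The norm `‖α‖₁ = ∑_{i ≥ 0} α_i` of a nonnegative sequence. -/
def norm1 (α : ℕ → ℝ) : ℝ := ∑' i, α i

/-- The functions `f_s(z) = z + ∑_{i=1}^{s} α_i (exp (f_{s-i}(z)) - 1)`; see `f_eq`. -/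
def f (α : ℕ → ℝ) (s : ℕ) (z : ℂ) : ℂ :=
  z + ∑ i : Fin s, (α (i + 1) : ℂ) * (Complex.exp (f α (s - (i + 1)) z) - 1)
termination_by s
decreasing_by omega

theorem f_eq (α : ℕ → ℝ) (s : ℕ) (z : ℂ) :
    f α s z = z + ∑ i ∈ Finset.Icc 1 s, (α i : ℂ) * (Complex.exp (f α (s - i) z) - 1) := by
  rw [f, Fin.sum_univ_eq_sum_range
    (fun i => (α (i + 1) : ℂ) * (Complex.exp (f α (s - (i + 1)) z) - 1)) s,
    Finset.range_eq_Ico, Finset.sum_Ico_add' (fun i => (α i : ℂ) *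
      (Complex.exp (f α (s - i) z) - 1)) 0 s 1]
  rfl

/-- `f_∞(z) = lim_s f_s(z)`. -/
def fInf (α : ℕ → ℝ) (z : ℂ) : ℂ := limUnder atTop (fun s => f α s z)

/-- `x(z) = exp (f_∞(z))`. -/
def xFun (α : ℕ → ℝ) (z : ℂ) : ℂ := Complex.exp (fInf α z)

/-- `η(z) = ν (x(z) - 1)`. -/
def eta (ν : ℝ) (α : ℕ → ℝ) (z : ℂ) : ℂ := ν * (xFun α z - 1)

/-- `φ(z) = ∑_{i ≥ 0} (exp (f_i(z)) - x(z))`. -/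
def phi (α : ℕ → ℝ) (z : ℂ) : ℂ := ∑' i, (Complex.exp (f α i z) - xFun α z)

/-- `ψ(z) = exp (ν φ(z))`. -/
def psi (ν : ℝ) (α : ℕ → ℝ) (z : ℂ) : ℂ := Complex.exp (ν * phi α z)

/-- The half-plane `Re z < θ_c`, where `θ_c = ‖α‖₁ - 1 - log ‖α‖₁`, which is `+∞` if `‖α‖₁ = 0`. -/
def openHalfPlane (α : ℕ → ℝ) : Set ℂ :=
  {z | norm1 α = 0 ∨ z.re < norm1 α - 1 - Real.log (norm1 α)}

/-- The half-plane `Re z ≤ θ_c`, where `θ_c = ‖α‖₁ - 1 - log ‖α‖₁`, which is `+∞` if `‖α‖₁ = 0`. -/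
def closedHalfPlane (α : ℕ → ℝ) : Set ℂ :=
  {z | norm1 α = 0 ∨ z.re ≤ norm1 α - 1 - Real.log (norm1 α)}

/-- The rate function
`I(x) = x log (x / (ν + x ‖α‖₁)) - x + x ‖α‖₁ + ν` at nonnegative `x`, where it is finite. -/
def rate (ν : ℝ) (α : ℕ → ℝ) (x : ℝ) : ℝ :=
  x * Real.log (x / (ν + x * norm1 α)) - x + x * norm1 α + ν

/-- `θ* = log (x / (ν + ‖α‖₁ x)) - ‖α‖₁ x / (ν + ‖α‖₁ x) + ‖α‖₁`. -/
def thetaStar (ν : ℝ) (α : ℕ → ℝ) (x : ℝ) : ℝ :=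
  Real.log (x / (ν + norm1 α * x)) - norm1 α * x / (ν + norm1 α * x) + norm1 α

/-- The set `𝒮_l` of the `l`-tuples `(m_1, …, m_l)` of nonnegative integers such that
`1 m_1 + 2 m_2 + ⋯ + l m_l = l`; the entry with index `j : Fin l` is `m_{j+1}`. -/
def tuples (l : ℕ) : Finset (Fin l → ℕ) :=
  (Fintype.piFinset fun _ => Finset.range (l + 1)).filter
    fun m => ∑ j : Fin l, ((j : ℕ) + 1) * m j = l

theorem mem_tuples {l : ℕ} {m : Fin l → ℕ} :
    m ∈ tuples l ↔ ∑ j : Fin l, ((j : ℕ) + 1) * m j = l := by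
  simp only [tuples, Finset.mem_filter, Fintype.mem_piFinset, Finset.mem_range,
    and_iff_right_iff_imp]
  intro h j
  have h1 := Finset.single_le_sum (f := fun j : Fin l => ((j : ℕ) + 1) * m j)
    (fun _ _ => Nat.zero_le _) (Finset.mem_univ j)
  rw [h] at h1
  nlinarith [Nat.zero_le ((j : ℕ) * m j)]

/-- `m_1! 1!^{m_1} m_2! 2!^{m_2} ⋯ m_l! l!^{m_l}`. -/
def tupleFactor {l : ℕ} (m : Fin l → ℕ) : ℕ :=
  ∏ j : Fin l, (m j).factorial * ((j : ℕ) + 1).factorial ^ m j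

/-- The sum over `𝒮_l` that enters the `k`-th coefficients:
`∑ (-1)^{|m|} / (m_1! 1!^{m_1} ⋯ m_l! l!^{m_l}) ·
  ∏_{j=1}^{l} (η^{(j+2)}(θ) / (η''(θ) (j+2) (j+1)))^{m_j} ·
  (-1)^k (2 (k + |m|) - 1)!! / η''(θ)^k`, where `|m| = m_1 + ⋯ + m_l`. -/
def innerSum (η : ℂ → ℂ) (θ : ℂ) (k l : ℕ) : ℂ :=
  ∑ m ∈ tuples l,
    (-1) ^ (∑ j, m j) / (tupleFactor m : ℂ) *
    (∏ j : Fin l, (1 / iteratedDeriv 2 η θ *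
      (iteratedDeriv ((j : ℕ) + 3) η θ / (((j : ℕ) + 3) * ((j : ℕ) + 2)))) ^ m j) *
    ((-1) ^ k * ((2 * (k + ∑ j, m j) - 1).doubleFactorial : ℂ) / iteratedDeriv 2 η θ ^ k)

/-- The coefficient `a_k` of the expansion of the point probabilities. -/
def coeffA (η ψ : ℂ → ℂ) (θ : ℂ) (k : ℕ) : ℂ :=
  ∑ l ∈ Finset.range (2 * k + 1),
    iteratedDeriv (2 * k - l) ψ θ / ((2 * k - l).factorial : ℂ) * innerSum η θ k l

/-- The coefficient `b_k` of the expansion of the tail probabilities. The sums over `𝒮_n` are the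
Taylor coefficients at `s = 0` of `(1 - exp (-θ)) / (1 - exp (-(θ + s)))`. -/
def coeffB (η ψ : ℂ → ℂ) (θ : ℂ) (k : ℕ) : ℂ :=
  ∑ n ∈ Finset.range (2 * k + 1),
    (∑ m ∈ tuples n,
      Complex.exp (-((∑ j, m j : ℕ) : ℂ) * θ) * ((∑ j, m j).factorial : ℂ) /
        (1 - Complex.exp (-θ)) ^ (∑ j, m j) / (tupleFactor m : ℂ) *
      ∏ j : Fin n, (-1) ^ (((j : ℕ) + 1) * m j)) *
    ∑ l ∈ Finset.range (2 * k - n + 1),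
      iteratedDeriv (2 * k - n - l) ψ θ / ((2 * k - n - l).factorial : ℂ) * innerSum η θ k l

/-- The times `t` with `t x ∈ ℕ`. -/
def latticeTimes (x : ℝ) : Set ℕ := {t | ∃ n : ℕ, (t : ℝ) * x = n}

end DiscreteHawkes

end

open DiscreteHawkes

open DiscreteHawkes

/-! The moment generating function of N_t is explicit. Averaging the last arrival out of an
exponential of a linear combination of arrivals gives an exponential of the same kind in the earlier
arrivals; iterated backwards in time this yields E exp(z N_t) = exp(ν ∑_{s<t} (e^{f_s(z)} - 1))
(`integral_exp_count`). Comparing each e^{f_s} with its limit x(z) splits this into exp(t η(z))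
times a factor that tends to ψ(z). So N_t behaves like a sum of t independent variables with
cumulant function η, up to the correction ψ.

Probabilities are recovered by Fourier inversion on a vertical segment of length 2π through θ*
(`point_inversion`, `tail_inversion`); the tail only adds the weight 1 / (1 - e^{-z}), a geometric
series that converges because θ* > 0. Since η'(θ*) = x, η''(θ*) = 1 / I''(x) and I(x) = x θ* -
η(θ*), the segment crosses the saddle point of η(z) - x z, and Laplace's method applies
(`laplace_expansion`, `saddle_expansion`).

Three points carry the weight.

Convergence: f_s - f_∞ obeys a renewal inequality whose inhomogeneity is a tail sum of α. Inside the
open half-plane the renewal kernel has mass below 1, and the moment of order v + 1 makes (1 + s)^v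
|e^{f_s} - x| summable uniformly (`exists_uniform_rate`). This gives analyticity and lets ψ replace
the finite-time factor at cost O(t^{-v}) (`exists_psi_rate`). Up to the boundary line only a kernel
of mass exactly 1 is available, and strict nonexpansiveness of exp in place of a contraction still
forces convergence (`tendsto_zero_of_renewal`).

Decay: the functional equation of x shows that |exp(η(θ* + iu) - η(θ*))| is at most Gaussian in u on
the whole segment (`sq_le_one_sub_re`).

Coefficients: write η(θ + s) = η(θ) + s x + s² K(s). At s = iu the exponent t s² K(s) is -t u² K(s).
Freezing t u² as a parameter and expanding in s alone gives sums over 𝒮_l by Faà di Bruno; Gaussian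
moments then supply the double factorials. The tail weight is absorbed into ψ (`coeffB_eq_coeffA`).
-/

namespace DiscreteHawkes

/-! ### Taylor series at the origin as power series -/

/-- The Taylor series of `g` at `0`, as a formal power series. -/
noncomputable def taylorPS (g : ℂ → ℂ) : PowerSeries ℂ :=
  PowerSeries.mk fun n => iteratedDeriv n g 0 / (n.factorial : ℂ)

theorem coeff_taylorPS (g : ℂ → ℂ) (n : ℕ) :
    PowerSeries.coeff n (taylorPS g) = iteratedDeriv n g 0 / (n.factorial : ℂ) := by
  simp [taylorPS]

theorem taylorPS_congr {g h : ℂ → ℂ} (H : g =ᶠ[𝓝 0] h) : taylorPS g = taylorPS h := by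
  ext n
  rw [coeff_taylorPS, coeff_taylorPS, H.iteratedDeriv_eq]

theorem taylorPS_mul {g h : ℂ → ℂ} (hg : AnalyticAt ℂ g 0) (hh : AnalyticAt ℂ h 0) :
    taylorPS (fun z => g z * h z) = taylorPS g * taylorPS h := by
  ext m
  change PowerSeries.coeff m (taylorPS (g * h)) = _
  simp only [coeff_taylorPS, iteratedDeriv_mul hg.contDiffAt hh.contDiffAt, PowerSeries.coeff_mul,
    Finset.Nat.sum_antidiagonal_eq_sum_range_succ_mk, Nat.succ_eq_add_one, Finset.sum_div]
  refine Finset.sum_congr rfl fun i hi => ?_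
  have h1 := Nat.factorial_ne_zero i
  have h2 := Nat.factorial_ne_zero (m - i)
  have h3 := Nat.factorial_ne_zero m
  rw [Nat.cast_choose _ (by grind)]
  field_simp

theorem taylorPS_add {g h : ℂ → ℂ} (hg : AnalyticAt ℂ g 0) (hh : AnalyticAt ℂ h 0) :
    taylorPS (fun z => g z + h z) = taylorPS g + taylorPS h := by
  ext m
  rw [map_add, coeff_taylorPS, coeff_taylorPS, coeff_taylorPS,
    iteratedDeriv_fun_add hg.contDiffAt hh.contDiffAt, add_div]

theorem taylorPS_const (c : ℂ) : taylorPS (fun _ => c) = PowerSeries.C c := by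
  ext m
  rw [coeff_taylorPS, iteratedDeriv_const, PowerSeries.coeff_C]
  split_ifs with h <;> simp [h]

theorem taylorPS_pow {g : ℂ → ℂ} (hg : AnalyticAt ℂ g 0) (n : ℕ) :
    taylorPS (fun z => g z ^ n) = taylorPS g ^ n := by
  induction n with
  | zero => simpa using taylorPS_const 1
  | succ n ih =>
    simp only [pow_succ]
    rw [taylorPS_mul (hg.fun_pow n) hg, ih]

theorem taylorPS_sum {ι : Type*} (s : Finset ι) {g : ι → ℂ → ℂ}
    (hg : ∀ i ∈ s, AnalyticAt ℂ (g i) 0) :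
    taylorPS (fun z => ∑ i ∈ s, g i z) = ∑ i ∈ s, taylorPS (g i) := by
  classical
  induction s using Finset.induction_on with
  | empty => simpa using taylorPS_const 0
  | insert a s ha ih =>
    simp only [Finset.sum_insert ha]
    rw [taylorPS_add (hg a (Finset.mem_insert_self a s))
      (Finset.analyticAt_fun_sum _ fun i hi => hg i (Finset.mem_insert_of_mem hi)),
      ih fun i hi => hg i (Finset.mem_insert_of_mem hi)]

theorem constantCoeff_taylorPS (g : ℂ → ℂ) :
    PowerSeries.constantCoeff (taylorPS g) = g 0 := by
  rw [← PowerSeries.coeff_zero_eq_constantCoeff_apply, coeff_taylorPS]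
  simp

theorem taylorPS_id : taylorPS (fun z => z) = PowerSeries.X := by
  ext m
  rw [coeff_taylorPS, PowerSeries.coeff_X, iteratedDeriv_fun_id_zero]
  split_ifs with h <;> simp [h]

/-- Taylor's formula for Φ to order `l + 1`: since g vanishes at 0, the substituted remainder has a
series divisible by X^(l+1) and does not reach the l-th coefficient. -/
theorem coeff_taylorPS_comp {Φ g : ℂ → ℂ} (hΦ : AnalyticAt ℂ Φ 0) (hg : AnalyticAt ℂ g 0)
    (hg0 : g 0 = 0) (l : ℕ) :
    PowerSeries.coeff l (taylorPS fun z => Φ (g z)) =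
      ∑ n ∈ Finset.range (l + 1),
        iteratedDeriv n Φ 0 / (n.factorial : ℂ) * PowerSeries.coeff l (taylorPS g ^ n) := by
  obtain ⟨F, hF, hΦF⟩ := hΦ.exists_eventuallyEq_sum_add_pow_mul (l + 1)
  have hg' : Tendsto g (𝓝 0) (𝓝 0) := by simpa [hg0] using hg.continuousAt.tendsto
  have hFg : AnalyticAt ℂ (fun z => F (g z)) 0 := by
    refine AnalyticAt.fun_comp ?_ hg
    rwa [hg0]
  have hcomp : (fun z => Φ (g z)) =ᶠ[𝓝 0] fun z =>
      (∑ i ∈ Finset.range (l + 1), (g z ^ i / (i.factorial : ℂ)) • iteratedDeriv i Φ 0) +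
        g z ^ (l + 1) • F (g z) := hg'.eventually hΦF
  rw [taylorPS_congr hcomp]
  simp only [smul_eq_mul]
  have hterm : ∀ i ∈ Finset.range (l + 1), AnalyticAt ℂ
      (fun z => g z ^ i / (i.factorial : ℂ) * iteratedDeriv i Φ 0) 0 := fun i _ => by fun_prop
  rw [taylorPS_add (Finset.analyticAt_fun_sum _ hterm) ((hg.fun_pow _).fun_mul hFg),
    taylorPS_sum _ hterm, taylorPS_mul (hg.fun_pow _) hFg, taylorPS_pow hg, map_add, map_sum]
  have h0 : PowerSeries.coeff l (taylorPS g ^ (l + 1) * taylorPS fun z => F (g z)) = 0 := by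
    have hX : PowerSeries.X ^ (l + 1) ∣ taylorPS g ^ (l + 1) * taylorPS fun z => F (g z) := by
      refine Dvd.dvd.mul_right (pow_dvd_pow_of_dvd ?_ _) _
      rw [PowerSeries.X_dvd_iff, constantCoeff_taylorPS, hg0]
    exact PowerSeries.X_pow_dvd_iff.mp hX l (Nat.lt_succ_self l)
  rw [h0, add_zero]
  refine Finset.sum_congr rfl fun i _ => ?_
  have : (fun z => g z ^ i / (i.factorial : ℂ) * iteratedDeriv i Φ 0) =
      fun z => (fun _ => iteratedDeriv i Φ 0 / (i.factorial : ℂ)) z * (g z) ^ i := by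
    ext z; ring
  rw [this, taylorPS_mul analyticAt_const (hg.fun_pow i), taylorPS_const, taylorPS_pow hg,
    PowerSeries.coeff_C_mul]

/-- Only the coefficients of q up to degree l matter, so q may be replaced by the polynomial `r`. In
the multinomial expansion of its power each choice of exponents is a single monomial, and degree l
singles out `tuples l`. -/
theorem coeff_pow_eq_sum_tuples {q : PowerSeries ℂ} (hq : PowerSeries.constantCoeff q = 0)
    (l p : ℕ) :
    PowerSeries.coeff l (q ^ p) =
      ∑ m ∈ (tuples l).filter fun m => ∑ j, m j = p,
        (p.factorial : ℂ) * ∏ j : Fin l,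
          PowerSeries.coeff ((j : ℕ) + 1) q ^ m j / ((m j).factorial : ℂ) := by
  classical
  set r : PowerSeries ℂ :=
    ∑ j : Fin l, PowerSeries.C (PowerSeries.coeff ((j : ℕ) + 1) q) * PowerSeries.X ^ ((j : ℕ) + 1)
    with hr
  have hdvd : PowerSeries.X ^ (l + 1) ∣ q - r := by
    rw [PowerSeries.X_pow_dvd_iff]
    intro n hn
    rw [map_sub, hr, map_sum]
    simp only [PowerSeries.coeff_C_mul_X_pow]
    rcases n with _ | n
    · simp [hq]
    · rw [Finset.sum_eq_single (⟨n, by omega⟩ : Fin l)]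
      · simp
      · intro b _ hb
        rw [if_neg]
        intro h
        exact hb (Fin.ext (by simpa using (Nat.succ_injective h).symm))
      · simp
  have hpow : PowerSeries.coeff l (q ^ p) = PowerSeries.coeff l (r ^ p) := by
    have h1 := PowerSeries.X_pow_dvd_iff.mp (hdvd.trans (sub_dvd_pow_sub_pow q r p)) l
      (Nat.lt_succ_self l)
    rw [map_sub] at h1
    exact sub_eq_zero.mp h1
  rw [hpow, hr, Finset.sum_pow_eq_sum_piAntidiag, map_sum]
  have hterm : ∀ k : Fin l → ℕ,
      PowerSeries.coeff l ((Nat.multinomial Finset.univ k : PowerSeries ℂ) *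
        ∏ j : Fin l, (PowerSeries.C (PowerSeries.coeff ((j : ℕ) + 1) q) *
          PowerSeries.X ^ ((j : ℕ) + 1)) ^ k j) =
      if ∑ j : Fin l, ((j : ℕ) + 1) * k j = l then
        (Nat.multinomial Finset.univ k : ℂ) *
          ∏ j : Fin l, PowerSeries.coeff ((j : ℕ) + 1) q ^ k j else 0 := by
    intro k
    have : (Nat.multinomial Finset.univ k : PowerSeries ℂ) *
        ∏ j : Fin l, (PowerSeries.C (PowerSeries.coeff ((j : ℕ) + 1) q) *
          PowerSeries.X ^ ((j : ℕ) + 1)) ^ k j =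
        PowerSeries.C ((Nat.multinomial Finset.univ k : ℂ) *
          ∏ j : Fin l, PowerSeries.coeff ((j : ℕ) + 1) q ^ k j) *
        PowerSeries.X ^ (∑ j : Fin l, ((j : ℕ) + 1) * k j) := by
      simp only [mul_pow, Finset.prod_mul_distrib, ← pow_mul, Finset.prod_pow_eq_pow_sum,
        map_mul, map_prod, map_pow, map_natCast, mul_assoc]
    rw [this, PowerSeries.coeff_C_mul_X_pow]
    simp only [eq_comm]
  simp only [hterm]
  rw [← Finset.sum_filter]
  refine Finset.sum_congr ?_ ?_
  · ext m
    simp only [Finset.mem_filter, Finset.mem_piAntidiag, mem_tuples]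
    simp [and_comm]
  · intro m hm
    have hmp : ∑ j, m j = p := (Finset.mem_filter.mp hm).2
    have hspec := Nat.multinomial_spec Finset.univ m
    rw [hmp] at hspec
    rw [Finset.prod_div_distrib, ← hspec]
    have hne : (∏ j : Fin l, ((m j).factorial : ℂ)) ≠ 0 :=
      Finset.prod_ne_zero_iff.mpr fun j _ => by exact_mod_cast (m j).factorial_ne_zero
    push_cast
    field_simp

theorem sum_le_of_mem_tuples {l : ℕ} {m : Fin l → ℕ} (hm : m ∈ tuples l) : ∑ j, m j ≤ l := by
  rw [mem_tuples] at hm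
  calc ∑ j, m j ≤ ∑ j : Fin l, ((j : ℕ) + 1) * m j :=
        Finset.sum_le_sum fun j _ => Nat.le_mul_of_pos_left _ (Nat.succ_pos _)
    _ = l := hm

/-- Faà di Bruno's formula for the Taylor coefficients of a composition at the origin. -/
theorem coeff_taylorPS_comp_eq_sum_tuples {Φ g : ℂ → ℂ} (hΦ : AnalyticAt ℂ Φ 0)
    (hg : AnalyticAt ℂ g 0) (hg0 : g 0 = 0) (l : ℕ) :
    PowerSeries.coeff l (taylorPS fun z => Φ (g z)) =
      ∑ m ∈ tuples l, iteratedDeriv (∑ j, m j) Φ 0 * ∏ j : Fin l,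
        PowerSeries.coeff ((j : ℕ) + 1) (taylorPS g) ^ m j / ((m j).factorial : ℂ) := by
  have hc : PowerSeries.constantCoeff (taylorPS g) = 0 := by rw [constantCoeff_taylorPS, hg0]
  rw [coeff_taylorPS_comp hΦ hg hg0]
  simp only [coeff_pow_eq_sum_tuples hc]
  rw [← Finset.sum_fiberwise_of_maps_to (t := Finset.range (l + 1))
    (g := fun m : Fin l → ℕ => ∑ j, m j)
    (fun m hm => Finset.mem_range.mpr (Nat.lt_succ_of_le (sum_le_of_mem_tuples hm)))]
  refine Finset.sum_congr rfl fun n _ => ?_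
  rw [Finset.mul_sum]
  refine Finset.sum_congr rfl fun m hm => ?_
  have hmn : ∑ j, m j = n := (Finset.mem_filter.mp hm).2
  have hn : (n.factorial : ℂ) ≠ 0 := by exact_mod_cast n.factorial_ne_zero
  rw [hmn]
  field_simp

/-! ### The coefficients a_k and b_k as Taylor coefficients -/

theorem taylorPS_shift_coeff (g : ℂ → ℂ) (c : ℂ) (n : ℕ) :
    PowerSeries.coeff n (taylorPS fun s => g (c + s)) =
      iteratedDeriv n g c / (n.factorial : ℂ) := by
  rw [coeff_taylorPS, iteratedDeriv_comp_const_add]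
  simp

/-- The defining sum is a Cauchy product. In this form the weight in `coeffB` can be moved onto ψ by
associativity of power series multiplication. -/
theorem coeffA_eq_coeff (η ψ : ℂ → ℂ) (θ : ℂ) (k : ℕ) :
    coeffA η ψ θ k = PowerSeries.coeff (2 * k)
      (PowerSeries.mk (innerSum η θ k) * taylorPS fun s => ψ (θ + s)) := by
  rw [PowerSeries.coeff_mul, Finset.Nat.sum_antidiagonal_eq_sum_range_succ_mk, coeffA]
  refine Finset.sum_congr rfl fun l _ => ?_
  rw [taylorPS_shift_coeff, PowerSeries.coeff_mk, mul_comm]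

theorem taylorPS_tail_weight {θ : ℂ} (hθ : 1 - Complex.exp (-θ) ≠ 0) (n : ℕ) :
    PowerSeries.coeff n (taylorPS fun s =>
      (1 - Complex.exp (-θ)) / (1 - Complex.exp (-(θ + s)))) =
    ∑ m ∈ tuples n,
      Complex.exp (-((∑ j, m j : ℕ) : ℂ) * θ) * ((∑ j, m j).factorial : ℂ) /
        (1 - Complex.exp (-θ)) ^ (∑ j, m j) / (tupleFactor m : ℂ) *
      ∏ j : Fin n, (-1) ^ (((j : ℕ) + 1) * m j) := by
  -- With this q the weight equals 1 / (1 - q (e^{-s} - 1)), a composition with w ↦ 1 / (1 - w),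
  -- whose k-th derivative at 0 is k!; Faà di Bruno's formula then gives the sum over 𝒮_n.
  set q : ℂ := Complex.exp (-θ) / (1 - Complex.exp (-θ)) with hq
  have hΦd : ∀ k : ℕ, iteratedDeriv k (fun w : ℂ => (1 - w)⁻¹) 0 = (k.factorial : ℂ) := by
    intro k
    have := iteratedDeriv_comp_const_sub k (fun w : ℂ => w⁻¹) (1 : ℂ)
    rw [this]
    simp [iteratedDeriv_eq_iterate, ← mul_assoc, ← mul_pow]
  have hg : AnalyticAt ℂ (fun s : ℂ => q * (Complex.exp (-s) - 1)) 0 := by fun_prop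
  have hΦ : AnalyticAt ℂ (fun w : ℂ => (1 - w)⁻¹) 0 := by
    refine AnalyticAt.fun_inv (by fun_prop) (by simp)
  have hcoeff : ∀ j : ℕ, PowerSeries.coeff (j + 1)
      (taylorPS fun s : ℂ => q * (Complex.exp (-s) - 1)) =
        q * (-1) ^ (j + 1) / ((j + 1).factorial : ℂ) := by
    intro j
    have : (fun s : ℂ => q * (Complex.exp (-s) - 1)) =
        fun s : ℂ => q * Complex.exp (-s) + (fun _ => -q) s := by ext s; ring
    rw [this, taylorPS_add (by fun_prop) (by fun_prop), taylorPS_const, map_add,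
      PowerSeries.coeff_C, if_neg (Nat.succ_ne_zero j), add_zero, coeff_taylorPS,
      iteratedDeriv_const_mul_field]
    congr 2
    have := iteratedDeriv_comp_neg (j + 1) Complex.exp 0
    rw [this, iteratedDeriv_eq_iterate, Complex.iter_deriv_exp]
    simp
  have heq : (fun s => (1 - Complex.exp (-θ)) / (1 - Complex.exp (-(θ + s)))) =
      fun s => (fun w : ℂ => (1 - w)⁻¹) ((fun s : ℂ => q * (Complex.exp (-s) - 1)) s) := by
    ext s
    have : 1 - q * (Complex.exp (-s) - 1) =
        (1 - Complex.exp (-(θ + s))) / (1 - Complex.exp (-θ)) := by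
      rw [neg_add, Complex.exp_add, hq]
      field_simp
      ring
    simp only [this, inv_div]
  rw [heq, coeff_taylorPS_comp_eq_sum_tuples hΦ hg (by simp)]
  refine Finset.sum_congr rfl fun m _ => ?_
  rw [hΦd]
  simp only [hcoeff]
  have h1 : Complex.exp (-((∑ j, m j : ℕ) : ℂ) * θ) = Complex.exp (-θ) ^ (∑ j, m j) := by
    rw [← Complex.exp_nat_mul]; ring_nf
  rw [h1, tupleFactor]
  push_cast
  simp only [div_pow, mul_pow, Finset.prod_div_distrib, Finset.prod_mul_distrib,
    Finset.prod_pow_eq_pow_sum, ← pow_mul, hq]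
  ring_nf

/-- This reduces the tail expansion to the point expansion with a modified amplitude: the sums over
𝒮_n are the Taylor coefficients of the factor multiplying ψ. -/
theorem coeffB_eq_coeffA {η ψ : ℂ → ℂ} {θ : ℂ} (hθ : 1 - Complex.exp (-θ) ≠ 0)
    (hψ : AnalyticAt ℂ ψ θ) (k : ℕ) :
    coeffB η ψ θ k =
      coeffA η (fun z => ψ z * ((1 - Complex.exp (-θ)) / (1 - Complex.exp (-z)))) θ k := by
  have hψ' : AnalyticAt ℂ (fun s => ψ (θ + s)) 0 := by
    refine AnalyticAt.fun_comp ?_ (by fun_prop)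
    simpa using hψ
  have hr : AnalyticAt ℂ (fun s => (1 - Complex.exp (-θ)) / (1 - Complex.exp (-(θ + s)))) 0 := by
    refine AnalyticAt.fun_div (by fun_prop) (by fun_prop) (by simpa using hθ)
  rw [coeffA_eq_coeff, taylorPS_mul hψ' hr, ← mul_assoc, mul_comm (PowerSeries.mk _ * _),
    PowerSeries.coeff_mul,
    Finset.Nat.sum_antidiagonal_eq_sum_range_succ_mk, coeffB]
  refine Finset.sum_congr rfl fun n _ => ?_
  rw [taylorPS_tail_weight hθ, PowerSeries.coeff_mul,
    Finset.Nat.sum_antidiagonal_eq_sum_range_succ_mk]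
  congr 1
  refine Finset.sum_congr rfl fun l _ => ?_
  rw [taylorPS_shift_coeff, PowerSeries.coeff_mk, mul_comm]

end DiscreteHawkes

namespace DiscreteHawkes

/-! ### Gaussian moments -/

theorem integrable_pow_mul_gaussian {b : ℝ} (hb : 0 < b) (n : ℕ) :
    Integrable fun u : ℝ => u ^ n * Real.exp (-b * u ^ 2) := by
  have := integrable_rpow_mul_exp_neg_mul_sq hb (s := n) (by linarith [n.cast_nonneg (α := ℝ)])
  simpa using this

theorem integral_odd_pow_mul_gaussian (b : ℝ) {n : ℕ} (hn : Odd n) :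
    ∫ u : ℝ, u ^ n * Real.exp (-b * u ^ 2) = 0 := by
  have h := integral_neg_eq_self (fun u : ℝ => u ^ n * Real.exp (-b * u ^ 2)) volume
  simp only [hn.neg_pow, neg_mul, even_two.neg_pow, integral_neg] at h ⊢
  linarith

theorem integral_even_pow_mul_gaussian {b : ℝ} (hb : 0 < b) (n : ℕ) :
    ∫ u : ℝ, u ^ (2 * n) * Real.exp (-b * u ^ 2) =
      ((2 * n - 1).doubleFactorial : ℝ) / (2 * b) ^ n * √(Real.pi / b) := by
  have h1 : ∫ u : ℝ, u ^ (2 * n) * Real.exp (-b * u ^ 2) =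
      ∫ u : ℝ, (fun y : ℝ => y ^ ((2 * n : ℕ) : ℝ) * Real.exp (-b * y ^ (2 : ℝ))) |u| := by
    refine integral_congr_ae (ae_of_all _ fun u => ?_)
    simp only [Real.rpow_natCast, Real.rpow_two, sq_abs]
    rw [(even_two_mul n).pow_abs]
  rw [h1, integral_comp_abs (f := fun y : ℝ => y ^ ((2 * n : ℕ) : ℝ) * Real.exp (-b * y ^ (2 : ℝ))),
    integral_rpow_mul_exp_neg_mul_rpow two_pos
      (by linarith [(2 * n : ℕ).cast_nonneg (α := ℝ)]) hb]
  have h2 : (((2 * n : ℕ) : ℝ) + 1) / 2 = n + 1 / 2 := by push_cast; ring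
  rw [neg_div, h2, Real.Gamma_nat_add_half, Real.rpow_neg hb.le, Real.rpow_add hb,
    Real.rpow_natCast, ← Real.sqrt_eq_rpow, Real.sqrt_div Real.pi_pos.le]
  have := Real.sqrt_ne_zero'.mpr hb
  field_simp
  rw [mul_pow, mul_comm]

/-! ### Taylor polynomials of bounded holomorphic functions -/

theorem norm_coeff_taylorPS_le {F : ℂ → ℂ} {δ R A : ℝ} (hδ : 0 < δ) (hδR : δ < R)
    (hF : DifferentiableOn ℂ F (Metric.ball 0 R))
    (hA : ∀ s ∈ Metric.closedBall (0 : ℂ) δ, ‖F s‖ ≤ A) (l : ℕ) :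
    ‖PowerSeries.coeff l (taylorPS F)‖ ≤ A / δ ^ l := by
  have hd : DiffContOnCl ℂ F (Metric.ball 0 δ) := by
    refine DifferentiableOn.diffContOnCl ?_
    rw [closure_ball _ hδ.ne']
    exact hF.mono (Metric.closedBall_subset_ball hδR)
  have := Complex.norm_iteratedDeriv_le_of_forall_mem_sphere_norm_le l hδ hd
    fun z hz => hA z (Metric.sphere_subset_closedBall hz)
  have hl : (0 : ℝ) < l.factorial := by exact_mod_cast l.factorial_pos
  rw [coeff_taylorPS, norm_div, Complex.norm_natCast, div_le_iff₀ hl]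
  calc _ ≤ _ := this
    _ = _ := by ring

/-- Cauchy's estimates and a geometric tail of ratio at most 1/2. The constant depends on F only
through the bound A, which matters because F will carry the parameter t u². -/
theorem norm_sub_taylor_le {F : ℂ → ℂ} {δ R A : ℝ} (hδ : 0 < δ) (hδR : δ < R)
    (hF : DifferentiableOn ℂ F (Metric.ball 0 R))
    (hA : ∀ s ∈ Metric.closedBall (0 : ℂ) δ, ‖F s‖ ≤ A) (N : ℕ) {s : ℂ} (hs : ‖s‖ ≤ δ / 2) :
    ‖F s - ∑ l ∈ Finset.range N, PowerSeries.coeff l (taylorPS F) * s ^ l‖ ≤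
      2 * A * (‖s‖ / δ) ^ N := by
  have hA0 : 0 ≤ A := (norm_nonneg _).trans (hA 0 (by simp [hδ.le]))
  have hsum : HasSum (fun l => PowerSeries.coeff l (taylorPS F) * s ^ l) (F s) := by
    have := Complex.hasSum_taylorSeries_on_ball hF (z := s)
      (by rw [mem_ball_zero_iff]; linarith)
    refine this.congr_fun fun l => ?_
    rw [coeff_taylorPS, smul_eq_mul, smul_eq_mul, sub_zero]
    ring
  have htail := (hasSum_nat_add_iff' N).mpr hsum
  set r : ℝ := ‖s‖ / δ with hr
  have hr0 : 0 ≤ r := by positivity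
  have hr2 : r ≤ 1 / 2 := by rw [hr, div_le_iff₀ hδ]; linarith
  have hgeo : HasSum (fun n : ℕ => A * r ^ N * r ^ n) (A * r ^ N * (1 - r)⁻¹) :=
    (hasSum_geometric_of_lt_one hr0 (by linarith)).mul_left _
  have hb : ‖F s - ∑ l ∈ Finset.range N, PowerSeries.coeff l (taylorPS F) * s ^ l‖ ≤
      A * r ^ N * (1 - r)⁻¹ := by
    refine htail.norm_le_of_bounded hgeo fun n => ?_
    rw [norm_mul, norm_pow]
    calc _ ≤ A / δ ^ (n + N) * ‖s‖ ^ (n + N) := by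
          gcongr
          exact norm_coeff_taylorPS_le hδ hδR hF hA _
      _ = A * r ^ N * r ^ n := by
          rw [hr, div_pow, div_pow, pow_add, pow_add]; field_simp
  refine hb.trans ?_
  have : (1 - r)⁻¹ ≤ 2 := by
    rw [inv_le_comm₀ (by linarith) two_pos]; linarith
  calc A * r ^ N * (1 - r)⁻¹ ≤ A * r ^ N * 2 := by gcongr
    _ = _ := by ring

/-! ### Laplace's method for an analytic phase -/

/-- K is the divided difference at 0 taken twice, so the singularity of (η(θ + s) - η(θ) - s η'(θ))
/ s² is removed, and its Taylor coefficients are those of η shifted by two. -/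
theorem exists_quadratic_quotient {η : ℂ → ℂ} {θ : ℂ} {ρ : ℝ} (hρ : 0 < ρ)
    (hη : DifferentiableOn ℂ η (Metric.ball θ ρ)) :
    ∃ K : ℂ → ℂ, DifferentiableOn ℂ K (Metric.ball 0 ρ) ∧
      (∀ s, η (θ + s) = η θ + s * deriv η θ + s ^ 2 * K s) ∧
      ∀ n, PowerSeries.coeff n (taylorPS K) =
        iteratedDeriv (n + 2) η θ / ((n + 2).factorial : ℂ) := by
  set η₁ : ℂ → ℂ := fun s => η (θ + s) with hη₁
  have hd : DifferentiableOn ℂ η₁ (Metric.ball 0 ρ) := by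
    refine hη.comp (by fun_prop) fun s hs => ?_
    simpa [Metric.mem_ball, dist_eq_norm] using hs
  have hnhds : Metric.ball (0 : ℂ) ρ ∈ 𝓝 0 := Metric.ball_mem_nhds _ hρ
  have hd1 := (Complex.differentiableOn_dslope hnhds).mpr hd
  have hd2 := (Complex.differentiableOn_dslope hnhds).mpr hd1
  have e1 : ∀ s, η₁ s = η₁ 0 + s * dslope η₁ 0 s := fun s => by
    have := sub_smul_dslope η₁ 0 s
    rw [sub_zero, smul_eq_mul] at this
    rw [this]; ring
  have e2 : ∀ s, dslope η₁ 0 s = deriv η θ + s * dslope (dslope η₁ 0) 0 s := fun s => by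
    have := sub_smul_dslope (dslope η₁ 0) 0 s
    rw [sub_zero, smul_eq_mul, dslope_same, hη₁, deriv_comp_const_add, add_zero] at this
    rw [this]; ring
  refine ⟨dslope (dslope η₁ 0) 0, hd2, fun s => ?_, fun n => ?_⟩
  · have h := e1 s
    rw [e2 s] at h
    simp only [hη₁, add_zero] at h
    rw [h]; ring
  · have a1 := hd1.analyticAt hnhds
    have a2 := hd2.analyticAt hnhds
    have t1 : taylorPS η₁ = PowerSeries.C (η₁ 0) + PowerSeries.X * taylorPS (dslope η₁ 0) := by
      conv_lhs => rw [show η₁ = fun s => (fun _ => η₁ 0) s + s * dslope η₁ 0 s from funext e1]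
      rw [taylorPS_add analyticAt_const (by fun_prop), taylorPS_const,
        taylorPS_mul (by fun_prop) a1, taylorPS_id]
    have t2 : taylorPS (dslope η₁ 0) = PowerSeries.C (deriv η θ) +
        PowerSeries.X * taylorPS (dslope (dslope η₁ 0) 0) := by
      conv_lhs => rw [show dslope η₁ 0 = fun s => (fun _ => deriv η θ) s +
        s * dslope (dslope η₁ 0) 0 s from funext e2]
      rw [taylorPS_add analyticAt_const (by fun_prop), taylorPS_const,
        taylorPS_mul (by fun_prop) a2, taylorPS_id]
    rw [← taylorPS_shift_coeff, show (fun s => η (θ + s)) = η₁ from rfl, t1, map_add,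
      PowerSeries.coeff_C, if_neg (by omega), zero_add, PowerSeries.coeff_succ_X_mul, t2, map_add,
      PowerSeries.coeff_C, if_neg (by omega), zero_add, PowerSeries.coeff_succ_X_mul]

/-- Under the Gaussian u² scales like 1 / (t σ), so the n factors t u² cost no power of t: the order
t^{-k} depends on k alone. Hence all tuples with the same l contribute to the same order of the
expansion. -/
theorem integral_gaussian_monomial {t σ : ℝ} (ht : 0 < t) (hσ : 0 < σ) (n k : ℕ) :
    (√(t * σ / (2 * Real.pi)) : ℂ) *
      ∫ u : ℝ, (Real.exp (-(t * σ / 2) * u ^ 2) : ℂ) *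
        ((-(t * u ^ 2) : ℂ) ^ n * (Complex.I * u) ^ (2 * k)) =
      (-1) ^ (k + n) * ((2 * (k + n) - 1).doubleFactorial : ℂ) / (σ : ℂ) ^ (k + n) /
        (t : ℂ) ^ k := by
  have h1 : ∀ u : ℝ, (Real.exp (-(t * σ / 2) * u ^ 2) : ℂ) *
        ((-(t * u ^ 2) : ℂ) ^ n * (Complex.I * u) ^ (2 * k)) =
      (((-1) ^ (k + n) * t ^ n *
        (u ^ (2 * (k + n)) * Real.exp (-(t * σ / 2) * u ^ 2)) : ℝ) : ℂ) := fun u => by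
    rw [mul_pow, pow_mul Complex.I, Complex.I_sq, neg_pow, mul_pow]
    push_cast
    ring
  simp only [h1]
  rw [integral_complex_ofReal, integral_const_mul, integral_even_pow_mul_gaussian (by positivity)]
  have h2 : √(t * σ / (2 * Real.pi)) * √(Real.pi / (t * σ / 2)) = 1 := by
    rw [← Real.sqrt_mul (by positivity)]
    have := Real.pi_pos
    rw [show t * σ / (2 * Real.pi) * (Real.pi / (t * σ / 2)) = 1 by field_simp, Real.sqrt_one]
  have h3 : (2 * (t * σ / 2)) = t * σ := by ring
  rw [h3]
  have h4 : √(t * σ / (2 * Real.pi)) * ((-1) ^ (k + n) * t ^ n *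
      (((2 * (k + n) - 1).doubleFactorial : ℝ) / (t * σ) ^ (k + n) * √(Real.pi / (t * σ / 2)))) =
      (-1) ^ (k + n) * ((2 * (k + n) - 1).doubleFactorial : ℝ) / σ ^ (k + n) / t ^ k := by
    calc _ = (√(t * σ / (2 * Real.pi)) * √(Real.pi / (t * σ / 2))) *
        ((-1) ^ (k + n) * t ^ n *
          (((2 * (k + n) - 1).doubleFactorial : ℝ) / (t * σ) ^ (k + n))) := by ring
      _ = _ := by
        rw [h2, one_mul, mul_pow, pow_add t k n]
        field_simp
  have := congrArg (fun r : ℝ => (r : ℂ)) h4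
  push_cast at this ⊢
  exact this

theorem integral_gaussian_monomial_odd (t σ : ℝ) (n k : ℕ) :
    ∫ u : ℝ, (Real.exp (-(t * σ / 2) * u ^ 2) : ℂ) *
        ((-(t * u ^ 2) : ℂ) ^ n * (Complex.I * u) ^ (2 * k + 1)) = 0 := by
  have h1 : ∀ u : ℝ, (Real.exp (-(t * σ / 2) * u ^ 2) : ℂ) *
        ((-(t * u ^ 2) : ℂ) ^ n * (Complex.I * u) ^ (2 * k + 1)) =
      ((-t : ℂ) ^ n * Complex.I ^ (2 * k + 1)) *
        ((u ^ (2 * n + (2 * k + 1)) * Real.exp (-(t * σ / 2) * u ^ 2) : ℝ) : ℂ) := fun u => by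
    rw [← neg_mul, mul_pow, mul_pow]
    push_cast
    ring
  simp only [h1]
  rw [integral_const_mul, integral_complex_ofReal, integral_odd_pow_mul_gaussian, Complex.ofReal_zero,
    mul_zero]
  exact ⟨n + k, by ring⟩

theorem integrable_gaussian_monomial {t σ : ℝ} (ht : 0 < t) (hσ : 0 < σ) (n l : ℕ) :
    Integrable fun u : ℝ => (Real.exp (-(t * σ / 2) * u ^ 2) : ℂ) *
        ((-(t * u ^ 2) : ℂ) ^ n * (Complex.I * u) ^ l) := by
  have h1 : (fun u : ℝ => (Real.exp (-(t * σ / 2) * u ^ 2) : ℂ) *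
        ((-(t * u ^ 2) : ℂ) ^ n * (Complex.I * u) ^ l)) =
      fun u : ℝ => ((-t : ℂ) ^ n * Complex.I ^ l) *
        ((u ^ (2 * n + l) * Real.exp (-(t * σ / 2) * u ^ 2) : ℝ) : ℂ) := by
    ext u
    rw [← neg_mul, mul_pow, mul_pow]
    push_cast
    ring
  rw [h1]
  exact (integrable_pow_mul_gaussian (by positivity) _).ofReal.const_mul _

end DiscreteHawkes

/-! ### Term-by-term Gaussian integration of the local expansion -/

namespace DiscreteHawkes

/-- The j!^{m_j} in the tuple factor combine with (j+2)(j+1) to (j+2)!, so the products are formed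
from the Taylor coefficients of K in `exists_quadratic_quotient`. -/
theorem innerSum_eq {η : ℂ → ℂ} {θ σ : ℂ} (hσ : iteratedDeriv 2 η θ = σ) (hσ0 : σ ≠ 0)
    (k l : ℕ) :
    innerSum η θ k l = ∑ m ∈ tuples l,
      (∏ j : Fin l, (iteratedDeriv ((j : ℕ) + 1 + 2) η θ / (((j : ℕ) + 1 + 2).factorial : ℂ)) ^ m j /
        ((m j).factorial : ℂ)) *
      ((-1) ^ (k + ∑ j, m j) * ((2 * (k + ∑ j, m j) - 1).doubleFactorial : ℂ) /
        σ ^ (k + ∑ j, m j)) := by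
  rw [innerSum]
  refine Finset.sum_congr rfl fun m _ => ?_
  have hfac : ∀ j : Fin l, (1 / iteratedDeriv 2 η θ *
      (iteratedDeriv ((j : ℕ) + 3) η θ / (((j : ℕ) + 3) * ((j : ℕ) + 2)))) ^ m j =
      (iteratedDeriv ((j : ℕ) + 1 + 2) η θ / (((j : ℕ) + 1 + 2).factorial : ℂ)) ^ m j *
        (((j : ℕ) + 1).factorial : ℂ) ^ m j * σ⁻¹ ^ m j := by
    intro j
    rw [← mul_pow, ← mul_pow, hσ]
    congr 1
    have h1 : (((j : ℕ) + 1 + 2).factorial : ℂ) =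
        ((j : ℕ) + 3) * ((j : ℕ) + 2) * (((j : ℕ) + 1).factorial : ℂ) := by
      rw [Nat.factorial_succ ((j : ℕ) + 2), Nat.factorial_succ ((j : ℕ) + 1)]
      push_cast
      ring
    have h2 : (((j : ℕ) + 1).factorial : ℂ) ≠ 0 := by exact_mod_cast Nat.factorial_ne_zero _
    have h3 : ((j : ℕ) : ℂ) + 3 ≠ 0 := by exact_mod_cast Nat.succ_ne_zero ((j : ℕ) + 2)
    have h4 : ((j : ℕ) : ℂ) + 2 ≠ 0 := by exact_mod_cast Nat.succ_ne_zero ((j : ℕ) + 1)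
    rw [h1]
    field_simp
  rw [Finset.prod_congr rfl fun j _ => hfac j, hσ, tupleFactor]
  push_cast
  simp only [Finset.prod_mul_distrib, Finset.prod_div_distrib, Finset.prod_pow_eq_pow_sum]
  have h5 : (∏ j : Fin l, (((j : ℕ) + 1).factorial : ℂ) ^ m j) ≠ 0 :=
    Finset.prod_ne_zero_iff.mpr fun j _ => pow_ne_zero _ (by exact_mod_cast Nat.factorial_ne_zero _)
  rw [pow_add, pow_add, inv_pow]
  field_simp

/-- Faà di Bruno's formula with outer function w ↦ exp(p w), whose n-th derivative at 0 is p^n. The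
number p stands for -t u² and is held fixed although s will later be i u; every coefficient is a
polynomial in p. -/
theorem coeff_taylorPS_exp_mul {K h : ℂ → ℂ} (hK : AnalyticAt ℂ K 0) (hh : AnalyticAt ℂ h 0)
    (p : ℂ) (l : ℕ) :
    PowerSeries.coeff l (taylorPS fun s => Complex.exp (p * (K s - K 0)) * h s) =
      ∑ i ∈ Finset.range (l + 1), ∑ m ∈ tuples i,
        (∏ j : Fin i, PowerSeries.coeff ((j : ℕ) + 1) (taylorPS K) ^ m j / ((m j).factorial : ℂ)) *
          PowerSeries.coeff (l - i) (taylorPS h) * p ^ (∑ j, m j) := by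
  have hg : AnalyticAt ℂ (fun s => K s - K 0) 0 := by fun_prop
  have hΦ : AnalyticAt ℂ (fun w : ℂ => Complex.exp (p * w)) 0 := by fun_prop
  have hE : AnalyticAt ℂ (fun s => Complex.exp (p * (K s - K 0))) 0 := by fun_prop
  have hΦd : ∀ n, iteratedDeriv n (fun w : ℂ => Complex.exp (p * w)) 0 = p ^ n := fun n => by
    rw [iteratedDeriv_cexp_const_mul]; simp
  have hc : ∀ j : ℕ, PowerSeries.coeff (j + 1) (taylorPS fun s => K s - K 0) =
      PowerSeries.coeff (j + 1) (taylorPS K) := fun j => by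
    rw [show (fun s => K s - K 0) = fun s => K s + (fun _ => -K 0) s by ext s; ring,
      taylorPS_add hK analyticAt_const, taylorPS_const, map_add, PowerSeries.coeff_C,
      if_neg (Nat.succ_ne_zero j), add_zero]
  rw [taylorPS_mul hE hh, PowerSeries.coeff_mul, Finset.Nat.sum_antidiagonal_eq_sum_range_succ_mk]
  refine Finset.sum_congr rfl fun i _ => ?_
  have := coeff_taylorPS_comp_eq_sum_tuples hΦ hg (sub_self _) i
  rw [this, Finset.sum_mul]
  refine Finset.sum_congr rfl fun m _ => ?_
  simp only [hΦd, hc]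
  ring

section
variable {η h K : ℂ → ℂ} {θ : ℂ} {σ t : ℝ}

theorem integrable_laplace_term (hK : AnalyticAt ℂ K 0) (hh : AnalyticAt ℂ h 0)
    (ht : 0 < t) (hσ : 0 < σ) (l : ℕ) :
    Integrable fun u : ℝ => (Real.exp (-(t * σ / 2) * u ^ 2) : ℂ) *
      (PowerSeries.coeff l (taylorPS fun s => Complex.exp (-(t * u ^ 2) * (K s - K 0)) * h s) *
        (Complex.I * u) ^ l) := by
  simp only [coeff_taylorPS_exp_mul hK hh, Finset.sum_mul, Finset.mul_sum]
  refine integrable_finsetSum _ fun i _ => integrable_finsetSum _ fun m _ => ?_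
  refine ((integrable_gaussian_monomial ht hσ (∑ j, m j) l).const_mul ((∏ j : Fin i,
    PowerSeries.coeff ((j : ℕ) + 1) (taylorPS K) ^ m j / ((m j).factorial : ℂ)) *
      PowerSeries.coeff (l - i) (taylorPS h))).congr (ae_of_all _ fun u => ?_)
  ring

theorem integral_laplace_term (hK : AnalyticAt ℂ K 0) (hh : AnalyticAt ℂ h 0)
    (ht : 0 < t) (hσ : 0 < σ) (l : ℕ) :
    ∫ u : ℝ, (Real.exp (-(t * σ / 2) * u ^ 2) : ℂ) *
      (PowerSeries.coeff l (taylorPS fun s => Complex.exp (-(t * u ^ 2) * (K s - K 0)) * h s) *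
        (Complex.I * u) ^ l) =
      ∑ i ∈ Finset.range (l + 1), ∑ m ∈ tuples i,
        (∏ j : Fin i, PowerSeries.coeff ((j : ℕ) + 1) (taylorPS K) ^ m j / ((m j).factorial : ℂ)) *
          PowerSeries.coeff (l - i) (taylorPS h) *
        ∫ u : ℝ, (Real.exp (-(t * σ / 2) * u ^ 2) : ℂ) *
          ((-(t * u ^ 2) : ℂ) ^ (∑ j, m j) * (Complex.I * u) ^ l) := by
  have hi : ∀ (i : ℕ) (m : Fin i → ℕ), Integrable fun u : ℝ => (∏ j : Fin i,
      PowerSeries.coeff ((j : ℕ) + 1) (taylorPS K) ^ m j / ((m j).factorial : ℂ)) *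
      PowerSeries.coeff (l - i) (taylorPS h) * ((Real.exp (-(t * σ / 2) * u ^ 2) : ℂ) *
          ((-(t * u ^ 2) : ℂ) ^ (∑ j, m j) * (Complex.I * u) ^ l)) := fun i m =>
    (integrable_gaussian_monomial ht hσ (∑ j, m j) l).const_mul _
  simp only [coeff_taylorPS_exp_mul hK hh, Finset.sum_mul, Finset.mul_sum, ← integral_const_mul]
  simp only [← integral_finsetSum _ fun m _ => hi _ m]
  rw [← integral_finsetSum _ fun i _ => integrable_finsetSum _ fun m _ => hi i m]
  refine integral_congr_ae (ae_of_all _ fun u => ?_)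
  refine Finset.sum_congr rfl fun i _ => Finset.sum_congr rfl fun m _ => ?_
  ring

theorem integral_laplace_term_odd (hK : AnalyticAt ℂ K 0) (hh : AnalyticAt ℂ h 0)
    (ht : 0 < t) (hσ : 0 < σ) (k : ℕ) :
    ∫ u : ℝ, (Real.exp (-(t * σ / 2) * u ^ 2) : ℂ) *
      (PowerSeries.coeff (2 * k + 1)
        (taylorPS fun s => Complex.exp (-(t * u ^ 2) * (K s - K 0)) * h s) *
          (Complex.I * u) ^ (2 * k + 1)) = 0 := by
  rw [integral_laplace_term hK hh ht hσ]
  simp only [integral_gaussian_monomial_odd, mul_zero, Finset.sum_const_zero]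

theorem integral_laplace_term_even (hK : AnalyticAt ℂ K 0)
    (hh : AnalyticAt ℂ (fun s => h (θ + s)) 0)
    (hKη : ∀ n, PowerSeries.coeff n (taylorPS K) =
        iteratedDeriv (n + 2) η θ / ((n + 2).factorial : ℂ))
    (ht : 0 < t) (hσ : 0 < σ) (hση : iteratedDeriv 2 η θ = σ) (k : ℕ) :
    (√(t * σ / (2 * Real.pi)) : ℂ) * ∫ u : ℝ, (Real.exp (-(t * σ / 2) * u ^ 2) : ℂ) *
      (PowerSeries.coeff (2 * k)
        (taylorPS fun s => Complex.exp (-(t * u ^ 2) * (K s - K 0)) * h (θ + s)) *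
          (Complex.I * u) ^ (2 * k)) = coeffA η h θ k / (t : ℂ) ^ k := by
  have hσ0 : (σ : ℂ) ≠ 0 := by exact_mod_cast hσ.ne'
  rw [integral_laplace_term hK hh ht hσ, coeffA, Finset.mul_sum, Finset.sum_div]
  refine Finset.sum_congr rfl fun i _ => ?_
  rw [innerSum_eq hση hσ0, Finset.mul_sum, Finset.mul_sum, Finset.sum_div]
  refine Finset.sum_congr rfl fun m _ => ?_
  rw [mul_left_comm, integral_gaussian_monomial ht hσ, taylorPS_shift_coeff]
  simp only [hKη]
  ring

/-- Raising v by one adds the index 2v, which contributes the v-th coefficient over t^v, and the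
index 2v + 1, whose integral vanishes by parity. This is why the expansion runs in integer powers of
1 / t. -/
theorem integral_laplace_sum (hK : AnalyticAt ℂ K 0)
    (hh : AnalyticAt ℂ (fun s => h (θ + s)) 0)
    (hKη : ∀ n, PowerSeries.coeff n (taylorPS K) =
        iteratedDeriv (n + 2) η θ / ((n + 2).factorial : ℂ))
    (ht : 0 < t) (hσ : 0 < σ) (hση : iteratedDeriv 2 η θ = σ) (v : ℕ) :
    (√(t * σ / (2 * Real.pi)) : ℂ) * ∫ u : ℝ, ∑ l ∈ Finset.range (2 * v),
      (Real.exp (-(t * σ / 2) * u ^ 2) : ℂ) * (PowerSeries.coeff l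
        (taylorPS fun s => Complex.exp (-(t * u ^ 2) * (K s - K 0)) * h (θ + s)) *
          (Complex.I * u) ^ l) = ∑ k ∈ Finset.range v, coeffA η h θ k / (t : ℂ) ^ k := by
  rw [integral_finsetSum _ fun l _ => integrable_laplace_term hK hh ht hσ l]
  induction v with
  | zero => simp
  | succ v ih =>
    rw [show 2 * (v + 1) = 2 * v + 1 + 1 by ring, Finset.sum_range_succ, Finset.sum_range_succ,
      Finset.sum_range_succ, integral_laplace_term_odd hK hh ht hσ, add_zero, mul_add, ih,
      integral_laplace_term_even hK hh hKη ht hσ hση]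

end

end DiscreteHawkes

/-! ### Remainder estimate and Laplace's method -/

namespace DiscreteHawkes

/-- Near 0 the difference is the Gaussian times a Taylor remainder; away from 0 the integrand and
the polynomial are bounded separately, which is harmless because |u| is bounded below there. The
bound holds for all real u, so the polynomial terms may be integrated over the whole line. -/
theorem norm_laplace_integrand_sub_le {η h : ℂ → ℂ} {θ x : ℂ} {ρ σ c B : ℝ} (hρ : 0 < ρ)
    (hη : DifferentiableOn ℂ η (Metric.ball θ ρ)) (hh : DifferentiableOn ℂ h (Metric.ball θ ρ))
    (hx : deriv η θ = x) (hσ : 0 < σ) (hση : iteratedDeriv 2 η θ = σ) (hc : 0 < c)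
    (hdec : ∀ u ∈ Set.Ioc (-Real.pi) Real.pi,
      ‖Complex.exp (η (θ + Complex.I * u) - η θ - Complex.I * u * x)‖ ≤ Real.exp (-c * u ^ 2))
    (hB : ∀ u ∈ Set.Ioc (-Real.pi) Real.pi, ‖h (θ + Complex.I * u)‖ ≤ B) (N : ℕ) :
    ∃ (K : ℂ → ℂ) (C c' : ℝ), 0 < c' ∧ AnalyticAt ℂ K 0 ∧
      (∀ n, PowerSeries.coeff n (taylorPS K) =
        iteratedDeriv (n + 2) η θ / ((n + 2).factorial : ℂ)) ∧
      ∀ (t : ℕ) (u : ℝ),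
      ‖(Set.Ioc (-Real.pi) Real.pi).indicator (fun u : ℝ =>
          Complex.exp (t * (η (θ + Complex.I * u) - η θ - Complex.I * u * x)) *
            h (θ + Complex.I * u)) u -
        ∑ l ∈ Finset.range N, (Real.exp (-((t : ℝ) * σ / 2) * u ^ 2) : ℂ) *
          (PowerSeries.coeff l (taylorPS fun s =>
            Complex.exp (-(((t : ℝ) : ℂ) * u ^ 2) * (K s - K 0)) * h (θ + s)) *
              (Complex.I * u) ^ l)‖ ≤ C * (|u| ^ N * Real.exp (-(c' * t) * u ^ 2)) := by
  obtain ⟨K, hKd, hKη, hKc⟩ := exists_quadratic_quotient hρ hη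
  have hnhds : Metric.ball (0 : ℂ) ρ ∈ 𝓝 0 := Metric.ball_mem_nhds _ hρ
  have hKa : AnalyticAt ℂ K 0 := hKd.analyticAt hnhds
  have hhd : DifferentiableOn ℂ (fun s => h (θ + s)) (Metric.ball 0 ρ) := by
    refine hh.comp (by fun_prop) fun s hs => ?_
    simpa [Metric.mem_ball, dist_eq_norm] using hs
  have hha := hhd.analyticAt hnhds
  have hK0 : K 0 = σ / 2 := by
    have h1 := hKc 0
    rw [coeff_taylorPS, zero_add, hση, iteratedDeriv_zero] at h1
    simpa using h1
  -- a disc on which `K` is close to `K 0` and `h` is bounded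
  obtain ⟨δ, hδ0, hδ1, hδρ, hδK, hδh⟩ : ∃ δ : ℝ, 0 < δ ∧ δ ≤ 1 ∧ δ < ρ ∧
      (∀ s ∈ Metric.closedBall (0 : ℂ) δ, ‖K s - K 0‖ ≤ σ / 4) ∧
      ∀ s ∈ Metric.closedBall (0 : ℂ) δ, ‖h (θ + s)‖ ≤ ‖h θ‖ + 1 := by
    have e1 : ∀ᶠ s in 𝓝 (0 : ℂ), ‖K s - K 0‖ ≤ σ / 4 := by
      have := Metric.tendsto_nhds.mp hKa.continuousAt.tendsto (σ / 4) (by positivity)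
      filter_upwards [this] with s hs
      rw [← dist_eq_norm]; exact hs.le
    have e2 : ∀ᶠ s in 𝓝 (0 : ℂ), ‖h (θ + s)‖ ≤ ‖h θ‖ + 1 := by
      have := hha.continuousAt.norm.tendsto.eventually_le_const
        (u := ‖h θ‖ + 1) (by simp)
      exact this
    obtain ⟨ε, hε, hεb⟩ := Metric.eventually_nhds_iff_ball.mp (e1.and e2)
    have hm : 0 < min (min ε ρ) 1 := by positivity
    refine ⟨min (min ε ρ) 1 / 2, by positivity, ?_, ?_, fun s hs => ?_, fun s hs => ?_⟩
    · linarith [min_le_right (min ε ρ) 1]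
    · linarith [(min_le_left (min ε ρ) 1).trans (min_le_right ε ρ)]
    all_goals
      have : s ∈ Metric.ball (0 : ℂ) ε := by
        rw [mem_closedBall_zero_iff] at hs
        rw [mem_ball_zero_iff]
        linarith [(min_le_left (min ε ρ) 1).trans (min_le_left ε ρ)]
    · exact (hεb s this).1
    · exact (hεb s this).2
  set H : ℝ := ‖h θ‖ + 1 with hH
  have hH0 : 0 ≤ H := by positivity
  have hB0 : 0 ≤ B := (norm_nonneg _).trans (hB 0 ⟨by linarith [Real.pi_pos], Real.pi_pos.le⟩)
  set G : ℝ → ℂ → ℂ := fun q s => Complex.exp (-(q : ℂ) * (K s - K 0)) * h (θ + s) with hG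
  have hGd : ∀ q, DifferentiableOn ℂ (G q) (Metric.ball 0 ρ) := fun q =>
    ((hKd.sub_const _).const_mul _).cexp.mul hhd
  have hGA : ∀ q : ℝ, 0 ≤ q → ∀ s ∈ Metric.closedBall (0 : ℂ) δ,
      ‖G q s‖ ≤ Real.exp (q * (σ / 4)) * H := fun q hq s hs => by
    rw [norm_mul, Complex.norm_exp]
    refine mul_le_mul (Real.exp_le_exp.mpr ?_) (hδh s hs) (norm_nonneg _) (Real.exp_pos _).le
    calc (-(q : ℂ) * (K s - K 0)).re ≤ ‖-(q : ℂ) * (K s - K 0)‖ := Complex.re_le_norm _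
      _ = q * ‖K s - K 0‖ := by rw [norm_mul, norm_neg, Complex.norm_real, Real.norm_of_nonneg hq]
      _ ≤ q * (σ / 4) := by gcongr; exact hδK s hs
  -- The disc allows growth exp(q σ / 4) against the Gaussian exp(-q σ / 2), which leaves the rate σ
  -- / 4; the rate c comes from the decay hypothesis. In the constant below, the first entry of
  -- `max` serves |u| ≤ δ / 2 and the second |u| > δ / 2.
  set c' : ℝ := min c (σ / 4) with hc'
  refine ⟨K, max (2 * H / δ ^ N) (B * (2 / δ) ^ N + N * (H * (2 / δ) ^ N)), c', by positivity,
    hKa, hKc, fun t u => ?_⟩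
  set q : ℝ := t * u ^ 2 with hq
  have hq0 : 0 ≤ q := by positivity
  have hGq : (fun s => Complex.exp (-(((t : ℝ) : ℂ) * u ^ 2) * (K s - K 0)) * h (θ + s)) = G q := by
    simp only [hG, hq]
    push_cast
    rfl
  rw [hGq]
  have hEσ : Real.exp (-((t : ℝ) * σ / 2) * u ^ 2) * Real.exp (q * (σ / 4)) ≤
      Real.exp (-(c' * t) * u ^ 2) := by
    rw [← Real.exp_add, Real.exp_le_exp, hq]
    have : c' * (t * u ^ 2) ≤ σ / 4 * (t * u ^ 2) := by gcongr; exact min_le_right _ _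
    linarith
  have hEc : Real.exp (-c * u ^ 2) ^ t ≤ Real.exp (-(c' * t) * u ^ 2) := by
    rw [← Real.exp_nat_mul, Real.exp_le_exp]
    have : c' * (t * u ^ 2) ≤ c * (t * u ^ 2) := by gcongr; exact min_le_left _ _
    linarith
  have hIu : ‖Complex.I * (u : ℂ)‖ = |u| := by simp
  rcases le_or_gt |u| (δ / 2) with hu | hu
  · have humem : u ∈ Set.Ioc (-Real.pi) Real.pi := by
      have := abs_le.mp hu
      constructor <;> linarith [Real.pi_gt_three]
    rw [Set.indicator_of_mem humem]
    -- Since (i u)² = -u², the phase is -q K(i u). Its part -q K(0) = -q σ / 2 is the Gaussian and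
    -- the rest goes into `G q`.
    have hphase : Complex.exp (t * (η (θ + Complex.I * u) - η θ - Complex.I * u * x)) *
        h (θ + Complex.I * u) =
        (Real.exp (-((t : ℝ) * σ / 2) * u ^ 2) : ℂ) * G q (Complex.I * u) := by
      simp only [hG]
      rw [← mul_assoc, Complex.ofReal_exp, ← Complex.exp_add, hKη, hx, hK0, hq]
      congr 2
      push_cast
      rw [mul_pow, Complex.I_sq]
      ring
    rw [hphase, ← Finset.mul_sum, ← mul_sub, norm_mul, Complex.norm_real,
      Real.norm_of_nonneg (Real.exp_pos _).le]
    have hrem := norm_sub_taylor_le hδ0 hδρ (hGd q) (hGA q hq0) N (s := Complex.I * u)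
      (by rw [hIu]; exact hu)
    rw [hIu] at hrem
    calc _ ≤ Real.exp (-((t : ℝ) * σ / 2) * u ^ 2) *
          (2 * (Real.exp (q * (σ / 4)) * H) * (|u| / δ) ^ N) := by gcongr
      _ = (Real.exp (-((t : ℝ) * σ / 2) * u ^ 2) * Real.exp (q * (σ / 4))) *
          ((2 * H / δ ^ N) * |u| ^ N) := by rw [div_pow]; ring
      _ ≤ Real.exp (-(c' * t) * u ^ 2) * ((2 * H / δ ^ N) * |u| ^ N) := by gcongr
      _ = (2 * H / δ ^ N) * (|u| ^ N * Real.exp (-(c' * t) * u ^ 2)) := by ring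
      _ ≤ _ := by gcongr; exact le_max_left _ _
  -- Here 2|u| / δ exceeds 1, so the missing factor |u|^N can be inserted at the price (2 / δ)^N.
  · have h2u : 1 ≤ 2 / δ * |u| := by
      rw [div_mul_eq_mul_div, le_div_iff₀ hδ0]; linarith
    have hfirst : ‖(Set.Ioc (-Real.pi) Real.pi).indicator (fun u : ℝ =>
          Complex.exp (t * (η (θ + Complex.I * u) - η θ - Complex.I * u * x)) *
            h (θ + Complex.I * u)) u‖ ≤
        B * (2 / δ) ^ N * (|u| ^ N * Real.exp (-(c' * t) * u ^ 2)) := by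
      by_cases humem : u ∈ Set.Ioc (-Real.pi) Real.pi
      · rw [Set.indicator_of_mem humem, norm_mul, Complex.exp_nat_mul, norm_pow]
        calc _ ≤ Real.exp (-c * u ^ 2) ^ t * B := by
              gcongr
              · exact hdec u humem
              · exact hB u humem
          _ ≤ Real.exp (-(c' * t) * u ^ 2) * B := by gcongr
          _ = Real.exp (-(c' * t) * u ^ 2) * B * 1 := by ring
          _ ≤ Real.exp (-(c' * t) * u ^ 2) * B * (2 / δ * |u|) ^ N := by
              gcongr
              exact one_le_pow₀ h2u
          _ = _ := by rw [mul_pow]; ring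
      · rw [Set.indicator_of_notMem humem, norm_zero]
        positivity
    have hsecond : ‖∑ l ∈ Finset.range N, (Real.exp (-((t : ℝ) * σ / 2) * u ^ 2) : ℂ) *
          (PowerSeries.coeff l (taylorPS (G q)) * (Complex.I * u) ^ l)‖ ≤
        N * (H * (2 / δ) ^ N) * (|u| ^ N * Real.exp (-(c' * t) * u ^ 2)) := by
      have : ∀ l ∈ Finset.range N, ‖(Real.exp (-((t : ℝ) * σ / 2) * u ^ 2) : ℂ) *
          (PowerSeries.coeff l (taylorPS (G q)) * (Complex.I * u) ^ l)‖ ≤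
          H * (2 / δ) ^ N * (|u| ^ N * Real.exp (-(c' * t) * u ^ 2)) := fun l hl => by
        rw [norm_mul, norm_mul, norm_pow, hIu, Complex.norm_real,
          Real.norm_of_nonneg (Real.exp_pos _).le]
        have hpow : (|u| / δ) ^ l ≤ (2 / δ * |u|) ^ N := by
          calc (|u| / δ) ^ l ≤ (2 / δ * |u|) ^ l := by
                refine pow_le_pow_left₀ (by positivity) ?_ l
                rw [div_mul_eq_mul_div]
                gcongr
                linarith [abs_nonneg u]
            _ ≤ _ := pow_le_pow_right₀ h2u (Finset.mem_range.mp hl).le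
        calc _ ≤ Real.exp (-((t : ℝ) * σ / 2) * u ^ 2) *
              (Real.exp (q * (σ / 4)) * H / δ ^ l * |u| ^ l) := by
              gcongr
              exact norm_coeff_taylorPS_le hδ0 hδρ (hGd q) (hGA q hq0) l
          _ = (Real.exp (-((t : ℝ) * σ / 2) * u ^ 2) * Real.exp (q * (σ / 4))) *
              (H * (|u| / δ) ^ l) := by rw [div_pow]; ring
          _ ≤ Real.exp (-(c' * t) * u ^ 2) * (H * (2 / δ * |u|) ^ N) := by gcongr
          _ = _ := by rw [mul_pow]; ring
      refine (norm_sum_le_of_le _ this).trans_eq ?_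
      rw [Finset.sum_const, Finset.card_range, nsmul_eq_mul]
      ring
    refine (norm_sub_le _ _).trans ((add_le_add hfirst hsecond).trans ?_)
    rw [← add_mul]
    gcongr
    exact le_max_right _ _

/-- **Laplace's method** for the integral of `exp (t (η(z) - η(θ) - (z - θ) x)) h(z)` over the
segment `[θ - iπ, θ + iπ]`, with all terms of the expansion. -/
theorem laplace_expansion {η h : ℂ → ℂ} {θ x : ℂ} {ρ σ c : ℝ} (hρ : 0 < ρ)
    (hη : DifferentiableOn ℂ η (Metric.ball θ ρ)) (hh : DifferentiableOn ℂ h (Metric.ball θ ρ))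
    (hx : deriv η θ = x) (hσ : 0 < σ) (hση : iteratedDeriv 2 η θ = σ) (hc : 0 < c)
    (hηc : Continuous fun u : ℝ => η (θ + Complex.I * u))
    (hhc : Continuous fun u : ℝ => h (θ + Complex.I * u))
    (hdec : ∀ u ∈ Set.Ioc (-Real.pi) Real.pi,
      ‖Complex.exp (η (θ + Complex.I * u) - η θ - Complex.I * u * x)‖ ≤ Real.exp (-c * u ^ 2))
    (v : ℕ) :
    ∃ C : ℝ, ∀ t : ℕ, 0 < t →
      ‖(√(t * σ / (2 * Real.pi)) : ℂ) * (∫ u : ℝ in (-Real.pi)..Real.pi,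
          Complex.exp (t * (η (θ + Complex.I * u) - η θ - Complex.I * u * x)) *
            h (θ + Complex.I * u)) -
        ∑ k ∈ Finset.range v, coeffA η h θ k / (t : ℂ) ^ k‖ ≤ C / (t : ℝ) ^ v := by
  obtain ⟨B, hB⟩ := isCompact_Icc.exists_bound_of_continuousOn
    (s := Set.Icc (-Real.pi) Real.pi) hhc.continuousOn
  -- Order 2v is the right truncation: the moment of order 2v of a Gaussian of rate c' t is of size
  -- t^{-v} after the normalisation by √t.
  obtain ⟨K, C, c', hc', hKa, hKc, hbound⟩ := norm_laplace_integrand_sub_le hρ hη hh hx hσ hση hc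
    hdec (fun u hu => hB u (Set.Ioc_subset_Icc_self hu)) (2 * v)
  have hha : AnalyticAt ℂ (fun s => h (θ + s)) 0 := by
    refine AnalyticAt.fun_comp ?_ (by fun_prop)
    rw [add_zero]
    exact hh.analyticAt (Metric.ball_mem_nhds _ hρ)
  refine ⟨√(σ / (2 * c')) * C * ((2 * v - 1).doubleFactorial / (2 * c') ^ v), fun t ht => ?_⟩
  have ht' : (0 : ℝ) < t := by exact_mod_cast ht
  have hsum := integral_laplace_sum (t := (t : ℝ)) hKa hha hKc ht' hσ hση v
  rw [Complex.ofReal_natCast] at hsum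
  rw [← hsum, ← mul_sub, intervalIntegral.integral_of_le (by linarith [Real.pi_pos]),
    ← integral_indicator measurableSet_Ioc, ← integral_sub]
  · rw [norm_mul, Complex.norm_real, Real.norm_of_nonneg (Real.sqrt_nonneg _)]
    have habs : ∀ u : ℝ, |u| ^ (2 * v) = u ^ (2 * v) := fun u => (even_two_mul v).pow_abs u
    have hint := (integrable_pow_mul_gaussian (b := c' * t) (by positivity) (2 * v)).const_mul C
    have hle := norm_integral_le_of_norm_le hint (ae_of_all _ fun u => by
      have := hbound t u
      rw [habs, Complex.ofReal_natCast] at this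
      exact this)
    rw [integral_const_mul, integral_even_pow_mul_gaussian (by positivity)] at hle
    calc _ ≤ √(t * σ / (2 * Real.pi)) * (C * ((2 * v - 1).doubleFactorial / (2 * (c' * t)) ^ v *
          √(Real.pi / (c' * t)))) := by gcongr
      _ = (√(t * σ / (2 * Real.pi)) * √(Real.pi / (c' * t))) * C *
          ((2 * v - 1).doubleFactorial / (2 * (c' * t)) ^ v) := by ring
      _ = _ := by
        rw [← Real.sqrt_mul (by positivity)]
        have := Real.pi_pos
        rw [show (t : ℝ) * σ / (2 * Real.pi) * (Real.pi / (c' * t)) = σ / (2 * c') by field_simp,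
          ← mul_assoc 2 c', mul_pow (2 * c')]
        field_simp
  · rw [integrable_indicator_iff measurableSet_Ioc]
    refine (Continuous.integrableOn_Icc ?_).mono_set Set.Ioc_subset_Icc_self
    exact (Complex.continuous_exp.comp (continuous_const.mul
      ((hηc.sub continuous_const).sub (by fun_prop)))).mul hhc
  · have := integrable_finsetSum (Finset.range (2 * v))
      fun l _ => integrable_laplace_term (t := (t : ℝ)) hKa hha ht' hσ l
    rw [Complex.ofReal_natCast] at this
    exact this

end DiscreteHawkes

namespace DiscreteHawkes

/-! ### The moment generating function of the counting process -/

theorem hasSum_poisson_exp (r : NNReal) (g : ℂ) :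
    HasSum (fun n : ℕ => (Real.exp (-r) * r ^ n / n.factorial) • Complex.exp (g * n))
      (Complex.exp (r * (Complex.exp g - 1))) := by
  have h := (NormedSpace.expSeries_div_hasSum_exp ((r : ℂ) * Complex.exp g)).mul_left
    (Complex.exp (-(r : ℂ)))
  rw [← Complex.exp_eq_exp_ℂ, ← Complex.exp_add] at h
  have h1 : -(r : ℂ) + r * Complex.exp g = r * (Complex.exp g - 1) := by ring
  rw [h1] at h
  refine h.congr_fun fun n => ?_
  rw [Complex.real_smul, mul_pow, ← Complex.exp_nat_mul, mul_comm (n : ℂ) g]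
  push_cast
  rw [show Complex.ofReal (r : ℝ) = (r : ℂ) from rfl]
  ring

theorem integrable_poisson_exp (r : NNReal) (g : ℂ) :
    Integrable (fun n : ℕ => Complex.exp (g * n)) (poissonMeasure r) := by
  rw [integrable_poissonMeasure_iff]
  refine (hasSum_poisson_exp r g).summable.norm.congr fun n => ?_
  rw [norm_smul, Real.norm_of_nonneg (by positivity)]

theorem integral_poisson_exp (r : NNReal) (g : ℂ) :
    ∫ n : ℕ, Complex.exp (g * n) ∂(poissonMeasure r) = Complex.exp (r * (Complex.exp g - 1)) :=
  (hasSum_integral_poissonMeasure (integrable_poisson_exp r g)).unique (hasSum_poisson_exp r g)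

/-- The arrival numbers at the times `1, …, r` as a sequence that vanishes elsewhere. -/
def extendPath {r : ℕ} (y : Fin r → ℕ) (n : ℕ) : ℕ :=
  if h : 1 ≤ n ∧ n ≤ r then y ⟨n - 1, by omega⟩ else 0

/-- The arrival numbers at the times `1, …, r`. -/
def path {Ω : Type*} (X : ℕ → Ω → ℕ) (r : ℕ) (ω : Ω) : Fin r → ℕ := fun i => X (i + 1) ω

theorem extendPath_path {Ω : Type*} (X : ℕ → Ω → ℕ) {r s : ℕ} (hs : s ∈ Finset.Icc 1 r) (ω : Ω) :
    extendPath (path X r ω) s = X s ω := by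
  rw [Finset.mem_Icc] at hs
  rw [extendPath, dif_pos hs, path]
  simp only [Nat.sub_add_cancel hs.1]

theorem history_extendPath {Ω : Type*} (X : ℕ → Ω → ℕ) {r : ℕ} (y : Fin r → ℕ) :
    history X (r + 1) (extendPath y) = path X r ⁻¹' {y} := by
  ext ω
  simp only [history, Set.mem_ofPred_eq, Set.mem_preimage, Set.mem_singleton_iff, Finset.mem_Ico]
  constructor
  · intro h
    ext i
    have := h (i + 1) ⟨by omega, by omega⟩
    rw [extendPath, dif_pos ⟨by omega, by omega⟩] at this
    exact this
  · rintro h s hs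
    rw [← h, extendPath_path X (Finset.mem_Icc.mpr ⟨hs.1, by omega⟩)]

theorem intensity_eq (ν : ℝ) (α : ℕ → ℝ) (x : ℕ → ℕ) (r : ℕ) :
    intensity ν α x (r + 1) = ν + ∑ s ∈ Finset.Icc 1 r, α (r + 1 - s) * (x s : ℝ) := by
  rw [intensity]
  congr 1
  refine Finset.sum_nbij' (fun s => r + 1 - s) (fun s => r + 1 - s) ?_ ?_ ?_ ?_ ?_
  · intro s hs; simp only [Finset.mem_Ico, Finset.mem_Icc] at hs ⊢; omega
  · intro s hs; simp only [Finset.mem_Ico, Finset.mem_Icc] at hs ⊢; omega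
  · intro s hs; simp only [Finset.mem_Ico] at hs; omega
  · intro s hs; simp only [Finset.mem_Icc] at hs; omega
  · intro s hs
    simp only [Finset.mem_Ico] at hs
    rw [show r + 1 - (r + 1 - s) = s by omega]

/-- The conditional law of the arrival number at time `r + 1` given the earlier ones. -/
noncomputable def arrivalKernel (ν : ℝ) (α : ℕ → ℝ) (r : ℕ) : Kernel (Fin r → ℕ) ℕ :=
  Kernel.ofFunOfCountable fun y => poissonMeasure (intensity ν α (extendPath y) (r + 1)).toNNReal

theorem arrivalKernel_apply (ν : ℝ) (α : ℕ → ℝ) (r : ℕ) (y : Fin r → ℕ) :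
    arrivalKernel ν α r y =
      poissonMeasure (intensity ν α (extendPath y) (r + 1)).toNNReal := rfl

instance (ν : ℝ) (α : ℕ → ℝ) (r : ℕ) : IsMarkovKernel (arrivalKernel ν α r) :=
  ⟨fun _ => inferInstanceAs (IsProbabilityMeasure (poissonMeasure _))⟩

/-- The exponential of a weighted sum of the arrival numbers at the times `1, …, r`. -/
noncomputable def expSum {Ω : Type*} (X : ℕ → Ω → ℕ) (r : ℕ) (g : ℕ → ℂ) (ω : Ω) : ℂ :=
  Complex.exp (∑ s ∈ Finset.Icc 1 r, g s * (X s ω : ℂ))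

/-- The same as a function of the path. -/
noncomputable def expSumPath (r : ℕ) (g : ℕ → ℂ) (y : Fin r → ℕ) : ℂ :=
  Complex.exp (∑ s ∈ Finset.Icc 1 r, g s * (extendPath y s : ℂ))

theorem expSum_eq {Ω : Type*} (X : ℕ → Ω → ℕ) (r : ℕ) (g : ℕ → ℂ) (ω : Ω) :
    expSum X r g ω = expSumPath r g (path X r ω) := by
  rw [expSum, expSumPath]
  congr 1
  exact Finset.sum_congr rfl fun s hs => by rw [extendPath_path X hs]

variable {Ω : Type*} [MeasurableSpace Ω] {P : Measure Ω}
  {ν : ℝ} {α : ℕ → ℝ} {X : ℕ → Ω → ℕ}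

theorem measurable_path (hX : IsDiscreteHawkes P ν α X) (r : ℕ) : Measurable (path X r) :=
  measurable_pi_lambda _ fun i => hX.measurable (i + 1)

/-- Paths are countable, so the joint law is determined by singletons, on which the elementary
conditional law in the definition is exactly the product formula for the kernel. -/
theorem map_path_succ [IsProbabilityMeasure P] (hX : IsDiscreteHawkes P ν α X) (r : ℕ) :
    P.map (fun ω => (path X r ω, X (r + 1) ω)) = (P.map (path X r)) ⊗ₘ arrivalKernel ν α r := by
  refine Measure.ext_of_singleton fun ⟨y, k⟩ => ?_
  have hm := measurable_path hX r
  have hk := hX.measurable (r + 1)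
  rw [Measure.map_apply (hm.prodMk hk) (measurableSet_singleton _),
    ← Set.singleton_prod_singleton, Measure.compProd_apply_prod (measurableSet_singleton _)
      (measurableSet_singleton _), lintegral_singleton, Measure.map_apply hm
      (measurableSet_singleton _), ← history_extendPath, mul_comm]
  have := hX.condLaw (r + 1) (by omega) (extendPath y) k
  refine Eq.trans ?_ this
  congr 1
  rw [history_extendPath]
  ext ω
  simp [Prod.ext_iff]

/-- The Poisson mean is affine in the past, so the Poisson transform is again an exponential of a
linear form in the past. This closure property is why arbitrary weights, not just a constant z, are
carried along. -/
theorem integral_arrival_exp (hν : 0 ≤ ν) (hα : ∀ i, 0 ≤ α i) {r : ℕ} (y : Fin r → ℕ) (g : ℂ) :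
    ∫ k : ℕ, Complex.exp (g * k) ∂(arrivalKernel ν α r y) =
      Complex.exp (ν * (Complex.exp g - 1)) * Complex.exp (∑ s ∈ Finset.Icc 1 r,
        (α (r + 1 - s) : ℂ) * (Complex.exp g - 1) * (extendPath y s : ℂ)) := by
  have hpos : 0 ≤ intensity ν α (extendPath y) (r + 1) := by
    rw [intensity]
    exact add_nonneg hν (Finset.sum_nonneg fun s _ => mul_nonneg (hα s) (Nat.cast_nonneg _))
  have := integral_poisson_exp (intensity ν α (extendPath y) (r + 1)).toNNReal g
  refine Eq.trans this ?_
  rw [← Complex.exp_add]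
  congr 1
  have hc : (((intensity ν α (extendPath y) (r + 1)).toNNReal : ℝ) : ℂ) =
      (intensity ν α (extendPath y) (r + 1) : ℂ) := by rw [Real.coe_toNNReal _ hpos]
  rw [show ((intensity ν α (extendPath y) (r + 1)).toNNReal : ℂ) =
    (((intensity ν α (extendPath y) (r + 1)).toNNReal : ℝ) : ℂ) from rfl, hc, intensity_eq]
  push_cast
  rw [add_mul, Finset.sum_mul]
  congr 1
  exact Finset.sum_congr rfl fun s _ => by ring

theorem expSumPath_mul {r : ℕ} (g g' : ℕ → ℂ) (y : Fin r → ℕ) :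
    expSumPath r g y * expSumPath r g' y = expSumPath r (fun s => g s + g' s) y := by
  rw [expSumPath, expSumPath, expSumPath, ← Complex.exp_add, ← Finset.sum_add_distrib]
  congr 1
  exact Finset.sum_congr rfl fun s _ => by ring

theorem expSum_succ {Ω : Type*} (X : ℕ → Ω → ℕ) (r : ℕ) (g : ℕ → ℂ) (ω : Ω) :
    expSum X (r + 1) g ω =
      expSumPath r g (path X r ω) * Complex.exp (g (r + 1) * (X (r + 1) ω : ℂ)) := by
  rw [← expSum_eq, expSum, expSum, Finset.sum_Icc_succ_top (by omega), Complex.exp_add]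

theorem norm_integral_arrival {r : ℕ} (y : Fin r → ℕ) (g : ℂ) :
    ∫ k : ℕ, ‖Complex.exp (g * k)‖ ∂(arrivalKernel ν α r y) =
      ‖∫ k : ℕ, Complex.exp ((g.re : ℂ) * k) ∂(arrivalKernel ν α r y)‖ := by
  have : ∀ k : ℕ, Complex.exp ((g.re : ℂ) * k) = ((‖Complex.exp (g * k)‖ : ℝ) : ℂ) := fun k => by
    rw [Complex.norm_exp]
    push_cast
    simp
  simp only [this]
  rw [integral_complex_ofReal, Complex.norm_real, Real.norm_of_nonneg]
  exact integral_nonneg fun k => norm_nonneg _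

theorem integrable_arrival_exp {r : ℕ} (y : Fin r → ℕ) (a : ℂ) :
    Integrable (fun k : ℕ => Complex.exp (a * k)) (arrivalKernel ν α r y) := by
  rw [arrivalKernel_apply]
  exact integrable_poisson_exp _ a

/-- The norm of exp(a k) is exp(Re(a) k), whose conditional mean is an exponential sum over the past
with new weights. Hence integrability is assumed for all weights at once, which is what the
induction on r needs. -/
theorem integrable_compProd_arrival (hν : 0 ≤ ν) (hα : ∀ i, 0 ≤ α i) {r : ℕ}
    {μ : Measure (Fin r → ℕ)} [IsFiniteMeasure μ]
    (hμ : ∀ g, Integrable (expSumPath r g) μ) (g : ℕ → ℂ) (a : ℂ) :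
    Integrable (fun p : (Fin r → ℕ) × ℕ => expSumPath r g p.1 * Complex.exp (a * p.2))
      (μ ⊗ₘ arrivalKernel ν α r) := by
  rw [Measure.integrable_compProd_iff AEStronglyMeasurable.of_discrete]
  refine ⟨ae_of_all _ fun y => ?_, ?_⟩
  · exact (integrable_arrival_exp y a).const_mul (expSumPath r g y)
  simp only [norm_mul, integral_const_mul, norm_integral_arrival, integral_arrival_exp hν hα]
  have := (hμ fun s => g s + (α (r + 1 - s) : ℂ) * (Complex.exp a.re - 1)).norm.const_mul
    ‖Complex.exp (ν * (Complex.exp a.re - 1))‖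
  refine this.congr (ae_of_all _ fun y => ?_)
  simp only
  rw [← expSumPath_mul, norm_mul]
  rw [expSumPath, expSumPath]
  ring

theorem integrable_expSumPath [IsProbabilityMeasure P] (hν : 0 ≤ ν) (hα : ∀ i, 0 ≤ α i)
    (hX : IsDiscreteHawkes P ν α X) (r : ℕ) (g : ℕ → ℂ) :
    Integrable (expSumPath r g) (P.map (path X r)) := by
  induction r generalizing g with
  | zero =>
    have := Measure.isProbabilityMeasure_map (μ := P) (measurable_path hX 0).aemeasurable
    have h1 : expSumPath 0 g = fun _ => 1 := by ext y; simp [expSumPath]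
    rw [h1]
    exact integrable_const _
  | succ r ih =>
    have := Measure.isProbabilityMeasure_map (μ := P) (measurable_path hX r).aemeasurable
    have h := integrable_compProd_arrival hν hα ih g (g (r + 1))
    rw [← map_path_succ hX, integrable_map_measure AEStronglyMeasurable.of_discrete
      ((measurable_path hX r).prodMk (hX.measurable (r + 1))).aemeasurable] at h
    rw [integrable_map_measure AEStronglyMeasurable.of_discrete
      (measurable_path hX (r + 1)).aemeasurable]
    refine h.congr (ae_of_all _ fun ω => ?_)
    simp only [Function.comp]
    rw [← expSum_succ, expSum_eq]

theorem integrable_expSum [IsProbabilityMeasure P] (hν : 0 ≤ ν) (hα : ∀ i, 0 ≤ α i)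
    (hX : IsDiscreteHawkes P ν α X) (r : ℕ) (g : ℕ → ℂ) : Integrable (expSum X r g) P := by
  have := integrable_expSumPath hν hα hX r g
  rw [integrable_map_measure AEStronglyMeasurable.of_discrete
      (measurable_path hX r).aemeasurable] at this
  exact this.congr (ae_of_all _ fun ω => (expSum_eq X r g ω).symm)

theorem integral_expSum_succ [IsProbabilityMeasure P] (hν : 0 ≤ ν) (hα : ∀ i, 0 ≤ α i)
    (hX : IsDiscreteHawkes P ν α X) (r : ℕ) (g : ℕ → ℂ) :
    ∫ ω, expSum X (r + 1) g ω ∂P = Complex.exp (ν * (Complex.exp (g (r + 1)) - 1)) *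
      ∫ ω, expSum X r (fun s => g s + (α (r + 1 - s) : ℂ) * (Complex.exp (g (r + 1)) - 1)) ω ∂P := by
  have := Measure.isProbabilityMeasure_map (μ := P) (measurable_path hX r).aemeasurable
  have hi := integrable_compProd_arrival hν hα (integrable_expSumPath hν hα hX r) g (g (r + 1))
  have h1 := Measure.integral_compProd hi
  rw [← map_path_succ hX, integral_map ((measurable_path hX r).prodMk
    (hX.measurable (r + 1))).aemeasurable AEStronglyMeasurable.of_discrete] at h1
  simp only [expSum_succ]
  rw [h1]
  simp only [integral_const_mul, integral_arrival_exp hν hα]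
  rw [integral_map (measurable_path hX r).aemeasurable AEStronglyMeasurable.of_discrete,
    ← integral_const_mul]
  refine integral_congr_ae (ae_of_all _ fun ω => ?_)
  simp only
  rw [expSum_eq, ← expSumPath_mul, mul_left_comm]
  rfl

theorem f_eq_sum_range (α : ℕ → ℝ) (s : ℕ) (z : ℂ) :
    f α s z = z + ∑ i ∈ Finset.range s, (α (s - i) : ℂ) * (Complex.exp (f α i z) - 1) := by
  rw [f_eq]
  congr 1
  refine Finset.sum_nbij' (fun i => s - i) (fun i => s - i) ?_ ?_ ?_ ?_ ?_
  · intro i hi; simp only [Finset.mem_Icc, Finset.mem_range] at hi ⊢; omega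
  · intro i hi; simp only [Finset.mem_Icc, Finset.mem_range] at hi ⊢; omega
  · intro i hi; simp only [Finset.mem_Icc] at hi; omega
  · intro i hi; simp only [Finset.mem_range] at hi; omega
  · intro i hi
    simp only [Finset.mem_Icc] at hi
    rw [show s - (s - i) = i by omega]

/-- The moment generating function of `N_t`. -/
theorem integral_exp_count [IsProbabilityMeasure P] (hν : 0 ≤ ν) (hα : ∀ i, 0 ≤ α i)
    (hX : IsDiscreteHawkes P ν α X) (t : ℕ) (z : ℂ) :
    ∫ ω, Complex.exp (z * (count X t ω : ℂ)) ∂P =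
      Complex.exp (ν * ∑ s ∈ Finset.range t, (Complex.exp (f α s z) - 1)) := by
  -- After the last j arrivals are averaged out, X_s carries the weight shown. At s = t - j this
  -- weight is f_j(z) by the recursion (`hg`), so the next averaging produces the factor with
  -- e^{f_j(z)} - 1.
  have key : ∀ j ≤ t, ∫ ω, expSum X t (fun _ => z) ω ∂P =
      Complex.exp (ν * ∑ s ∈ Finset.range j, (Complex.exp (f α s z) - 1)) *
        ∫ ω, expSum X (t - j) (fun s => z + ∑ i ∈ Finset.range j,
          (α (t - i - s) : ℂ) * (Complex.exp (f α i z) - 1)) ω ∂P := by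
    intro j
    induction j with
    | zero => simp
    | succ j ih =>
      intro hj
      rw [ih (by omega)]
      obtain ⟨r, hr⟩ : ∃ r, t = r + 1 + j := ⟨t - (j + 1), by omega⟩
      have hr1 : t - j = r + 1 := by omega
      have hr2 : t - (j + 1) = r := by omega
      rw [hr1, hr2, integral_expSum_succ hν hα hX]
      have hg : z + ∑ i ∈ Finset.range j, (α (t - i - (r + 1)) : ℂ) * (Complex.exp (f α i z) - 1) =
          f α j z := by
        rw [f_eq_sum_range α j]
        congr 1
        refine Finset.sum_congr rfl fun i _ => ?_
        rw [show t - i - (r + 1) = j - i by omega]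
      have hg' : ∀ s, z + ∑ i ∈ Finset.range j, (α (t - i - s) : ℂ) *
          (Complex.exp (f α i z) - 1) + (α (r + 1 - s) : ℂ) * (Complex.exp (f α j z) - 1) =
          z + ∑ i ∈ Finset.range (j + 1), (α (t - i - s) : ℂ) * (Complex.exp (f α i z) - 1) := by
        intro s
        rw [Finset.sum_range_succ, hr1, add_assoc]
      simp only [hg, hg']
      rw [← mul_assoc, ← Complex.exp_add, ← mul_add, Finset.sum_range_succ]
  have := key t le_rfl
  simp only [Nat.sub_self, expSum, Finset.Icc_eq_empty (show ¬ 1 ≤ 0 by omega), Finset.sum_empty,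
    Complex.exp_zero, integral_const, probReal_univ, one_smul, mul_one] at this
  rw [← this]
  refine integral_congr_ae (ae_of_all _ fun ω => ?_)
  simp only [count]
  push_cast
  rw [Finset.mul_sum]

theorem integrable_exp_count [IsProbabilityMeasure P] (hν : 0 ≤ ν) (hα : ∀ i, 0 ≤ α i)
    (hX : IsDiscreteHawkes P ν α X) (t : ℕ) (z : ℂ) :
    Integrable (fun ω => Complex.exp (z * (count X t ω : ℂ))) P := by
  refine (integrable_expSum hν hα hX t fun _ => z).congr (ae_of_all _ fun ω => ?_)
  simp only [count, expSum]
  push_cast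
  rw [Finset.mul_sum]

end DiscreteHawkes

namespace DiscreteHawkes

/-! ### Fourier inversion -/

theorem integral_exp_int_mul (θ : ℝ) (j : ℤ) :
    ∫ u : ℝ in (-Real.pi)..Real.pi, Complex.exp (j * (θ + Complex.I * u)) =
      if j = 0 then 2 * (Real.pi : ℂ) else 0 := by
  split_ifs with hj
  · simp only [hj, Int.cast_zero, zero_mul, Complex.exp_zero, intervalIntegral.integral_const,
      sub_neg_eq_add, Complex.real_smul, mul_one]
    push_cast
    ring
  · have hc : (j : ℂ) * Complex.I ≠ 0 :=
      mul_ne_zero (by exact_mod_cast hj) Complex.I_ne_zero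
    have h1 : ∀ u : ℝ, Complex.exp (j * (θ + Complex.I * u)) =
        Complex.exp (j * θ) * Complex.exp (j * Complex.I * u) := fun u => by
      rw [← Complex.exp_add]; ring_nf
    simp only [h1]
    rw [intervalIntegral.integral_const_mul, integral_exp_mul_complex hc]
    have h2 : Complex.exp (j * Complex.I * (Real.pi : ℝ)) =
        Complex.exp (j * Complex.I * ((-Real.pi : ℝ) : ℂ)) := by
      rw [Complex.exp_eq_exp_iff_exists_int]
      exact ⟨j, by push_cast; ring⟩
    rw [h2, sub_self, zero_div, mul_zero]

theorem norm_exp_neg_lt_one {θ : ℝ} (hθ : 0 < θ) (u : ℝ) :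
    ‖Complex.exp (-(θ + Complex.I * u))‖ < 1 := by
  rw [Complex.norm_exp]
  simpa using hθ

theorem one_sub_exp_neg_ne_zero {θ : ℝ} (hθ : 0 < θ) (u : ℝ) :
    1 - Complex.exp (-(θ + Complex.I * u)) ≠ 0 := by
  intro h
  have := norm_exp_neg_lt_one hθ u
  rw [← sub_eq_zero.mp h, norm_one] at this
  exact lt_irrefl _ this

/-- Expanding 1 / (1 - e^{-z}) as a geometric series, convergent since θ > 0, leaves the
orthogonality integrals of the frequencies j - k with k ≥ 0; one of them survives exactly when j ≥
0. -/
theorem integral_exp_int_mul_div {θ : ℝ} (hθ : 0 < θ) (j : ℤ) :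
    ∫ u : ℝ in (-Real.pi)..Real.pi, Complex.exp (j * (θ + Complex.I * u)) /
        (1 - Complex.exp (-(θ + Complex.I * u))) =
      if 0 ≤ j then 2 * (Real.pi : ℂ) else 0 := by
  have hr : Real.exp (-θ) < 1 := by rw [Real.exp_lt_one_iff]; linarith
  have hsum : HasSum (fun k : ℕ => ∫ u : ℝ in (-Real.pi)..Real.pi,
      Complex.exp (((j - k : ℤ) : ℂ) * (θ + Complex.I * u)))
      (∫ u : ℝ in (-Real.pi)..Real.pi, Complex.exp (j * (θ + Complex.I * u)) /
        (1 - Complex.exp (-(θ + Complex.I * u)))) := by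
    refine intervalIntegral.hasSum_integral_of_dominated_convergence
      (fun k _ => Real.exp (j * θ) * Real.exp (-θ) ^ k) (fun k => ?_) (fun k => ?_) ?_ ?_ ?_
    · exact (by fun_prop : Continuous _).aestronglyMeasurable
    · refine ae_of_all _ fun u _ => le_of_eq ?_
      rw [Complex.norm_exp, ← Real.exp_nat_mul, ← Real.exp_add]
      congr 1
      simp
      ring
    · exact ae_of_all _ fun u _ => (summable_geometric_of_lt_one (Real.exp_pos _).le hr).mul_left _
    · exact continuous_const.intervalIntegrable _ _
    · refine ae_of_all _ fun u _ => ?_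
      have := (hasSum_geometric_of_norm_lt_one (norm_exp_neg_lt_one hθ u)).mul_left
        (Complex.exp (j * (θ + Complex.I * u)))
      rw [div_eq_mul_inv]
      refine this.congr_fun fun k => ?_
      rw [← Complex.exp_nat_mul, ← Complex.exp_add]
      congr 1
      push_cast
      ring
  refine hsum.unique ?_
  simp only [integral_exp_int_mul]
  split_ifs with hj
  · obtain ⟨n, rfl⟩ := Int.eq_ofNat_of_zero_le hj
    have := hasSum_ite_eq n (2 * (Real.pi : ℂ))
    refine this.congr_fun fun k => ?_
    simp only [sub_eq_zero, Nat.cast_inj, eq_comm]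
  · refine hasSum_zero.congr_fun fun k => ?_
    rw [if_neg (by omega)]

theorem measurable_count {Ω : Type*} [MeasurableSpace Ω] {P : Measure Ω} {ν : ℝ} {α : ℕ → ℝ}
    {X : ℕ → Ω → ℕ} (hX : IsDiscreteHawkes P ν α X) (t : ℕ) : Measurable (count X t) :=
  Finset.measurable_fun_sum _ fun s _ => hX.measurable s

/-- Fubini, stated with a weight w to cover both inversions: w = 1 for point probabilities and w = 1
/ (1 - e^{-z}) for tails. The integrand is dominated because |exp(z N)| depends only on Re z = θ. -/
theorem integral_fourier_swap {Ω : Type*} [MeasurableSpace Ω] {P : Measure Ω}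
    [IsProbabilityMeasure P] {N : Ω → ℕ} (hN : Measurable N) {θ : ℝ}
    (hi : Integrable (fun ω => Complex.exp (θ * (N ω : ℂ))) P) (n : ℕ) {w : ℝ → ℂ}
    (hw : Continuous w) :
    ∫ u : ℝ in (-Real.pi)..Real.pi, Complex.exp (-(n * (θ + Complex.I * u))) * w u *
        ∫ ω, Complex.exp ((θ + Complex.I * u) * (N ω : ℂ)) ∂P =
      ∫ ω, (∫ u : ℝ in (-Real.pi)..Real.pi,
        Complex.exp ((((N ω : ℤ) - n : ℤ) : ℂ) * (θ + Complex.I * u)) * w u) ∂P := by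
  have hπ : -Real.pi ≤ Real.pi := by linarith [Real.pi_pos]
  simp only [intervalIntegral.integral_of_le hπ]
  have hwi : Integrable w (volume.restrict (Set.Ioc (-Real.pi) Real.pi)) :=
    hw.integrableOn_Icc.mono_set Set.Ioc_subset_Icc_self
  have hNc : Measurable fun ω => ((N ω : ℕ) : ℂ) := (measurable_of_countable _).comp hN
  rw [← integral_integral_swap]
  · refine integral_congr_ae (ae_of_all _ fun u => ?_)
    simp only [← integral_const_mul]
    refine integral_congr_ae (ae_of_all _ fun ω => ?_)
    simp only
    rw [mul_right_comm, ← Complex.exp_add]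
    congr 2
    push_cast
    ring
  · have hprod := (hwi.norm.mul_prod hi.norm).const_mul (Real.exp (-(n * θ)))
    refine hprod.mono' ?_ (ae_of_all _ fun p => le_of_eq ?_)
    · have h1 : Measurable fun p : ℝ × Ω => ((N p.2 : ℕ) : ℂ) := hNc.comp measurable_snd
      have h2 : Measurable fun p : ℝ × Ω => w p.1 := hw.measurable.comp measurable_fst
      refine Measurable.aestronglyMeasurable ?_
      simp only [Function.uncurry_def]
      push_cast
      fun_prop
    · simp only [Function.uncurry_def]
      rw [norm_mul, Complex.norm_exp, Complex.norm_exp, mul_left_comm, ← Real.exp_add, mul_comm]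
      congr 2
      simp
      ring

section
variable {Ω : Type*} [MeasurableSpace Ω] {P : Measure Ω} [IsProbabilityMeasure P]
  {ν : ℝ} {α : ℕ → ℝ} {X : ℕ → Ω → ℕ}

theorem integral_ite_const {Ω : Type*} [MeasurableSpace Ω] (P : Measure Ω) (p : Ω → Prop)
    [DecidablePred p] (hp : MeasurableSet {ω | p ω}) (c : ℂ) :
    ∫ ω, (if p ω then c else 0) ∂P = c * (P.real {ω | p ω} : ℂ) := by
  have : (fun ω => if p ω then c else 0) = {ω | p ω}.indicator fun _ => c := by
    ext ω
    simp [Set.indicator_apply]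
  rw [this, integral_indicator_const c hp, Complex.real_smul, mul_comm]

theorem point_inversion (hν : 0 ≤ ν) (hα : ∀ i, 0 ≤ α i)
    (hX : IsDiscreteHawkes P ν α X) (t n : ℕ) (θ : ℝ) :
    2 * (Real.pi : ℂ) * (P.real {ω | count X t ω = n} : ℂ) =
      ∫ u : ℝ in (-Real.pi)..Real.pi, Complex.exp (-(n * (θ + Complex.I * u))) *
        Complex.exp (ν * ∑ s ∈ Finset.range t,
          (Complex.exp (f α s (θ + Complex.I * u)) - 1)) := by
  have h := integral_fourier_swap (measurable_count hX t)
    (integrable_exp_count hν hα hX t θ) n (w := fun _ => 1) continuous_const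
  simp only [mul_one, integral_exp_count hν hα hX, integral_exp_int_mul] at h
  rw [h, ← integral_ite_const P (fun ω => count X t ω = n)
    (measurable_count hX t (measurableSet_singleton n))]
  refine integral_congr_ae (ae_of_all _ fun ω => ?_)
  simp [sub_eq_zero]

theorem tail_inversion (hν : 0 ≤ ν) (hα : ∀ i, 0 ≤ α i)
    (hX : IsDiscreteHawkes P ν α X) (t n : ℕ) {θ : ℝ} (hθ : 0 < θ) :
    2 * (Real.pi : ℂ) * (P.real {ω | n ≤ count X t ω} : ℂ) =
      ∫ u : ℝ in (-Real.pi)..Real.pi, Complex.exp (-(n * (θ + Complex.I * u))) *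
        (1 - Complex.exp (-(θ + Complex.I * u)))⁻¹ *
        Complex.exp (ν * ∑ s ∈ Finset.range t,
          (Complex.exp (f α s (θ + Complex.I * u)) - 1)) := by
  have hw : Continuous fun u : ℝ => (1 - Complex.exp (-((θ : ℂ) + Complex.I * u)))⁻¹ :=
    Continuous.inv₀ (by fun_prop) (one_sub_exp_neg_ne_zero hθ)
  have h := integral_fourier_swap (measurable_count hX t)
    (integrable_exp_count hν hα hX t θ) n hw
  simp only [← div_eq_mul_inv, integral_exp_count hν hα hX, integral_exp_int_mul_div hθ] at h ⊢
  rw [h, ← integral_ite_const P (fun ω => n ≤ count X t ω)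
    (measurable_count hX t (measurableSet_Ici (a := n)))]
  refine integral_congr_ae (ae_of_all _ fun ω => ?_)
  simp
end

end DiscreteHawkes

namespace DiscreteHawkes

/-! ### Contraction properties of the exponential -/

/-- With w = a + ib, |1 - e^w|² = (1 - e^a)² + 2 e^a (1 - cos b), and for a ≤ 0 the two terms are at
most a² and b². The second is strict if b ≠ 0, the first if b = 0, since then a ≠ 0. -/
theorem norm_one_sub_exp_lt {w : ℂ} (hre : w.re ≤ 0) (hw : w ≠ 0) :
    ‖1 - Complex.exp w‖ < ‖w‖ := by
  have hsq : ‖1 - Complex.exp w‖ ^ 2 < ‖w‖ ^ 2 := by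
    rw [← Complex.normSq_eq_norm_sq, ← Complex.normSq_eq_norm_sq, Complex.normSq_apply,
      Complex.normSq_apply]
    simp only [Complex.sub_re, Complex.sub_im, Complex.one_re, Complex.one_im, Complex.exp_re,
      Complex.exp_im]
    set a := w.re
    set b := w.im
    have he1 : Real.exp a ≤ 1 := Real.exp_le_one_iff.mpr hre
    have he0 := Real.exp_pos a
    have hea := Real.add_one_le_exp a
    have hcs := Real.sin_sq_add_cos_sq b
    have hcos1 := Real.cos_le_one b
    have hcos := Real.one_sub_sq_div_two_le_cos (x := b)
    have hid : (1 - Real.exp a * Real.cos b) * (1 - Real.exp a * Real.cos b) +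
        (0 - Real.exp a * Real.sin b) * (0 - Real.exp a * Real.sin b) =
        (1 - Real.exp a) ^ 2 + 2 * Real.exp a * (1 - Real.cos b) := by
      linear_combination Real.exp a ^ 2 * hcs
    rw [hid]
    by_cases hb : b = 0
    · have ha : a ≠ 0 := fun ha => hw (Complex.ext ha hb)
      have hlt := Real.add_one_lt_exp ha
      rw [hb, Real.cos_zero]
      nlinarith
    · have hlt := Real.one_sub_sq_div_two_lt_cos hb
      have h1 : 2 * Real.exp a * (1 - Real.cos b) ≤ 2 * (1 - Real.cos b) := by nlinarith
      nlinarith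
  exact lt_of_pow_lt_pow_left₀ 2 (norm_nonneg _) hsq

theorem norm_one_sub_exp_le {w : ℂ} (hre : w.re ≤ 0) : ‖1 - Complex.exp w‖ ≤ ‖w‖ := by
  by_cases hw : w = 0
  · simp [hw]
  · exact (norm_one_sub_exp_lt hre hw).le

/-- Factoring out the exponential with the larger real part leaves 1 - e^w with w = ±(a - b) in the
left half-plane. -/
theorem exists_norm_exp_sub_exp_le {a b : ℂ} {L : ℝ} (ha : a.re ≤ L) (hb : b.re ≤ L) :
    ∃ w : ℂ, ‖w‖ = ‖a - b‖ ∧ w.re ≤ 0 ∧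
      ‖Complex.exp a - Complex.exp b‖ ≤ Real.exp L * ‖1 - Complex.exp w‖ := by
  have key : ∀ {a b : ℂ}, a.re ≤ L → b.re ≤ a.re →
      ‖Complex.exp a - Complex.exp b‖ ≤ Real.exp L * ‖1 - Complex.exp (b - a)‖ := by
    intro a b ha _
    have : Complex.exp a - Complex.exp b = Complex.exp a * (1 - Complex.exp (b - a)) := by
      rw [mul_sub, ← Complex.exp_add]; ring_nf
    rw [this, norm_mul, Complex.norm_exp]
    gcongr
  rcases le_total b.re a.re with h | h
  · exact ⟨b - a, norm_sub_rev _ _, by simpa using h, key ha h⟩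
  · refine ⟨a - b, rfl, by simpa using h, ?_⟩
    rw [norm_sub_rev]
    exact key hb h

theorem norm_exp_sub_exp_le {a b : ℂ} {L : ℝ} (ha : a.re ≤ L) (hb : b.re ≤ L) :
    ‖Complex.exp a - Complex.exp b‖ ≤ Real.exp L * ‖a - b‖ := by
  obtain ⟨w, hw, hre, hle⟩ := exists_norm_exp_sub_exp_le ha hb
  refine hle.trans ?_
  rw [← hw]
  gcongr
  exact norm_one_sub_exp_le hre

theorem norm_exp_sub_exp_lt {a b : ℂ} {L : ℝ} (ha : a.re ≤ L) (hb : b.re ≤ L) (hab : a ≠ b) :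
    ‖Complex.exp a - Complex.exp b‖ < Real.exp L * ‖a - b‖ := by
  obtain ⟨w, hw, hre, hle⟩ := exists_norm_exp_sub_exp_le ha hb
  refine hle.trans_lt ?_
  have hw0 : w ≠ 0 := by
    rw [← norm_ne_zero_iff, hw, norm_ne_zero_iff]
    exact sub_ne_zero.mpr hab
  rw [← hw]
  gcongr
  exact norm_one_sub_exp_lt hre hw0

/-- The ratio |1 - e^w| / |w| is continuous and below 1 on the compact set r ≤ |w| ≤ B, Re w ≤ 0. It
tends to 1 at the origin, so no single κ serves without the cut-off r. -/
theorem exists_contraction_away_from_zero {r : ℝ} (hr : 0 < r) (B : ℝ) :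
    ∃ κ : ℝ, 0 ≤ κ ∧ κ < 1 ∧ ∀ w : ℂ, w.re ≤ 0 → ‖w‖ ≤ B →
      ‖1 - Complex.exp w‖ ≤ max r (κ * ‖w‖) := by
  set S : Set ℂ := Metric.closedBall 0 B ∩ ({w | w.re ≤ 0} ∩ {w | r ≤ ‖w‖}) with hS
  have hcompact : IsCompact S := (isCompact_closedBall 0 B).inter_right
    ((isClosed_le Complex.continuous_re continuous_const).inter
      (isClosed_le continuous_const continuous_norm))
  have hne : ∀ w ∈ S, ‖w‖ ≠ 0 := fun w hw => (hr.trans_le hw.2.2).ne'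
  rcases S.eq_empty_or_nonempty with hemp | hnonempty
  · refine ⟨0, le_rfl, one_pos, fun w hre hw => le_max_of_le_left ?_⟩
    refine (norm_one_sub_exp_le hre).trans (le_of_not_ge fun h => ?_)
    have : w ∈ S := ⟨by simpa using hw, hre, h⟩
    rw [hemp] at this
    exact this
  · obtain ⟨w₀, hw₀, hmax⟩ := hcompact.exists_isMaxOn hnonempty
      (f := fun w : ℂ => ‖1 - Complex.exp w‖ / ‖w‖)
      (ContinuousOn.div (by fun_prop) (by fun_prop) hne)
    refine ⟨‖1 - Complex.exp w₀‖ / ‖w₀‖, by positivity, ?_, fun w hre hw => ?_⟩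
    · rw [div_lt_one ((norm_nonneg _).lt_of_ne' (hne w₀ hw₀))]
      exact norm_one_sub_exp_lt hw₀.2.1 (norm_ne_zero_iff.mp (hne w₀ hw₀))
    · rcases le_total r ‖w‖ with h | h
      · have hwS : w ∈ S := ⟨by simpa using hw, hre, h⟩
        refine le_max_of_le_right ?_
        have := hmax hwS
        simp only [Set.mem_ofPred_eq] at this
        rwa [div_le_iff₀ (hr.trans_le h)] at this
      · exact le_max_of_le_left ((norm_one_sub_exp_le hre).trans h)

/-! ### Renewal inequalities -/

theorem tendsto_sum_conv_zero {β e : ℕ → ℝ} (hβ : ∀ i, 0 ≤ β i) (hβs : Summable β)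
    (he : Tendsto e atTop (𝓝 0)) :
    Tendsto (fun s => ∑ i ∈ Finset.Icc 1 s, β i * e (s - i)) atTop (𝓝 0) := by
  obtain ⟨B, hB⟩ := he.norm.bddAbove_range
  have hB' : ∀ n, ‖e n‖ ≤ B := fun n => hB (Set.mem_range_self n)
  have h := tendsto_tsum_of_dominated_convergence (𝓕 := atTop)
    (f := fun (s i : ℕ) => if i ∈ Finset.Icc 1 s then β i * e (s - i) else 0)
    (g := fun _ => 0) (bound := fun i => β i * B) (hβs.mul_right B) (fun i => ?_)
    (Eventually.of_forall fun s i => ?_)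
  · rw [tsum_zero] at h
    refine h.congr fun s => ?_
    rw [tsum_eq_sum (s := Finset.Icc 1 s) fun i hi => if_neg hi]
    exact Finset.sum_congr rfl fun i hi => if_pos hi
  · have h1 : Tendsto (fun s => β i * e (s - i)) atTop (𝓝 0) := by
      simpa using (he.comp (tendsto_sub_atTop_nat i)).const_mul (β i)
    rw [tendsto_zero_iff_norm_tendsto_zero] at h1 ⊢
    refine squeeze_zero (fun _ => norm_nonneg _) (fun s => ?_) h1
    split_ifs
    · exact le_rfl
    · rw [norm_zero]; exact norm_nonneg _
  · split_ifs
    · rw [norm_mul, Real.norm_of_nonneg (hβ i)]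
      exact mul_le_mul_of_nonneg_left (hB' _) (hβ i)
    · rw [norm_zero]
      exact mul_nonneg (hβ i) ((norm_nonneg _).trans (hB' 0))

theorem sum_Icc_le_tsum {β : ℕ → ℝ} (hβ : ∀ i, 0 ≤ β i) (hβs : Summable β) (s : ℕ) :
    ∑ i ∈ Finset.Icc 1 s, β i ≤ ∑' i, β i := hβs.sum_le_tsum _ fun i _ => hβ i

/-- A bounded nonnegative sequence that satisfies a nonlinear renewal inequality with vanishing
inhomogeneity tends to `0`. -/
theorem tendsto_zero_of_renewal {β d ε : ℕ → ℝ} {B : ℝ} (hβ : ∀ i, 0 ≤ β i) (hβs : Summable β)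
    (hβ1 : ∑' i, β i ≤ 1) (hd : ∀ s, 0 ≤ d s) (hdB : ∀ s, d s ≤ B)
    (hε : Tendsto ε atTop (𝓝 0))
    (h : ∀ r : ℝ, 0 < r → ∃ κ : ℝ, 0 ≤ κ ∧ κ < 1 ∧
      ∀ s, d s ≤ ε s + ∑ i ∈ Finset.Icc 1 s, β i * max r (κ * d (s - i))) :
    Tendsto d atTop (𝓝 0) := by
  have hbdd : IsBoundedUnder (· ≤ ·) atTop d := isBoundedUnder_of ⟨B, hdB⟩
  have hcob : IsCoboundedUnder (· ≤ ·) atTop d :=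
    (isBoundedUnder_of ⟨0, hd⟩ : IsBoundedUnder (· ≥ ·) atTop d).isCoboundedUnder_le
  set D := limsup d atTop with hD
  have hD0 : 0 ≤ D := le_limsup_of_frequently_le (Frequently.of_forall hd) hbdd
  have step : ∀ r : ℝ, 0 < r → D ≤ r := by
    intro r hr
    obtain ⟨κ, hκ0, hκ1, hκ⟩ := h r hr
    -- Letting τ ↓ 0 gives D ≤ max(r, κ D), and κ < 1 then forces D ≤ r.
    have hle : ∀ τ : ℝ, 0 < τ → D ≤ max r (κ * (D + τ)) + τ := by
      intro τ hτ
      set E := max r (κ * (D + τ)) with hE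
      have hE0 : 0 ≤ E := hr.le.trans (le_max_left _ _)
      have hev : ∀ᶠ s in atTop, d s < D + τ := eventually_lt_of_limsup_lt (by linarith) hbdd
      -- The excess over the eventual bound E: it vanishes from some index on, so its convolution
      -- with the summable kernel tends to 0, while the part E passes through a kernel of mass at
      -- most 1.
      set e : ℕ → ℝ := fun s => max 0 (max r (κ * d s) - E) with he
      have he0 : Tendsto e atTop (𝓝 0) := by
        refine tendsto_const_nhds.congr' ?_
        filter_upwards [hev] with s hs
        refine (max_eq_left (sub_nonpos.mpr (max_le_max le_rfl ?_))).symm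
        exact mul_le_mul_of_nonneg_left hs.le hκ0
      have hlim : Tendsto (fun s => ε s + ∑ i ∈ Finset.Icc 1 s, β i * e (s - i)) atTop (𝓝 0) := by
        simpa using hε.add (tendsto_sum_conv_zero hβ hβs he0)
      refine limsup_le_of_le hcob ?_
      filter_upwards [hlim.eventually_le_const hτ] with s hs
      calc d s ≤ ε s + ∑ i ∈ Finset.Icc 1 s, β i * max r (κ * d (s - i)) := hκ s
        _ ≤ ε s + ∑ i ∈ Finset.Icc 1 s, (β i * e (s - i) + β i * E) := by
            gcongr with i
            rw [← mul_add]
            refine mul_le_mul_of_nonneg_left ?_ (hβ i)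
            linarith [le_max_right 0 (max r (κ * d (s - i)) - E)]
        _ = (ε s + ∑ i ∈ Finset.Icc 1 s, β i * e (s - i)) + (∑ i ∈ Finset.Icc 1 s, β i) * E := by
            rw [Finset.sum_add_distrib, Finset.sum_mul, add_assoc]
        _ ≤ τ + 1 * E := by
            gcongr
            exact (sum_Icc_le_tsum hβ hβs s).trans hβ1
        _ = E + τ := by ring
    have hlim : D ≤ max r (κ * D) := by
      have : Tendsto (fun τ : ℝ => max r (κ * (D + τ)) + τ) (𝓝[>] 0) (𝓝 (max r (κ * D))) := by
        have hc : Continuous fun τ : ℝ => max r (κ * (D + τ)) + τ := by fun_prop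
        have := hc.tendsto 0
        simp only [add_zero] at this
        exact this.mono_left nhdsWithin_le_nhds
      refine ge_of_tendsto this ?_
      filter_upwards [self_mem_nhdsWithin] with τ hτ using hle τ hτ
    rcases le_max_iff.mp hlim with h1 | h1
    · exact h1
    · have : D ≤ 0 := by nlinarith
      linarith
  have hDz : D = 0 := le_antisymm (le_of_forall_pos_le_add fun r hr => by
    rw [zero_add]; exact step r hr) hD0
  refine tendsto_order.mpr ⟨fun a ha => Eventually.of_forall fun s => ha.trans_le (hd s),
    fun a ha => ?_⟩
  exact eventually_lt_of_limsup_lt (by rw [← hD, hDz]; exact ha) hbdd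

/-- The solution of the renewal equation `u_s = c_s + ∑_{i=1}^s β_i u_{s-i}`. -/
noncomputable def renewal (c β : ℕ → ℝ) (s : ℕ) : ℝ :=
  c s + ∑ i : Fin s, β (i + 1) * renewal c β (s - (i + 1))
termination_by s
decreasing_by omega

theorem renewal_eq (c β : ℕ → ℝ) (s : ℕ) :
    renewal c β s = c s + ∑ i ∈ Finset.Icc 1 s, β i * renewal c β (s - i) := by
  rw [renewal, Fin.sum_univ_eq_sum_range (fun i => β (i + 1) * renewal c β (s - (i + 1))) s,
    Finset.range_eq_Ico, Finset.sum_Ico_add' (fun i => β i * renewal c β (s - i)) 0 s 1]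
  rfl

theorem renewal_nonneg {c β : ℕ → ℝ} (hc : ∀ s, 0 ≤ c s) (hβ : ∀ s, 0 ≤ β s) (s : ℕ) :
    0 ≤ renewal c β s := by
  induction s using Nat.strong_induction_on with
  | _ s ih =>
    rw [renewal_eq]
    refine add_nonneg (hc s) (Finset.sum_nonneg fun i hi => mul_nonneg (hβ i) (ih _ ?_))
    rw [Finset.mem_Icc] at hi
    omega

theorem le_renewal {c β d : ℕ → ℝ} (hβ : ∀ s, 0 ≤ β s)
    (h : ∀ s, d s ≤ c s + ∑ i ∈ Finset.Icc 1 s, β i * d (s - i)) (s : ℕ) :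
    d s ≤ renewal c β s := by
  induction s using Nat.strong_induction_on with
  | _ s ih =>
    rw [renewal_eq]
    refine (h s).trans (add_le_add le_rfl (Finset.sum_le_sum fun i hi => ?_))
    rw [Finset.mem_Icc] at hi
    exact mul_le_mul_of_nonneg_left (ih _ (by omega)) (hβ i)

/-- Submultiplicativity turns the weighted convolution into a convolution of weighted sequences. A
weighted partial sum U of the solution therefore satisfies U ≤ C + q U with q < 1, where U is
finite, so U ≤ C / (1 - q). -/
theorem summable_weight_mul_renewal {c β w : ℕ → ℝ} (hc : ∀ s, 0 ≤ c s) (hβ : ∀ s, 0 ≤ β s)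
    (hw : ∀ s, 0 ≤ w s) (hsub : ∀ i j, w (i + j) ≤ w i * w j)
    (hwc : Summable fun s => w s * c s) (hwβ : Summable fun s => w s * β s)
    (hlt : ∑' s, w s * β s < 1) : Summable fun s => w s * renewal c β s := by
  set u := renewal c β with hu
  have hu0 : ∀ s, 0 ≤ u s := renewal_nonneg hc hβ
  set q := ∑' s, w s * β s with hq
  refine summable_of_sum_range_le (c := (∑' s, w s * c s) / (1 - q))
    (fun s => mul_nonneg (hw s) (hu0 s)) fun S => ?_
  rw [le_div_iff₀ (by linarith)]
  have hconv : ∑ s ∈ Finset.range S, w s * ∑ i ∈ Finset.Icc 1 s, β i * u (s - i) ≤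
      q * ∑ s ∈ Finset.range S, w s * u s := by
    calc _ ≤ ∑ s ∈ Finset.range S, ∑ i ∈ Finset.range (s + 1),
          (w i * β i) * (w (s - i) * u (s - i)) := by
          refine Finset.sum_le_sum fun s _ => ?_
          rw [Finset.mul_sum]
          refine (Finset.sum_le_sum fun i hi => ?_).trans
            (Finset.sum_le_sum_of_subset_of_nonneg (s := Finset.Icc 1 s) ?_ fun i _ _ => ?_)
          · have hsi : i + (s - i) = s := by rw [Finset.mem_Icc] at hi; omega
            have := hsub i (s - i)
            rw [hsi] at this
            calc w s * (β i * u (s - i)) ≤ (w i * w (s - i)) * (β i * u (s - i)) :=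
                  mul_le_mul_of_nonneg_right this (mul_nonneg (hβ i) (hu0 _))
              _ = _ := by ring
          · intro i hi
            rw [Finset.mem_Icc] at hi
            rw [Finset.mem_range]
            omega
          · exact mul_nonneg (mul_nonneg (hw i) (hβ i)) (mul_nonneg (hw _) (hu0 _))
      _ = ∑ i ∈ Finset.range S, ∑ j ∈ Finset.range (S - i), (w i * β i) * (w j * u j) :=
          Finset.sum_range_diag_flip S fun i j => (w i * β i) * (w j * u j)
      _ ≤ ∑ i ∈ Finset.range S, ∑ j ∈ Finset.range S, (w i * β i) * (w j * u j) := by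
          refine Finset.sum_le_sum fun i _ => Finset.sum_le_sum_of_subset_of_nonneg
            (Finset.range_mono (Nat.sub_le _ _)) fun j _ _ => ?_
          exact mul_nonneg (mul_nonneg (hw i) (hβ i)) (mul_nonneg (hw j) (hu0 j))
      _ = (∑ i ∈ Finset.range S, w i * β i) * ∑ j ∈ Finset.range S, w j * u j := by
          rw [Finset.sum_mul_sum]
      _ ≤ _ := by
          refine mul_le_mul_of_nonneg_right ?_
            (Finset.sum_nonneg fun j _ => mul_nonneg (hw j) (hu0 j))
          exact hwβ.sum_le_tsum _ fun i _ => mul_nonneg (hw i) (hβ i)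
  have heq : ∑ s ∈ Finset.range S, w s * u s = ∑ s ∈ Finset.range S, w s * c s +
      ∑ s ∈ Finset.range S, w s * ∑ i ∈ Finset.Icc 1 s, β i * u (s - i) := by
    rw [← Finset.sum_add_distrib]
    refine Finset.sum_congr rfl fun s _ => ?_
    rw [← mul_add, hu, renewal_eq]
  have hcs : ∑ s ∈ Finset.range S, w s * c s ≤ ∑' s, w s * c s :=
    hwc.sum_le_tsum _ fun i _ => mul_nonneg (hw i) (hc i)
  linarith

/-- The tail sums `∑_{i > s} α_i`. -/
noncomputable def tailSum (α : ℕ → ℝ) (s : ℕ) : ℝ := ∑' i, if s < i then α i else 0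

theorem tailSum_nonneg {α : ℕ → ℝ} (hα : ∀ i, 0 ≤ α i) (s : ℕ) : 0 ≤ tailSum α s :=
  tsum_nonneg fun i => by split_ifs; exacts [hα i, le_rfl]

theorem summable_tail {α : ℕ → ℝ} (hα : ∀ i, 0 ≤ α i) (hαs : Summable α) (s : ℕ) :
    Summable fun i => if s < i then α i else 0 :=
  hαs.of_nonneg_of_le (fun i => by split_ifs; exacts [hα i, le_rfl])
    fun i => by split_ifs; exacts [le_rfl, hα i]

theorem norm1_eq_sum_add_tailSum {α : ℕ → ℝ} (hα : ∀ i, 0 ≤ α i) (hα0 : α 0 = 0)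
    (hαs : Summable α) (s : ℕ) :
    norm1 α = ∑ i ∈ Finset.Icc 1 s, α i + tailSum α s := by
  have h1 : ∑ i ∈ Finset.Icc 1 s, α i = ∑' i, if i ∈ Finset.Icc 1 s then α i else 0 := by
    rw [tsum_eq_sum (s := Finset.Icc 1 s) fun i hi => if_neg hi]
    exact Finset.sum_congr rfl fun i hi => (if_pos hi).symm
  rw [h1, tailSum, ← Summable.tsum_add ?_ (summable_tail hα hαs s), norm1]
  · refine tsum_congr fun i => ?_
    rcases Nat.eq_zero_or_pos i with rfl | hi
    · simp [hα0]
    · by_cases h : s < i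
      · rw [if_neg (by rw [Finset.mem_Icc]; omega), if_pos h, zero_add]
      · rw [if_pos (by rw [Finset.mem_Icc]; omega), if_neg h, add_zero]
  · exact summable_of_ne_finset_zero (s := Finset.Icc 1 s) fun i hi => if_neg hi

theorem tendsto_tailSum {α : ℕ → ℝ} (hα : ∀ i, 0 ≤ α i) (hαs : Summable α) :
    Tendsto (tailSum α) atTop (𝓝 0) := by
  have h := tendsto_tsum_of_dominated_convergence (𝓕 := atTop)
    (f := fun (s i : ℕ) => if s < i then α i else 0)
    (g := fun _ => 0) (bound := α) hαs (fun i => ?_) (Eventually.of_forall fun s i => ?_)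
  · rw [tsum_zero] at h
    exact h
  · refine tendsto_const_nhds.congr' ?_
    filter_upwards [eventually_ge_atTop i] with s hs
    rw [if_neg (by omega)]
  · split_ifs
    · exact (Real.norm_of_nonneg (hα i)).le
    · simpa using hα i

/-- Interchanging the sums, α_i is counted with ∑_{s<i} (1 + s)^v ≤ i^{v+1}. This is where one
moment more than the order of the weight is spent. -/
theorem summable_pow_mul_tailSum {α : ℕ → ℝ} (hα : ∀ i, 0 ≤ α i) (hαs : Summable α) {v : ℕ}
    (hmom : Summable fun i : ℕ => (i : ℝ) ^ (v + 1) * α i) :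
    Summable fun s : ℕ => (1 + s : ℝ) ^ v * tailSum α s := by
  refine summable_of_sum_range_le (c := ∑' i : ℕ, (i : ℝ) ^ (v + 1) * α i)
    (fun s => mul_nonneg (by positivity) (tailSum_nonneg hα s)) fun S => ?_
  have h1 : ∀ s : ℕ, (1 + s : ℝ) ^ v * tailSum α s =
      ∑' i, (1 + s : ℝ) ^ v * if s < i then α i else 0 := fun s => tsum_mul_left.symm
  simp only [h1]
  rw [← Summable.tsum_finsetSum fun s _ => (summable_tail hα hαs s).mul_left _]
  refine Summable.tsum_le_tsum (fun i => ?_)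
    (summable_sum fun s _ => (summable_tail hα hαs s).mul_left _) hmom
  calc ∑ s ∈ Finset.range S, (1 + s : ℝ) ^ v * (if s < i then α i else 0)
      = ∑ s ∈ (Finset.range S).filter (· < i), (1 + s : ℝ) ^ v * α i := by
        rw [Finset.sum_filter]
        refine Finset.sum_congr rfl fun s _ => ?_
        split_ifs <;> simp
    _ ≤ ∑ s ∈ Finset.range i, (1 + s : ℝ) ^ v * α i := by
        refine Finset.sum_le_sum_of_subset_of_nonneg (fun s hs => ?_) fun s _ _ =>
          mul_nonneg (by positivity) (hα i)
        exact Finset.mem_range.mpr (Finset.mem_filter.mp hs).2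
    _ ≤ ∑ s ∈ Finset.range i, (i : ℝ) ^ v * α i := by
        refine Finset.sum_le_sum fun s hs => mul_le_mul_of_nonneg_right ?_ (hα i)
        refine pow_le_pow_left₀ (by positivity) ?_ v
        have : s + 1 ≤ i := Finset.mem_range.mp hs
        have : ((s + 1 : ℕ) : ℝ) ≤ i := by exact_mod_cast this
        push_cast at this
        linarith
    _ = (i : ℝ) ^ (v + 1) * α i := by
        rw [Finset.sum_const, Finset.card_range, nsmul_eq_mul]
        ring

/-- A submultiplicative polynomial weight that changes the mass of `α` arbitrarily little. -/
theorem exists_weight {α : ℕ → ℝ} (hα : ∀ i, 0 ≤ α i) (hα0 : α 0 = 0) {v : ℕ}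
    (hmom : Summable fun i : ℕ => (i : ℝ) ^ (v + 1) * α i) {b : ℝ} (hb : norm1 α < b) :
    ∃ δ : ℝ, 0 < δ ∧ δ ≤ 1 ∧ (Summable fun i : ℕ => (1 + δ * i) ^ v * α i) ∧
      ∑' i : ℕ, (1 + δ * i) ^ v * α i < b := by
  have hsum1 : Summable fun i : ℕ => (1 + i : ℝ) ^ v * α i := by
    refine (hmom.mul_left (2 ^ v)).of_nonneg_of_le
      (fun i => mul_nonneg (by positivity) (hα i)) fun i => ?_
    rcases Nat.eq_zero_or_pos i with rfl | hi
    · simp [hα0]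
    · have hi1 : (1 : ℝ) ≤ i := by exact_mod_cast hi
      rw [← mul_assoc]
      refine mul_le_mul_of_nonneg_right ?_ (hα i)
      calc (1 + i : ℝ) ^ v ≤ (2 * i) ^ v := by gcongr; linarith
        _ = 2 ^ v * (i : ℝ) ^ v := mul_pow _ _ _
        _ ≤ 2 ^ v * (i : ℝ) ^ (v + 1) := by gcongr; exact Nat.le_succ v
  have hle : ∀ δ : ℝ, 0 ≤ δ → δ ≤ 1 → ∀ i : ℕ, (1 + δ * i) ^ v * α i ≤ (1 + i : ℝ) ^ v * α i := by
    intro δ h0 h1 i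
    refine mul_le_mul_of_nonneg_right (pow_le_pow_left₀ (by positivity) ?_ v) (hα i)
    nlinarith [(Nat.cast_nonneg i : (0 : ℝ) ≤ i)]
  -- As δ ↓ 0 the weight tends to 1 pointwise and is dominated by (1 + i)^v, so the weighted mass
  -- tends to that of α.
  have hlim : Tendsto (fun δ : ℝ => ∑' i : ℕ, (1 + δ * i) ^ v * α i) (𝓝[>] 0) (𝓝 (norm1 α)) := by
    refine tendsto_tsum_of_dominated_convergence hsum1 (fun i => ?_) ?_
    · have hc : Continuous fun δ : ℝ => (1 + δ * (i : ℝ)) ^ v * α i := by fun_prop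
      have := hc.tendsto 0
      simp only [zero_mul, add_zero, one_pow, one_mul] at this
      exact this.mono_left nhdsWithin_le_nhds
    · filter_upwards [Ioc_mem_nhdsGT (one_pos : (0 : ℝ) < 1)] with δ hδ i
      rw [Real.norm_of_nonneg (mul_nonneg (by have := hδ.1.le; positivity) (hα i))]
      exact hle δ hδ.1.le hδ.2 i
  obtain ⟨δ, hδ, hδb⟩ := ((hlim.eventually_lt_const hb).and
    (Ioc_mem_nhdsGT (one_pos : (0 : ℝ) < 1))).exists
  exact ⟨δ, hδb.1, hδb.2, hsum1.of_nonneg_of_le (fun i => mul_nonneg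
    (by have := hδb.1.le; positivity) (hα i)) (hle δ hδb.1.le hδb.2), hδ⟩

end DiscreteHawkes

namespace DiscreteHawkes

/-! ### The limit function -/

section
variable {α : ℕ → ℝ}

theorem re_f_le (hα : ∀ i, 0 ≤ α i) (s : ℕ) (z : ℂ) :
    (f α s z).re ≤ z.re + ∑ i ∈ Finset.Icc 1 s, α i * (Real.exp (f α (s - i) z).re - 1) := by
  conv_lhs => rw [f_eq]
  rw [Complex.add_re, Complex.re_sum]
  gcongr with i
  rw [Complex.re_ofReal_mul, Complex.sub_re, Complex.one_re, ← Complex.norm_exp]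
  exact mul_le_mul_of_nonneg_left (by linarith [Complex.re_le_norm (Complex.exp (f α (s - i) z))])
    (hα i)

/-- Induction along the recursion: L ≥ 0 makes e^L - 1 nonnegative, so partial sums of α may be
replaced by the full mass. -/
theorem re_f_le_of_nonneg (hα : ∀ i, 0 ≤ α i) (hαs : Summable α) {L : ℝ} (hL : 0 ≤ L) {z : ℂ}
    (hz : z.re + norm1 α * (Real.exp L - 1) ≤ L) (s : ℕ) : (f α s z).re ≤ L := by
  induction s using Nat.strong_induction_on with
  | _ s ih =>
    have hexp : 0 ≤ Real.exp L - 1 := by linarith [Real.one_le_exp hL]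
    calc (f α s z).re ≤ z.re + ∑ i ∈ Finset.Icc 1 s, α i * (Real.exp (f α (s - i) z).re - 1) :=
          re_f_le hα s z
      _ ≤ z.re + ∑ i ∈ Finset.Icc 1 s, α i * (Real.exp L - 1) := by
          gcongr with i hi
          · exact hα i
          · rw [Finset.mem_Icc] at hi
            exact ih _ (by omega)
      _ = z.re + (∑ i ∈ Finset.Icc 1 s, α i) * (Real.exp L - 1) := by rw [Finset.sum_mul]
      _ ≤ z.re + norm1 α * (Real.exp L - 1) := by
          gcongr
          exact sum_Icc_le_tsum hα hαs s
      _ ≤ L := hz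

theorem re_f_le_of_nonpos (hα : ∀ i, 0 ≤ α i) {L : ℝ} (hL : L ≤ 0) {z : ℂ}
    (hz : z.re ≤ L) (s : ℕ) : (f α s z).re ≤ L := by
  induction s using Nat.strong_induction_on with
  | _ s ih =>
    refine (re_f_le hα s z).trans ?_
    have : ∑ i ∈ Finset.Icc 1 s, α i * (Real.exp (f α (s - i) z).re - 1) ≤ 0 := by
      refine Finset.sum_nonpos fun i hi => mul_nonpos_of_nonneg_of_nonpos (hα i) ?_
      rw [Finset.mem_Icc] at hi
      have := Real.exp_le_one_iff.mpr ((ih (s - i) (by omega)).trans hL)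
      linarith
    linarith

/-- On the real axis f_s is real. Elsewhere Re e^w ≤ e^{Re w} together with α ≥ 0 lets the
comparison of real parts pass through the recursion. -/
theorem norm_exp_f_le (hα : ∀ i, 0 ≤ α i) (s : ℕ) (z : ℂ) :
    ‖Complex.exp (f α s z)‖ ≤ ‖Complex.exp (f α s (z.re : ℂ))‖ := by
  rw [Complex.norm_exp, Complex.norm_exp, Real.exp_le_exp]
  have him : ∀ s, (f α s (z.re : ℂ)).im = 0 := by
    intro s
    induction s using Nat.strong_induction_on with
    | _ s ih =>
      rw [f_eq, Complex.add_im, Complex.ofReal_im, zero_add, Complex.im_sum]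
      refine Finset.sum_eq_zero fun i hi => ?_
      rw [Finset.mem_Icc] at hi
      rw [Complex.im_ofReal_mul, Complex.sub_im, Complex.exp_im, ih _ (by omega)]
      simp
  induction s using Nat.strong_induction_on with
  | _ s ih =>
    refine (re_f_le hα s z).trans ?_
    conv_rhs => rw [f_eq]
    rw [Complex.add_re, Complex.re_sum, Complex.ofReal_re]
    gcongr with i hi
    rw [Complex.re_ofReal_mul, Complex.sub_re, Complex.one_re, Complex.exp_re, him, Real.cos_zero,
      mul_one]
    rw [Finset.mem_Icc] at hi
    refine mul_le_mul_of_nonneg_left ?_ (hα i)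
    linarith [Real.exp_le_exp.mpr (ih (s - i) (by omega))]

theorem eq_zero_of_norm1_eq_zero (hα : ∀ i, 0 ≤ α i) (hαs : Summable α) (h : norm1 α = 0)
    (i : ℕ) : α i = 0 :=
  congrFun ((hasSum_zero_iff_of_nonneg hα).mp (by rw [← h]; exact hαs.hasSum)) i

theorem f_of_norm1_eq_zero (hα : ∀ i, 0 ≤ α i) (hαs : Summable α) (h : norm1 α = 0) (s : ℕ)
    (z : ℂ) : f α s z = z := by
  rw [f_eq]
  simp [eq_zero_of_norm1_eq_zero hα hαs h]

theorem norm1_nonneg (hα : ∀ i, 0 ≤ α i) : 0 ≤ norm1 α := tsum_nonneg hα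

theorem ofReal_norm1_eq (hα : ∀ i, 0 ≤ α i) (hα0 : α 0 = 0) (hαs : Summable α) (s : ℕ) :
    (norm1 α : ℂ) = ∑ i ∈ Finset.Icc 1 s, (α i : ℂ) + (tailSum α s : ℂ) := by
  rw [norm1_eq_sum_add_tailSum hα hα0 hαs s]
  push_cast
  rfl

/-- The fixed-point equation involves the full mass of α and f_s only its first s terms; the
discrepancy is the tail sum. What remains is a renewal equation for the error. -/
theorem f_sub_fixedPoint (hα : ∀ i, 0 ≤ α i) (hα0 : α 0 = 0) (hαs : Summable α) {z F : ℂ}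
    (hF : F = z + norm1 α * (Complex.exp F - 1)) (s : ℕ) :
    f α s z - F = ∑ i ∈ Finset.Icc 1 s, (α i : ℂ) *
      (Complex.exp (f α (s - i) z) - Complex.exp F) - tailSum α s * (Complex.exp F - 1) := by
  conv_lhs => rw [f_eq, hF, ofReal_norm1_eq hα hα0 hαs s]
  rw [add_mul, Finset.sum_mul, add_sub_add_left_eq_sub, ← sub_sub, ← Finset.sum_sub_distrib]
  congr 1
  exact Finset.sum_congr rfl fun i _ => by ring

theorem norm_f_sub_fixedPoint_le (hα : ∀ i, 0 ≤ α i) (hα0 : α 0 = 0) (hαs : Summable α)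
    {z F : ℂ} (hF : F = z + norm1 α * (Complex.exp F - 1)) (s : ℕ) :
    ‖f α s z - F‖ ≤ tailSum α s * ‖Complex.exp F - 1‖ + ∑ i ∈ Finset.Icc 1 s, α i *
      ‖Complex.exp (f α (s - i) z) - Complex.exp F‖ := by
  rw [f_sub_fixedPoint hα hα0 hαs hF, add_comm]
  refine (norm_sub_le _ _).trans (add_le_add ((norm_sum_le _ _).trans_eq ?_) (le_of_eq ?_))
  · refine Finset.sum_congr rfl fun i _ => ?_
    rw [norm_mul, Complex.norm_real, Real.norm_of_nonneg (hα i)]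
  · rw [norm_mul, Complex.norm_real, Real.norm_of_nonneg (tailSum_nonneg hα s)]

/-- A strictly nonexpansive self-map of a compact set has a fixed point. -/
theorem exists_fixedPoint_of_strictly_nonexpansive {S : Set ℂ} (hS : IsCompact S)
    (hne : S.Nonempty) {G : ℂ → ℂ} (hG : ContinuousOn G S) (hmaps : ∀ w ∈ S, G w ∈ S)
    (hlt : ∀ a ∈ S, ∀ b ∈ S, a ≠ b → ‖G a - G b‖ < ‖a - b‖) : ∃ w ∈ S, G w = w := by
  -- At a minimiser w of |G w - w|, a nonzero value would be strictly lowered by passing to G w.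
  obtain ⟨w, hw, hmin⟩ := hS.exists_isMinOn hne (f := fun w => ‖G w - w‖)
    (hG.sub continuousOn_id).norm
  refine ⟨w, hw, by_contra fun h => ?_⟩
  exact absurd (hmin (hmaps w hw)) (not_le.mpr (hlt _ (hmaps w hw) _ hw h))

/-- The map w ↦ z + m (e^w - 1) preserves Re w ≤ L and has bounded image there. As m e^L = 1 it is
strictly nonexpansive but need not be a contraction, so compactness takes the place of Banach's
theorem. -/
theorem exists_fixedPoint_exp {m L : ℝ} (hm : 0 < m) (hL : m * Real.exp L = 1) {z : ℂ}
    (hz : z.re + m * (Real.exp L - 1) ≤ L) :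
    ∃ F : ℂ, F.re ≤ L ∧ F = z + m * (Complex.exp F - 1) := by
  set G : ℂ → ℂ := fun w => z + m * (Complex.exp w - 1) with hG
  have hexp : ∀ w : ℂ, w.re ≤ L → ‖Complex.exp w‖ ≤ Real.exp L := fun w hw => by
    rw [Complex.norm_exp]; exact Real.exp_le_exp.mpr hw
  have hGre : ∀ w : ℂ, w.re ≤ L → (G w).re ≤ L := fun w hw => by
    refine le_trans ?_ hz
    simp only [hG]
    rw [Complex.add_re, Complex.re_ofReal_mul, Complex.sub_re, Complex.one_re]
    gcongr
    exact (Complex.re_le_norm _).trans (hexp w hw)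
  have hGn : ∀ w : ℂ, w.re ≤ L → ‖G w‖ ≤ ‖z‖ + m * (Real.exp L + 1) := fun w hw => by
    refine (norm_add_le _ _).trans ?_
    rw [norm_mul, Complex.norm_real, Real.norm_of_nonneg hm.le]
    gcongr
    refine (norm_sub_le _ _).trans ?_
    rw [norm_one]
    gcongr
    exact hexp w hw
  obtain ⟨F, hF, hGF⟩ := exists_fixedPoint_of_strictly_nonexpansive
    (S := Metric.closedBall 0 (‖z‖ + m * (Real.exp L + 1)) ∩ {w | w.re ≤ L}) (G := G)
    ((isCompact_closedBall 0 _).inter_right (isClosed_le Complex.continuous_re continuous_const))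
    ⟨G L, by simpa using hGn L (by simp), hGre L (by simp)⟩ (by fun_prop)
    (fun w hw => ⟨by simpa using hGn w hw.2, hGre w hw.2⟩) fun a ha b hb hab => by
      have h := norm_exp_sub_exp_lt ha.2 hb.2 hab
      have : G a - G b = m * (Complex.exp a - Complex.exp b) := by simp only [hG]; ring
      rw [this, norm_mul, Complex.norm_real, Real.norm_of_nonneg hm.le]
      calc _ < m * (Real.exp L * ‖a - b‖) := by gcongr
        _ = ‖a - b‖ := by rw [← mul_assoc, hL, one_mul]
  exact ⟨F, hF.2, hGF.symm⟩

/-- The kernel α_i e^L has mass exactly 1, so the linear renewal inequality gives no decay; the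
strict contraction of exp away from 0 does. -/
theorem tendsto_f_of_fixedPoint (hα : ∀ i, 0 ≤ α i) (hα0 : α 0 = 0) (hαs : Summable α)
    {L : ℝ} (hL : norm1 α * Real.exp L = 1) {z F : ℂ}
    (hf : ∀ s, (f α s z).re ≤ L) (hFL : F.re ≤ L)
    (hF : F = z + norm1 α * (Complex.exp F - 1)) :
    Tendsto (fun s => f α s z) atTop (𝓝 F) := by
  rw [tendsto_iff_norm_sub_tendsto_zero]
  have hbound : ∀ s, ‖f α s z - F‖ ≤ ‖z‖ + norm1 α * (Real.exp L + 1) + ‖F‖ := by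
    intro s
    refine (norm_sub_le _ _).trans ?_
    gcongr
    rw [f_eq]
    refine (norm_add_le _ _).trans ?_
    gcongr
    calc _ ≤ ∑ i ∈ Finset.Icc 1 s, α i * (Real.exp L + 1) := by
          refine norm_sum_le_of_le _ fun i _ => ?_
          rw [norm_mul, Complex.norm_real, Real.norm_of_nonneg (hα i)]
          refine mul_le_mul_of_nonneg_left ?_ (hα i)
          refine (norm_sub_le _ _).trans ?_
          rw [norm_one, Complex.norm_exp]
          gcongr
          exact hf _
      _ = (∑ i ∈ Finset.Icc 1 s, α i) * (Real.exp L + 1) := by rw [Finset.sum_mul]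
      _ ≤ _ := by
          gcongr
          exact sum_Icc_le_tsum hα hαs s
  have hβs : Summable fun i => α i * Real.exp L := hαs.mul_right _
  refine tendsto_zero_of_renewal (β := fun i => α i * Real.exp L)
    (ε := fun s => tailSum α s * ‖Complex.exp F - 1‖)
    (fun i => mul_nonneg (hα i) (Real.exp_pos L).le) hβs ?_
    (fun s => norm_nonneg _) hbound ?_ fun r hr => ?_
  · rw [tsum_mul_right]
    exact hL.le
  · simpa using (tendsto_tailSum hα hαs).mul_const ‖Complex.exp F - 1‖
  · obtain ⟨κ, hκ0, hκ1, hκ⟩ := exists_contraction_away_from_zero hr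
      (‖z‖ + norm1 α * (Real.exp L + 1) + ‖F‖)
    refine ⟨κ, hκ0, hκ1, fun s => (norm_f_sub_fixedPoint_le hα hα0 hαs hF s).trans
      (add_le_add le_rfl (Finset.sum_le_sum fun i _ => ?_))⟩
    rw [mul_assoc]
    refine mul_le_mul_of_nonneg_left ?_ (hα i)
    obtain ⟨w, hw, hre, hle⟩ := exists_norm_exp_sub_exp_le (hf (s - i)) hFL
    refine hle.trans ?_
    rw [← hw]
    gcongr
    exact hκ w hre (hw ▸ hbound _)

/-- The origin of θ_c: it is the maximum of L - m (e^L - 1), attained at L = -log m, where m e^L =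
1. -/
theorem closedHalfPlane_re_le (hm : 0 < norm1 α) {z : ℂ} (hz : z ∈ closedHalfPlane α) :
    norm1 α * Real.exp (-Real.log (norm1 α)) = 1 ∧
    z.re + norm1 α * (Real.exp (-Real.log (norm1 α)) - 1) ≤ -Real.log (norm1 α) := by
  have h1 : norm1 α * Real.exp (-Real.log (norm1 α)) = 1 := by
    rw [Real.exp_neg, Real.exp_log hm, mul_inv_cancel₀ hm.ne']
  refine ⟨h1, ?_⟩
  have h2 : z.re ≤ norm1 α - 1 - Real.log (norm1 α) := hz.resolve_left hm.ne'
  rw [mul_sub, h1]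
  linarith

theorem tendsto_f (hα : ∀ i, 0 ≤ α i) (hα0 : α 0 = 0) (hαs : Summable α) (h1 : norm1 α ≤ 1)
    {z : ℂ} (hz : z ∈ closedHalfPlane α) :
    Tendsto (fun s => f α s z) atTop (𝓝 (fInf α z)) ∧
      fInf α z = z + norm1 α * (Complex.exp (fInf α z) - 1) := by
  obtain ⟨F, hF, hlim⟩ : ∃ F : ℂ, F = z + norm1 α * (Complex.exp F - 1) ∧
      Tendsto (fun s => f α s z) atTop (𝓝 F) := by
    rcases (norm1_nonneg hα).eq_or_lt with hm | hm
    · refine ⟨z, by simp [← hm], ?_⟩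
      simp only [f_of_norm1_eq_zero hα hαs hm.symm]
      exact tendsto_const_nhds
    · obtain ⟨hL, hzL⟩ := closedHalfPlane_re_le hm hz
      obtain ⟨F, hFL, hF⟩ := exists_fixedPoint_exp hm hL hzL
      have hL0 : 0 ≤ -Real.log (norm1 α) := neg_nonneg.mpr (Real.log_nonpos hm.le h1)
      exact ⟨F, hF, tendsto_f_of_fixedPoint hα hα0 hαs hL
        (re_f_le_of_nonneg hα hαs hL0 hzL) hFL hF⟩
  have : fInf α z = F := hlim.limUnder_eq
  rw [this]
  exact ⟨hlim, hF⟩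

theorem xFun_eq (hα : ∀ i, 0 ≤ α i) (hα0 : α 0 = 0) (hαs : Summable α) (h1 : norm1 α ≤ 1)
    {z : ℂ} (hz : z ∈ closedHalfPlane α) :
    xFun α z = Complex.exp (z + norm1 α * (xFun α z - 1)) := by
  conv_lhs => rw [xFun, (tendsto_f hα hα0 hαs h1 hz).2]
  rfl

theorem openHalfPlane_subset : openHalfPlane α ⊆ closedHalfPlane α :=
  fun _ hz => hz.imp_right le_of_lt

theorem mem_openHalfPlane_of_re_le {z w : ℂ} (hz : z ∈ openHalfPlane α) (hw : w.re ≤ z.re) :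
    w ∈ openHalfPlane α := hz.imp_right hw.trans_lt

/-- Strictly below θ_c there is room to take L below -log m, hence m e^L < 1: by continuity if θ ≥ 0
(which excludes m = 1, as then θ_c = 0), and with L = θ if θ < 0. -/
theorem exists_subcritical_bound (hα : ∀ i, 0 ≤ α i) (hαs : Summable α) (h1 : norm1 α ≤ 1)
    {θ : ℝ} (hθ : (θ : ℂ) ∈ openHalfPlane α) :
    ∃ L : ℝ, norm1 α * Real.exp L < 1 ∧ ∀ z : ℂ, z.re ≤ θ → ∀ s, (f α s z).re ≤ L := by
  rcases (norm1_nonneg hα).eq_or_lt with hm | hm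
  · refine ⟨θ, by simp [← hm], fun z hz s => ?_⟩
    rw [f_of_norm1_eq_zero hα hαs hm.symm]
    exact hz
  rcases lt_or_ge θ 0 with hθ0 | hθ0
  · refine ⟨θ, ?_, fun z hz s => re_f_le_of_nonpos hα hθ0.le hz s⟩
    have := Real.exp_lt_one_iff.mpr hθ0
    nlinarith [Real.exp_pos θ]
  · have hθc : θ < norm1 α - 1 - Real.log (norm1 α) := by
      have := hθ.resolve_left hm.ne'
      simpa using this
    set L₀ := -Real.log (norm1 α) with hL₀
    have hexp : norm1 α * Real.exp L₀ = 1 := by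
      rw [hL₀, Real.exp_neg, Real.exp_log hm, mul_inv_cancel₀ hm.ne']
    have hL₀pos : 0 < L₀ := by
      have hne : norm1 α ≠ 1 := fun h => by
        rw [h, Real.log_one] at hθc
        linarith
      exact neg_pos.mpr (Real.log_neg hm (lt_of_le_of_ne h1 hne))
    have hcont : Tendsto (fun L : ℝ => L - norm1 α * (Real.exp L - 1)) (𝓝[<] L₀)
        (𝓝 (L₀ - norm1 α * (Real.exp L₀ - 1))) := by
      have hc : Continuous fun L : ℝ => L - norm1 α * (Real.exp L - 1) := by fun_prop
      exact (hc.tendsto L₀).mono_left nhdsWithin_le_nhds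
    have hgt : θ < L₀ - norm1 α * (Real.exp L₀ - 1) := by
      rw [mul_sub, hexp]
      linarith
    obtain ⟨L, hL, hLmem⟩ := ((hcont.eventually_const_lt hgt).and
      (Ioo_mem_nhdsLT hL₀pos)).exists
    refine ⟨L, ?_, fun z hz s => re_f_le_of_nonneg hα hαs hLmem.1.le (by linarith) s⟩
    rw [← hexp]
    exact mul_lt_mul_of_pos_left (Real.exp_lt_exp.mpr hLmem.2) hm

/-- Uniform convergence of `exp (f_s)` with a polynomial rate on half-planes. -/
theorem exists_uniform_rate (hα : ∀ i, 0 ≤ α i) (hα0 : α 0 = 0) (hαs : Summable α)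
    (h1 : norm1 α ≤ 1) {v : ℕ} (hmom : Summable fun i : ℕ => (i : ℝ) ^ (v + 1) * α i)
    {θ : ℝ} (hθ : (θ : ℂ) ∈ openHalfPlane α) :
    ∃ (L : ℝ) (u : ℕ → ℝ), norm1 α * Real.exp L < 1 ∧ (∀ s, 0 ≤ u s) ∧
      (Summable fun s : ℕ => (1 + s : ℝ) ^ v * u s) ∧
      ∀ z : ℂ, z.re ≤ θ → ‖xFun α z‖ ≤ Real.exp L ∧
        (∀ s, ‖Complex.exp (f α s z)‖ ≤ Real.exp L) ∧
        ∀ s, ‖Complex.exp (f α s z) - xFun α z‖ ≤ u s := by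
  obtain ⟨L, hL, hfL⟩ := exists_subcritical_bound hα hαs h1 hθ
  have hEpos := Real.exp_pos L
  -- Since exp is Lipschitz with constant e^L on Re w ≤ L, the error |f_s - f_∞| is dominated by the
  -- renewal sequence with these data. The kernel β has mass m e^L < 1, and the weight chosen below
  -- keeps its weighted mass under 1.
  set c : ℕ → ℝ := fun s => (Real.exp L + 1) * tailSum α s with hc
  set β : ℕ → ℝ := fun i => Real.exp L * α i with hβ
  have hc0 : ∀ s, 0 ≤ c s := fun s => mul_nonneg (by positivity) (tailSum_nonneg hα s)
  have hβ0 : ∀ s, 0 ≤ β s := fun s => mul_nonneg hEpos.le (hα s)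
  have hu0 := renewal_nonneg hc0 hβ0
  have hb : norm1 α < (Real.exp L)⁻¹ := by
    rw [← mul_lt_mul_iff_left₀ hEpos, inv_mul_cancel₀ hEpos.ne']
    exact hL
  obtain ⟨δ, hδ0, hδ1, hδs, hδb⟩ := exists_weight hα hα0 hmom hb
  have hsum : Summable fun s : ℕ => (1 + δ * s) ^ v * renewal c β s := by
    refine summable_weight_mul_renewal hc0 hβ0 (fun s => by positivity) (fun i j => ?_) ?_ ?_ ?_
    · rw [← mul_pow]
      refine pow_le_pow_left₀ (by positivity) ?_ v
      push_cast
      nlinarith [mul_nonneg (mul_nonneg hδ0.le (Nat.cast_nonneg (α := ℝ) i))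
        (mul_nonneg hδ0.le (Nat.cast_nonneg (α := ℝ) j))]
    · refine ((summable_pow_mul_tailSum hα hαs hmom).mul_left (Real.exp L + 1)).of_nonneg_of_le
        (fun s => mul_nonneg (by positivity) (hc0 s)) fun s => ?_
      rw [hc, mul_left_comm]
      refine mul_le_mul_of_nonneg_left (mul_le_mul_of_nonneg_right ?_ (tailSum_nonneg hα s))
        (by positivity)
      refine pow_le_pow_left₀ (by positivity) ?_ v
      nlinarith [Nat.cast_nonneg (α := ℝ) s]
    · refine (hδs.mul_left (Real.exp L)).congr fun s => ?_
      simp only [hβ]; ring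
    · have : ∀ s : ℕ, (1 + δ * s) ^ v * β s = Real.exp L * ((1 + δ * s) ^ v * α s) := fun s => by
        simp only [hβ]; ring
      simp only [this]
      rw [tsum_mul_left]
      calc _ < Real.exp L * (Real.exp L)⁻¹ := by gcongr
        _ = 1 := mul_inv_cancel₀ hEpos.ne'
  refine ⟨L, fun s => Real.exp L * renewal c β s, hL, fun s => mul_nonneg hEpos.le (hu0 s), ?_,
    fun z hz => ?_⟩
  -- Return from the weight (1 + δ s)^v to (1 + s)^v, which is at most δ^{-v} times as large because
  -- δ ≤ 1.
  · refine (hsum.mul_left (Real.exp L * (δ ^ v)⁻¹)).of_nonneg_of_le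
      (fun s => mul_nonneg (by positivity) (mul_nonneg hEpos.le (hu0 s))) fun s => ?_
    have h2 : (1 + s : ℝ) ^ v ≤ (δ ^ v)⁻¹ * (1 + δ * s) ^ v := by
      rw [← inv_pow, ← mul_pow]
      refine pow_le_pow_left₀ (by positivity) ?_ v
      rw [inv_mul_eq_div, le_div_iff₀ hδ0]
      nlinarith
    calc _ ≤ (δ ^ v)⁻¹ * (1 + δ * s) ^ v * (Real.exp L * renewal c β s) :=
          mul_le_mul_of_nonneg_right h2 (mul_nonneg hEpos.le (hu0 s))
      _ = _ := by ring
  · have hzo : z ∈ openHalfPlane α := mem_openHalfPlane_of_re_le hθ (by simpa using hz)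
    obtain ⟨hlim, hfix⟩ := tendsto_f hα hα0 hαs h1 (openHalfPlane_subset hzo)
    have hFre : (fInf α z).re ≤ L :=
      le_of_tendsto ((Complex.continuous_re.tendsto _).comp hlim) (Eventually.of_forall (hfL z hz))
    have hnorm : ∀ w : ℂ, w.re ≤ L → ‖Complex.exp w‖ ≤ Real.exp L := fun w hw => by
      rw [Complex.norm_exp]; exact Real.exp_le_exp.mpr hw
    have hx : ‖xFun α z‖ ≤ Real.exp L := hnorm _ hFre
    have hd : ∀ s, ‖f α s z - fInf α z‖ ≤ renewal c β s := by
      refine le_renewal hβ0 fun s => (norm_f_sub_fixedPoint_le hα hα0 hαs hfix s).trans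
        (add_le_add ?_ (Finset.sum_le_sum fun i _ => ?_))
      · rw [mul_comm]
        refine mul_le_mul_of_nonneg_right ?_ (tailSum_nonneg hα s)
        refine (norm_sub_le _ _).trans ?_
        rw [norm_one]
        gcongr
        exact hx
      · rw [show β i = α i * Real.exp L from mul_comm _ _, mul_assoc]
        exact mul_le_mul_of_nonneg_left (norm_exp_sub_exp_le (hfL z hz _) hFre) (hα i)
    refine ⟨hx, fun s => hnorm _ (hfL z hz s), fun s => ?_⟩
    exact (norm_exp_sub_exp_le (hfL z hz s) hFre).trans
      (mul_le_mul_of_nonneg_left (hd s) hEpos.le)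

end

end DiscreteHawkes

namespace DiscreteHawkes

/-! ### Analyticity -/

section
variable {α : ℕ → ℝ}

theorem isOpen_openHalfPlane (α : ℕ → ℝ) : IsOpen (openHalfPlane α) := by
  by_cases h : norm1 α = 0
  · simp [openHalfPlane, h]
  · simpa [openHalfPlane, h] using isOpen_lt Complex.continuous_re continuous_const

theorem exists_re_lt_mem_openHalfPlane {z : ℂ} (hz : z ∈ openHalfPlane α) :
    ∃ θ : ℝ, z.re < θ ∧ (θ : ℂ) ∈ openHalfPlane α := by
  by_cases h : norm1 α = 0
  · exact ⟨z.re + 1, by linarith, Or.inl h⟩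
  · obtain ⟨θ, h1, h2⟩ := exists_between (hz.resolve_left h)
    exact ⟨θ, h1, Or.inr (by simpa using h2)⟩

theorem differentiable_f (α : ℕ → ℝ) (s : ℕ) : Differentiable ℂ (f α s) := by
  induction s using Nat.strong_induction_on with
  | _ s ih =>
    have : f α s = fun z => z + ∑ i ∈ Finset.Icc 1 s, (α i : ℂ) *
        (Complex.exp (f α (s - i) z) - 1) := funext fun z => f_eq α s z
    rw [this]
    refine differentiable_id.add (Differentiable.fun_sum fun i hi => ?_)
    rw [Finset.mem_Icc] at hi
    exact ((ih _ (by omega)).cexp.sub_const 1).const_mul _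

theorem isOpen_re_lt (θ : ℝ) : IsOpen {z : ℂ | z.re < θ} :=
  isOpen_lt Complex.continuous_re continuous_const

theorem summable_of_weighted {u : ℕ → ℝ} {v : ℕ} (hu : ∀ s, 0 ≤ u s)
    (h : Summable fun s : ℕ => (1 + s : ℝ) ^ v * u s) : Summable u :=
  h.of_nonneg_of_le hu fun s => le_mul_of_one_le_left (hu s)
    (one_le_pow₀ (by linarith [Nat.cast_nonneg (α := ℝ) s]))

variable {v : ℕ}

theorem summable_phi (hα : ∀ i, 0 ≤ α i) (hα0 : α 0 = 0) (hαs : Summable α) (h1 : norm1 α ≤ 1)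
    (hmom : Summable fun i : ℕ => (i : ℝ) ^ (v + 1) * α i) {z : ℂ} (hz : z ∈ openHalfPlane α) :
    Summable fun i => Complex.exp (f α i z) - xFun α z := by
  obtain ⟨θ, hθ, hθm⟩ := exists_re_lt_mem_openHalfPlane hz
  obtain ⟨L, u, _, hu0, hus, hu⟩ := exists_uniform_rate hα hα0 hαs h1 hmom hθm
  exact (summable_of_weighted hu0 hus).of_norm_bounded (hu z hθ.le).2.2

theorem analyticOnNhd_xFun (hα : ∀ i, 0 ≤ α i) (hα0 : α 0 = 0) (hαs : Summable α)
    (h1 : norm1 α ≤ 1) (hmom : Summable fun i : ℕ => (i : ℝ) ^ (v + 1) * α i) :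
    AnalyticOnNhd ℂ (xFun α) (openHalfPlane α) := by
  intro z hz
  obtain ⟨θ, hθ, hθm⟩ := exists_re_lt_mem_openHalfPlane hz
  obtain ⟨L, u, _, hu0, hus, hu⟩ := exists_uniform_rate hα hα0 hαs h1 hmom hθm
  have hlim := (summable_of_weighted hu0 hus).tendsto_atTop_zero
  have hunif : TendstoUniformlyOn (fun s z => Complex.exp (f α s z)) (xFun α) atTop
      {z : ℂ | z.re < θ} := by
    rw [Metric.tendstoUniformlyOn_iff]
    intro ε hε
    filter_upwards [hlim.eventually_lt_const hε] with s hs w hw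
    rw [dist_comm, dist_eq_norm]
    exact ((hu w (le_of_lt hw)).2.2 s).trans_lt hs
  have hd := hunif.tendstoLocallyUniformlyOn.differentiableOn
    (Eventually.of_forall fun s => ((differentiable_f α s).cexp).differentiableOn)
    (isOpen_re_lt θ)
  exact hd.analyticAt ((isOpen_re_lt θ).mem_nhds hθ)

theorem analyticOnNhd_phi (hα : ∀ i, 0 ≤ α i) (hα0 : α 0 = 0) (hαs : Summable α)
    (h1 : norm1 α ≤ 1) (hmom : Summable fun i : ℕ => (i : ℝ) ^ (v + 1) * α i) :
    AnalyticOnNhd ℂ (phi α) (openHalfPlane α) := by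
  intro z hz
  obtain ⟨θ, hθ, hθm⟩ := exists_re_lt_mem_openHalfPlane hz
  obtain ⟨L, u, _, hu0, hus, hu⟩ := exists_uniform_rate hα hα0 hαs h1 hmom hθm
  have hx : DifferentiableOn ℂ (xFun α) {z : ℂ | z.re < θ} := fun w hw =>
    (analyticOnNhd_xFun hα hα0 hαs h1 hmom w
      (mem_openHalfPlane_of_re_le hθm (by simpa using le_of_lt hw))).differentiableAt
        |>.differentiableWithinAt
  have hd := Complex.differentiableOn_tsum_of_summable_norm (summable_of_weighted hu0 hus)
    (F := fun i z => Complex.exp (f α i z) - xFun α z)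
    (fun i => ((differentiable_f α i).cexp).differentiableOn.sub hx) (isOpen_re_lt θ)
    fun i w hw => (hu w (le_of_lt hw)).2.2 i
  exact hd.analyticAt ((isOpen_re_lt θ).mem_nhds hθ)

theorem analyticOnNhd_psi (ν : ℝ) (hα : ∀ i, 0 ≤ α i) (hα0 : α 0 = 0) (hαs : Summable α)
    (h1 : norm1 α ≤ 1) (hmom : Summable fun i : ℕ => (i : ℝ) ^ (v + 1) * α i) :
    AnalyticOnNhd ℂ (psi ν α) (openHalfPlane α) := fun z hz =>
  (analyticAt_const.mul (analyticOnNhd_phi hα hα0 hαs h1 hmom z hz)).cexp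

theorem analyticOnNhd_eta (ν : ℝ) (hα : ∀ i, 0 ≤ α i) (hα0 : α 0 = 0) (hαs : Summable α)
    (h1 : norm1 α ≤ 1) (hmom : Summable fun i : ℕ => (i : ℝ) ^ (v + 1) * α i) :
    AnalyticOnNhd ℂ (eta ν α) (openHalfPlane α) := fun z hz =>
  analyticAt_const.mul ((analyticOnNhd_xFun hα hα0 hαs h1 hmom z hz).sub analyticAt_const)

/-! ### Derivatives of `η` -/

theorem one_sub_mul_xFun_ne_zero (hα : ∀ i, 0 ≤ α i) (hα0 : α 0 = 0) (hαs : Summable α)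
    (h1 : norm1 α ≤ 1) (hmom : Summable fun i : ℕ => (i : ℝ) ^ (v + 1) * α i) {z : ℂ}
    (hz : z ∈ openHalfPlane α) : 1 - norm1 α * xFun α z ≠ 0 := by
  obtain ⟨θ, hθ, hθm⟩ := exists_re_lt_mem_openHalfPlane hz
  obtain ⟨L, u, hL, hu0, hus, hu⟩ := exists_uniform_rate hα hα0 hαs h1 hmom hθm
  intro h
  have h2 : ‖(norm1 α : ℂ) * xFun α z‖ = 1 := by rw [← sub_eq_zero.mp h, norm_one]
  rw [norm_mul, Complex.norm_real, Real.norm_of_nonneg (norm1_nonneg hα)] at h2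
  have := mul_le_mul_of_nonneg_left (hu z hθ.le).1 (norm1_nonneg hα)
  linarith

/-- Implicit differentiation of x = exp(z + m (x - 1)): analyticity being known, a linear equation
for x' remains, solvable because |m x(z)| < 1. -/
theorem hasDerivAt_xFun (hα : ∀ i, 0 ≤ α i) (hα0 : α 0 = 0) (hαs : Summable α)
    (h1 : norm1 α ≤ 1) (hmom : Summable fun i : ℕ => (i : ℝ) ^ (v + 1) * α i) {z : ℂ}
    (hz : z ∈ openHalfPlane α) :
    HasDerivAt (xFun α) (xFun α z / (1 - norm1 α * xFun α z)) z := by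
  have hne := one_sub_mul_xFun_ne_zero hα hα0 hαs h1 hmom hz
  have hd := (analyticOnNhd_xFun hα hα0 hαs h1 hmom z hz).differentiableAt.hasDerivAt
  have hd2 : HasDerivAt (fun z => Complex.exp (z + norm1 α * (xFun α z - 1)))
      (Complex.exp (z + norm1 α * (xFun α z - 1)) * (1 + norm1 α * deriv (xFun α) z)) z :=
    ((hasDerivAt_id z).add ((hd.sub_const 1).const_mul _)).cexp
  have heq : xFun α =ᶠ[𝓝 z] fun z => Complex.exp (z + norm1 α * (xFun α z - 1)) := by
    filter_upwards [(isOpen_openHalfPlane α).mem_nhds hz] with w hw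
    exact xFun_eq hα hα0 hαs h1 (openHalfPlane_subset hw)
  have hval := hd.unique (hd2.congr_of_eventuallyEq heq)
  rw [← xFun_eq hα hα0 hαs h1 (openHalfPlane_subset hz)] at hval
  have : deriv (xFun α) z = xFun α z / (1 - norm1 α * xFun α z) := by
    rw [eq_div_iff hne]
    linear_combination hval
  rw [← this]
  exact hd

theorem deriv_eta (ν : ℝ) (hα : ∀ i, 0 ≤ α i) (hα0 : α 0 = 0) (hαs : Summable α)
    (h1 : norm1 α ≤ 1) (hmom : Summable fun i : ℕ => (i : ℝ) ^ (v + 1) * α i) {z : ℂ}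
    (hz : z ∈ openHalfPlane α) :
    deriv (eta ν α) z = ν * (xFun α z / (1 - norm1 α * xFun α z)) :=
  (((hasDerivAt_xFun hα hα0 hαs h1 hmom hz).sub_const 1).const_mul (ν : ℂ)).deriv

theorem iteratedDeriv_two_eta (ν : ℝ) (hα : ∀ i, 0 ≤ α i) (hα0 : α 0 = 0) (hαs : Summable α)
    (h1 : norm1 α ≤ 1) (hmom : Summable fun i : ℕ => (i : ℝ) ^ (v + 1) * α i) {z : ℂ}
    (hz : z ∈ openHalfPlane α) :
    iteratedDeriv 2 (eta ν α) z = ν * xFun α z / (1 - norm1 α * xFun α z) ^ 3 := by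
  have hne := one_sub_mul_xFun_ne_zero hα hα0 hαs h1 hmom hz
  rw [iteratedDeriv_succ, iteratedDeriv_one]
  have heq : deriv (eta ν α) =ᶠ[𝓝 z] fun w => ν * (xFun α w / (1 - norm1 α * xFun α w)) := by
    filter_upwards [(isOpen_openHalfPlane α).mem_nhds hz] with w hw
    exact deriv_eta ν hα hα0 hαs h1 hmom hw
  rw [heq.deriv_eq]
  have hx := hasDerivAt_xFun hα hα0 hαs h1 hmom hz
  have := ((hx.fun_div ((hx.const_mul (norm1 α : ℂ)).const_sub 1) hne).const_mul (ν : ℂ)).deriv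
  rw [this]
  field_simp
  ring

/-! ### The saddle point -/

variable {ν x : ℝ}

/-- The value of `x(z)` at the saddle point. -/
noncomputable def saddleValue (ν : ℝ) (α : ℕ → ℝ) (x : ℝ) : ℝ := x / (ν + norm1 α * x)

theorem saddleValue_pos (hν : 0 < ν) (hα : ∀ i, 0 ≤ α i) (hx : 0 < x) :
    0 < saddleValue ν α x := by
  have := norm1_nonneg hα
  unfold saddleValue
  positivity

theorem one_sub_saddleValue (hν : 0 < ν) (hα : ∀ i, 0 ≤ α i) (hx : 0 < x) :
    1 - norm1 α * saddleValue ν α x = ν / (ν + norm1 α * x) := by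
  have := norm1_nonneg hα
  unfold saddleValue
  field_simp
  ring

theorem mul_saddleValue_lt_one (hν : 0 < ν) (hα : ∀ i, 0 ≤ α i) (hx : 0 < x) :
    norm1 α * saddleValue ν α x < 1 := by
  have h := one_sub_saddleValue hν hα hx
  have := norm1_nonneg hα
  have : 0 < ν / (ν + norm1 α * x) := by positivity
  linarith

theorem thetaStar_eq (ν : ℝ) (α : ℕ → ℝ) (x : ℝ) :
    thetaStar ν α x = Real.log (saddleValue ν α x) - norm1 α * (saddleValue ν α x - 1) := by
  rw [thetaStar, saddleValue]
  ring

/-- With X = x / (ν + m x), the claim θ* < θ_c is log(m X) < m X - 1, strict because m X < 1. -/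
theorem thetaStar_mem (hν : 0 < ν) (hα : ∀ i, 0 ≤ α i) (hx : 0 < x) :
    (thetaStar ν α x : ℂ) ∈ openHalfPlane α := by
  rcases (norm1_nonneg hα).eq_or_lt with h | h
  · exact Or.inl h.symm
  · right
    have hX := saddleValue_pos hν hα hx
    have hlt := mul_saddleValue_lt_one hν hα hx
    have := Real.log_lt_sub_one_of_pos (mul_pos h hX) hlt.ne
    rw [Real.log_mul h.ne' hX.ne'] at this
    rw [Complex.ofReal_re, thetaStar_eq]
    linarith

/-- Both f_∞(θ*) and log X solve F = θ* + m (e^F - 1), and both lie in a half-plane on which the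
right-hand side is a strict contraction, so they agree. -/
theorem xFun_thetaStar (hν : 0 < ν) (hα : ∀ i, 0 ≤ α i) (hα0 : α 0 = 0) (hαs : Summable α)
    (h1 : norm1 α ≤ 1) (hmom : Summable fun i : ℕ => (i : ℝ) ^ (v + 1) * α i) (hx : 0 < x) :
    xFun α (thetaStar ν α x) = saddleValue ν α x := by
  have hθ := thetaStar_mem hν hα hx
  have hX := saddleValue_pos hν hα hx
  set X := saddleValue ν α x with hXdef
  obtain ⟨L, u, hL, -, -, hu⟩ := exists_uniform_rate hα hα0 hαs h1 hmom hθ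
  obtain ⟨-, hfix⟩ := tendsto_f hα hα0 hαs h1 (openHalfPlane_subset hθ)
  set F := fInf α (thetaStar ν α x) with hF
  have hFL : F.re ≤ max L (Real.log X) := by
    have := (hu _ (le_of_eq (Complex.ofReal_re _))).1
    rw [xFun, Complex.norm_exp, Real.exp_le_exp] at this
    exact this.trans (le_max_left _ _)
  have hlog : Complex.exp (Real.log X : ℂ) = X := by
    rw [← Complex.ofReal_exp, Real.exp_log hX]
  have hXL : ((Real.log X : ℝ) : ℂ).re ≤ max L (Real.log X) := by simp
  have hmax : norm1 α * Real.exp (max L (Real.log X)) < 1 := by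
    rcases max_choice L (Real.log X) with h | h
    · rw [h]; exact hL
    · rw [h, Real.exp_log hX]; exact mul_saddleValue_lt_one hν hα hx
  have hdiff : F - Real.log X = norm1 α * (Complex.exp F - Complex.exp (Real.log X : ℂ)) := by
    conv_lhs => rw [hfix, thetaStar_eq]
    rw [hlog]
    push_cast
    ring
  have hle := norm_exp_sub_exp_le hFL hXL
  have hn : ‖F - Real.log X‖ ≤ norm1 α * Real.exp (max L (Real.log X)) * ‖F - Real.log X‖ := by
    conv_lhs => rw [hdiff]
    rw [norm_mul, Complex.norm_real, Real.norm_of_nonneg (norm1_nonneg hα), mul_assoc]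
    exact mul_le_mul_of_nonneg_left hle (norm1_nonneg hα)
  have h0 : ‖F - Real.log X‖ = 0 := by
    nlinarith [norm_nonneg (F - Real.log X)]
  rw [xFun, ← hF, sub_eq_zero.mp (norm_eq_zero.mp h0), hlog]

theorem deriv_eta_thetaStar (hν : 0 < ν) (hα : ∀ i, 0 ≤ α i) (hα0 : α 0 = 0)
    (hαs : Summable α) (h1 : norm1 α ≤ 1)
    (hmom : Summable fun i : ℕ => (i : ℝ) ^ (v + 1) * α i) (hx : 0 < x) :
    deriv (eta ν α) (thetaStar ν α x) = x := by
  rw [deriv_eta ν hα hα0 hαs h1 hmom (thetaStar_mem hν hα hx),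
    xFun_thetaStar hν hα hα0 hαs h1 hmom hx]
  have h2 := one_sub_saddleValue hν hα hx
  have := norm1_nonneg hα
  have h3 : ν * (saddleValue ν α x / (1 - norm1 α * saddleValue ν α x)) = x := by
    rw [h2, saddleValue]
    field_simp
  exact_mod_cast h3

theorem iteratedDeriv_two_eta_thetaStar (hν : 0 < ν) (hα : ∀ i, 0 ≤ α i) (hα0 : α 0 = 0)
    (hαs : Summable α) (h1 : norm1 α ≤ 1)
    (hmom : Summable fun i : ℕ => (i : ℝ) ^ (v + 1) * α i) (hx : 0 < x) :
    iteratedDeriv 2 (eta ν α) (thetaStar ν α x) =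
      ((x * (ν + norm1 α * x) ^ 2 / ν ^ 2 : ℝ) : ℂ) := by
  rw [iteratedDeriv_two_eta ν hα hα0 hαs h1 hmom (thetaStar_mem hν hα hx),
    xFun_thetaStar hν hα hα0 hαs h1 hmom hx]
  have h2 := one_sub_saddleValue hν hα hx
  have := norm1_nonneg hα
  have h3 : ν * saddleValue ν α x / (1 - norm1 α * saddleValue ν α x) ^ 3 =
      x * (ν + norm1 α * x) ^ 2 / ν ^ 2 := by
    rw [h2, saddleValue]
    field_simp
  exact_mod_cast h3

/-- Legendre duality I(x) = x θ* - η(θ*): the factor e^{-t I(x)} is the integrand's size at the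
saddle point. -/
theorem rate_eq (hν : 0 < ν) (hα : ∀ i, 0 ≤ α i) (hx : 0 < x) :
    rate ν α x = x * thetaStar ν α x - ν * (saddleValue ν α x - 1) := by
  have := norm1_nonneg hα
  have h : saddleValue ν α x * (ν + norm1 α * x) = x := by
    rw [saddleValue]; field_simp
  rw [rate, thetaStar_eq, show x / (ν + x * norm1 α) = saddleValue ν α x by
    rw [saddleValue, mul_comm x]]
  linear_combination h

theorem iteratedDeriv_two_rate (hν : 0 < ν) (hα : ∀ i, 0 ≤ α i) (hx : 0 < x) :
    iteratedDeriv 2 (rate ν α) x = ν ^ 2 / (x * (ν + norm1 α * x) ^ 2) := by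
  have hm := norm1_nonneg hα
  set m := norm1 α with hmdef
  have hq : ∀ y : ℝ, 0 < y → HasDerivAt (fun y => y / (ν + y * m)) (ν / (ν + y * m) ^ 2) y := by
    intro y hy
    have hne : ν + y * m ≠ 0 := by positivity
    have := (hasDerivAt_id y).fun_div (((hasDerivAt_id y).mul_const m).const_add ν) hne
    refine this.congr_deriv ?_
    simp only [id_eq]
    field_simp
    ring
  have hlog : ∀ y : ℝ, 0 < y → HasDerivAt (fun y => Real.log (y / (ν + y * m)))
      (ν / (y * (ν + y * m))) y := by
    intro y hy
    have hne : y / (ν + y * m) ≠ 0 := by positivity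
    refine ((hq y hy).log hne).congr_deriv ?_
    field_simp
  have hd1 : ∀ y : ℝ, 0 < y → HasDerivAt (rate ν α)
      (Real.log (y / (ν + y * m)) + ν / (ν + y * m) - 1 + m) y := by
    intro y hy
    have h := ((((hasDerivAt_id y).fun_mul (hlog y hy)).fun_sub (hasDerivAt_id y)).fun_add
      ((hasDerivAt_id y).mul_const m)).add_const ν
    refine h.congr_deriv ?_
    have : ν + y * m ≠ 0 := by positivity
    simp only [id_eq, one_mul]
    field_simp
  rw [iteratedDeriv_succ, iteratedDeriv_one]
  have heq : deriv (rate ν α) =ᶠ[𝓝 x]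
      fun y => Real.log (y / (ν + y * m)) + ν / (ν + y * m) - 1 + m := by
    filter_upwards [lt_mem_nhds hx] with y hy using (hd1 y hy).deriv
  rw [heq.deriv_eq]
  have hne : ν + x * m ≠ 0 := by positivity
  have hinv : HasDerivAt (fun y => ν / (ν + y * m)) (-(ν * m) / (ν + x * m) ^ 2) x := by
    have := (hasDerivAt_const x ν).fun_div (((hasDerivAt_id x).mul_const m).const_add ν) hne
    refine this.congr_deriv ?_
    simp only [id_eq]
    ring
  have := ((((hlog x hx).fun_add hinv).sub_const 1).add_const m).deriv
  rw [this, mul_comm m x]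
  field_simp
  ring

end

end DiscreteHawkes

namespace DiscreteHawkes

/-! ### Decay away from the saddle point -/

/-- From |w| ≤ 1, |w - 1|² ≤ 2 (1 - Re w). Solving the equation for e^{iu} = w exp(-a (w - 1)) gives
|e^{iu} - 1| ≤ 2 e² |w - 1|, while |e^{iu} - 1|² = 2 - 2 cos u ≥ 4 u² / π² on the segment. The
constant is what these three bounds combine to. -/
theorem sq_le_one_sub_re {w : ℂ} {a u : ℝ} (hw : ‖w‖ ≤ 1) (ha0 : 0 ≤ a) (ha1 : a ≤ 1)
    (h : w = Complex.exp (Complex.I * u + a * (w - 1))) (hu : |u| ≤ Real.pi) :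
    (2 * Real.pi ^ 2 * Real.exp 2 ^ 2)⁻¹ * u ^ 2 ≤ 1 - w.re := by
  set y : ℂ := -(a * (w - 1)) with hy
  have hN2 : ‖w - 1‖ ^ 2 ≤ 2 * (1 - w.re) := by
    have h1 : ‖w‖ ^ 2 ≤ 1 := pow_le_one₀ (norm_nonneg _) hw
    rw [← Complex.normSq_eq_norm_sq, Complex.normSq_apply] at h1 ⊢
    simp only [Complex.sub_re, Complex.sub_im, Complex.one_re, Complex.one_im]
    nlinarith
  have hNle : ‖w - 1‖ ≤ 2 := by
    refine (norm_sub_le _ _).trans ?_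
    rw [norm_one]
    linarith
  have hyn : ‖y‖ ≤ ‖w - 1‖ := by
    rw [hy, norm_neg, norm_mul, Complex.norm_real, Real.norm_of_nonneg ha0]
    exact mul_le_of_le_one_left (norm_nonneg _) ha1
  have hyre : y.re ≤ 2 := (Complex.re_le_norm y).trans (hyn.trans hNle)
  have hey : ‖Complex.exp y‖ ≤ Real.exp 2 := by
    rw [Complex.norm_exp]; exact Real.exp_le_exp.mpr hyre
  have hey1 : ‖Complex.exp y - 1‖ ≤ Real.exp 2 * ‖w - 1‖ := by
    have := norm_exp_sub_exp_le (b := 0) hyre (by simp)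
    rw [Complex.exp_zero, sub_zero] at this
    exact this.trans (by gcongr)
  have hiu : Complex.exp (Complex.I * u) - 1 =
      (w - 1) * Complex.exp y + (Complex.exp y - 1) := by
    have : Complex.exp (Complex.I * u) = w * Complex.exp y := by
      conv_rhs => rw [h]
      rw [← Complex.exp_add, hy]
      ring_nf
    rw [this]; ring
  have hbound : ‖Complex.exp (Complex.I * u) - 1‖ ≤ 2 * Real.exp 2 * ‖w - 1‖ := by
    rw [hiu]
    refine (norm_add_le _ _).trans ?_
    rw [norm_mul]
    calc _ ≤ ‖w - 1‖ * Real.exp 2 + Real.exp 2 * ‖w - 1‖ := by gcongr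
      _ = _ := by ring
  have hsq : ‖Complex.exp (Complex.I * u) - 1‖ ^ 2 = 2 - 2 * Real.cos u := by
    rw [← Complex.normSq_eq_norm_sq, Complex.normSq_apply, mul_comm Complex.I]
    simp only [Complex.sub_re, Complex.sub_im, Complex.one_re, Complex.one_im,
      Complex.exp_ofReal_mul_I_re, Complex.exp_ofReal_mul_I_im]
    nlinarith [Real.sin_sq_add_cos_sq u]
  have hcos := Real.cos_le_one_sub_mul_cos_sq hu
  have hpow : ‖Complex.exp (Complex.I * u) - 1‖ ^ 2 ≤ (2 * Real.exp 2 * ‖w - 1‖) ^ 2 := by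
    gcongr
  rw [hsq, mul_pow] at hpow
  have hfin : 4 / Real.pi ^ 2 * u ^ 2 ≤ (2 * Real.exp 2) ^ 2 * (2 * (1 - w.re)) := by
    have h2 : (2 * Real.exp 2) ^ 2 * ‖w - 1‖ ^ 2 ≤ (2 * Real.exp 2) ^ 2 * (2 * (1 - w.re)) := by
      gcongr
    have h3 : 2 * (2 / Real.pi ^ 2 * u ^ 2) = 4 / Real.pi ^ 2 * u ^ 2 := by ring
    linarith
  have hπ := Real.pi_pos
  have he := Real.exp_pos 2
  have h4 : (2 * Real.pi ^ 2 * Real.exp 2 ^ 2)⁻¹ * u ^ 2 =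
      (8 * Real.exp 2 ^ 2)⁻¹ * (4 / Real.pi ^ 2 * u ^ 2) := by
    field_simp
    ring
  have h5 : (8 * Real.exp 2 ^ 2)⁻¹ * ((2 * Real.exp 2) ^ 2 * (2 * (1 - w.re))) = 1 - w.re := by
    field_simp
    norm_num
  rw [h4, ← h5]
  gcongr

section
variable {α : ℕ → ℝ} {v : ℕ} {ν x : ℝ}

theorem norm_xFun_le (hα : ∀ i, 0 ≤ α i) (hα0 : α 0 = 0) (hαs : Summable α) (h1 : norm1 α ≤ 1)
    {z : ℂ} (hz : z ∈ openHalfPlane α) : ‖xFun α z‖ ≤ ‖xFun α (z.re : ℂ)‖ := by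
  have hz' : (z.re : ℂ) ∈ openHalfPlane α := mem_openHalfPlane_of_re_le hz (by simp)
  have hlim := fun {w : ℂ} (hw : w ∈ openHalfPlane α) =>
    ((Complex.continuous_exp.tendsto _).comp
      (tendsto_f hα hα0 hαs h1 (openHalfPlane_subset hw)).1).norm
  exact le_of_tendsto_of_tendsto' (hlim hz) (hlim hz') fun s => norm_exp_f_le hα s z

theorem re_add_I_mul (θ u : ℝ) : ((θ : ℂ) + Complex.I * u).re = θ := by simp

theorem add_I_mul_mem {θ : ℝ} (hθ : (θ : ℂ) ∈ openHalfPlane α) (u : ℝ) :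
    (θ : ℂ) + Complex.I * u ∈ openHalfPlane α :=
  mem_openHalfPlane_of_re_le hθ (by simp)

/-- For w = x(θ* + iu) / x(θ*) the real part of the exponent is -ν X (1 - Re w), and dividing the
functional equations at the two points shows that w satisfies the hypothesis of `sq_le_one_sub_re`
with a = m X. -/
theorem exists_decay (hν : 0 < ν) (hα : ∀ i, 0 ≤ α i) (hα0 : α 0 = 0) (hαs : Summable α)
    (h1 : norm1 α ≤ 1) (hmom : Summable fun i : ℕ => (i : ℝ) ^ (v + 1) * α i) (hx : 0 < x) :
    ∃ c : ℝ, 0 < c ∧ ∀ u ∈ Set.Ioc (-Real.pi) Real.pi,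
      ‖Complex.exp (eta ν α (thetaStar ν α x + Complex.I * u) - eta ν α (thetaStar ν α x) -
        Complex.I * u * x)‖ ≤ Real.exp (-c * u ^ 2) := by
  have hθ := thetaStar_mem hν hα hx
  have hX := saddleValue_pos hν hα hx
  have hxθ := xFun_thetaStar hν hα hα0 hαs h1 hmom hx
  have hmX := mul_saddleValue_lt_one hν hα hx
  have hm := norm1_nonneg hα
  set X := saddleValue ν α x with hXdef
  set θ := thetaStar ν α x with hθdef
  refine ⟨ν * X * (2 * Real.pi ^ 2 * Real.exp 2 ^ 2)⁻¹,
    by have := Real.pi_pos; positivity, fun u hu => ?_⟩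
  have hz := add_I_mul_mem hθ u
  set z : ℂ := θ + Complex.I * u with hzdef
  set w : ℂ := xFun α z / X with hwdef
  have hXc : (X : ℂ) ≠ 0 := by exact_mod_cast hX.ne'
  have hwx : xFun α z = X * w := by rw [hwdef]; field_simp
  have hw1 : ‖w‖ ≤ 1 := by
    rw [hwdef, norm_div, Complex.norm_real, Real.norm_of_nonneg hX.le, div_le_one hX]
    have := norm_xFun_le hα hα0 hαs h1 hz
    rw [hzdef, re_add_I_mul, hxθ, Complex.norm_real, Real.norm_of_nonneg hX.le] at this
    exact this
  have hweq : w = Complex.exp (Complex.I * u + (norm1 α * X : ℝ) * (w - 1)) := by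
    have e1 := xFun_eq hα hα0 hαs h1 (openHalfPlane_subset hz)
    have e2 := xFun_eq hα hα0 hαs h1 (openHalfPlane_subset hθ)
    rw [hxθ] at e2
    refine mul_left_cancel₀ hXc ?_
    have e3 : ∀ A : ℂ, (X : ℂ) * Complex.exp A =
        Complex.exp (θ + norm1 α * (X - 1) + A) := fun A => by rw [Complex.exp_add, ← e2]
    rw [e3, ← hwx]
    conv_lhs => rw [e1]
    congr 1
    rw [hwx, hzdef]
    push_cast
    ring
  have hq := sq_le_one_sub_re hw1 (mul_nonneg hm hX.le) hmX.le hweq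
    (abs_le.mpr ⟨hu.1.le, hu.2⟩)
  rw [Complex.norm_exp, Real.exp_le_exp]
  have hre : (eta ν α z - eta ν α θ - Complex.I * u * x).re = -(ν * X * (1 - w.re)) := by
    have : eta ν α z - eta ν α θ - Complex.I * u * x =
        ((ν * X : ℝ) : ℂ) * (w - 1) - Complex.I * ((u * x : ℝ) : ℂ) := by
      rw [eta, eta, hxθ, hwx]
      push_cast
      ring
    rw [this, Complex.sub_re, Complex.re_ofReal_mul, Complex.sub_re, Complex.one_re]
    simp only [Complex.mul_re, Complex.I_re, Complex.I_im, Complex.ofReal_im, Complex.ofReal_re]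
    ring
  rw [hre]
  have := mul_le_mul_of_nonneg_left hq (mul_pos hν hX).le
  linarith

/-- The finite products converge to `ψ` at the rate `t ^ (-v)`, uniformly on half-planes. -/
theorem exists_psi_rate (hν : 0 < ν) (hα : ∀ i, 0 ≤ α i) (hα0 : α 0 = 0) (hαs : Summable α)
    (h1 : norm1 α ≤ 1) (hmom : Summable fun i : ℕ => (i : ℝ) ^ (v + 1) * α i)
    {θ : ℝ} (hθ : (θ : ℂ) ∈ openHalfPlane α) :
    ∃ D : ℝ, ∀ z : ℂ, z.re ≤ θ → ∀ t : ℕ, 0 < t →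
      ‖Complex.exp (ν * ∑ s ∈ Finset.range t, (Complex.exp (f α s z) - xFun α z)) - psi ν α z‖ ≤
        D / (t : ℝ) ^ v := by
  obtain ⟨L, u, -, hu0, hus, hu⟩ := exists_uniform_rate hα hα0 hαs h1 hmom hθ
  have hus' := summable_of_weighted hu0 hus
  refine ⟨Real.exp (ν * ∑' s, u s) * (ν * ∑' s : ℕ, (1 + s : ℝ) ^ v * u s), fun z hz t ht => ?_⟩
  have ht' : (0 : ℝ) < t := by exact_mod_cast ht
  have hb := (hu z hz).2.2
  have hsz : Summable fun i => Complex.exp (f α i z) - xFun α z := hus'.of_norm_bounded hb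
  have hre : ∀ S : ℂ, ‖S‖ ≤ ∑' s, u s → ((ν : ℂ) * S).re ≤ ν * ∑' s, u s := fun S hS => by
    rw [Complex.re_ofReal_mul]
    exact mul_le_mul_of_nonneg_left ((Complex.re_le_norm S).trans hS) hν.le
  have hA : ‖∑ s ∈ Finset.range t, (Complex.exp (f α s z) - xFun α z)‖ ≤ ∑' s, u s :=
    (norm_sum_le_of_le _ fun s _ => hb s).trans (hus'.sum_le_tsum _ fun s _ => hu0 s)
  have hB : ‖phi α z‖ ≤ ∑' s, u s := tsum_of_norm_bounded hus'.hasSum hb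
  refine (norm_exp_sub_exp_le (hre _ hA) (hre _ hB)).trans ?_
  rw [mul_div_assoc, ← mul_sub, norm_mul, Complex.norm_real, Real.norm_of_nonneg hν.le,
    mul_div_assoc]
  gcongr
  have htail : ∑ s ∈ Finset.range t, (Complex.exp (f α s z) - xFun α z) - phi α z =
      -∑' k, (Complex.exp (f α (k + t) z) - xFun α z) := by
    rw [phi, ← hsz.sum_add_tsum_nat_add t]
    ring
  rw [htail, norm_neg]
  have hsT : Summable fun k : ℕ => (1 + (k + t : ℕ) : ℝ) ^ v * u (k + t) :=
    (summable_nat_add_iff t).mpr hus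
  have hle : ∀ k, ‖Complex.exp (f α (k + t) z) - xFun α z‖ ≤
      (1 + (k + t : ℕ) : ℝ) ^ v * u (k + t) / (t : ℝ) ^ v := fun k => by
    refine (hb _).trans ?_
    rw [le_div_iff₀ (by positivity), mul_comm]
    refine mul_le_mul_of_nonneg_right (pow_le_pow_left₀ ht'.le ?_ v) (hu0 _)
    push_cast
    linarith [Nat.cast_nonneg (α := ℝ) k]
  refine (tsum_of_norm_bounded (hsT.div_const _).hasSum hle).trans ?_
  rw [tsum_div_const]
  refine div_le_div_of_nonneg_right ?_ (by positivity)
  rw [← hus.sum_add_tsum_nat_add t]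
  exact le_add_of_nonneg_left (Finset.sum_nonneg fun s _ => mul_nonneg (by positivity) (hu0 s))

theorem integral_gaussian_Icc_le {b : ℝ} (hb : 0 < b) :
    ∫ u : ℝ in (-Real.pi)..Real.pi, Real.exp (-b * u ^ 2) ≤ √(Real.pi / b) := by
  rw [← integral_gaussian, intervalIntegral.integral_of_le (by linarith [Real.pi_pos])]
  exact setIntegral_le_integral (integrable_exp_neg_mul_sq hb)
    (ae_of_all _ fun u => (Real.exp_pos _).le)

/-- The saddle point expansion of the inversion integrals. -/
theorem saddle_expansion (hν : 0 < ν) (hα : ∀ i, 0 ≤ α i) (hα0 : α 0 = 0) (hαs : Summable α)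
    (h1 : norm1 α ≤ 1) (hmom : Summable fun i : ℕ => (i : ℝ) ^ (v + 1) * α i) (hx : 0 < x)
    {W : ℂ → ℂ} {ρ : ℝ} (hρ : 0 < ρ)
    (hW : DifferentiableOn ℂ W (Metric.ball (thetaStar ν α x : ℂ) ρ))
    (hWc : Continuous fun u : ℝ => W (thetaStar ν α x + Complex.I * u)) :
    ∃ C : ℝ, ∀ t n : ℕ, 0 < t → (t : ℝ) * x = n →
      ‖(√(t * (x * (ν + norm1 α * x) ^ 2 / ν ^ 2) / (2 * Real.pi)) : ℂ) *
          ((Real.exp (t * rate ν α x) : ℂ) * ∫ u : ℝ in (-Real.pi)..Real.pi,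
            Complex.exp (-(n * (thetaStar ν α x + Complex.I * u))) *
              W (thetaStar ν α x + Complex.I * u) *
              Complex.exp (ν * ∑ s ∈ Finset.range t,
                (Complex.exp (f α s (thetaStar ν α x + Complex.I * u)) - 1))) -
        ∑ k ∈ Finset.range v,
          coeffA (eta ν α) (fun z => psi ν α z * W z) (thetaStar ν α x) k / (t : ℂ) ^ k‖ ≤
        C / (t : ℝ) ^ v := by
  have hθ := thetaStar_mem hν hα hx
  have hxθ := xFun_thetaStar hν hα hα0 hαs h1 hmom hx
  have hηx := deriv_eta_thetaStar hν hα hα0 hαs h1 hmom hx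
  have hησ := iteratedDeriv_two_eta_thetaStar hν hα hα0 hαs h1 hmom hx
  obtain ⟨c, hc, hdec⟩ := exists_decay hν hα hα0 hαs h1 hmom hx
  obtain ⟨D, hD⟩ := exists_psi_rate hν hα hα0 hαs h1 hmom hθ
  have hrate := rate_eq hν hα hx
  have hm := norm1_nonneg hα
  set σ : ℝ := x * (ν + norm1 α * x) ^ 2 / ν ^ 2 with hσdef
  have hσ : 0 < σ := by positivity
  set θ : ℝ := thetaStar ν α x with hθdef
  obtain ⟨ρ', hρ', hball⟩ := Metric.isOpen_iff.mp (isOpen_openHalfPlane α) _ hθ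
  set r := min ρ ρ' with hr
  have hr0 : 0 < r := lt_min hρ hρ'
  have hsub : Metric.ball (θ : ℂ) r ⊆ openHalfPlane α :=
    (Metric.ball_subset_ball (min_le_right _ _)).trans hball
  have hηa := analyticOnNhd_eta ν hα hα0 hαs h1 hmom
  have hψa := analyticOnNhd_psi ν hα hα0 hαs h1 hmom
  have hxa := analyticOnNhd_xFun hα hα0 hαs h1 hmom
  have hline : ∀ {g : ℂ → ℂ}, AnalyticOnNhd ℂ g (openHalfPlane α) →
      Continuous fun u : ℝ => g (θ + Complex.I * u) := fun {g} hg =>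
    hg.continuousOn.comp_continuous (by fun_prop) (add_I_mul_mem hθ)
  have hηc := hline hηa
  have hψc := hline hψa
  have hxc := hline hxa
  have hfc : ∀ s, Continuous fun u : ℝ => Complex.exp (f α s (θ + Complex.I * u)) := fun s =>
    (differentiable_f α s).cexp.continuous.comp (by fun_prop)
  obtain ⟨C₁, hC₁⟩ := laplace_expansion (h := fun z => psi ν α z * W z) hr0
    (hηa.differentiableOn.mono hsub)
    ((hψa.differentiableOn.mono hsub).fun_mul (hW.mono (Metric.ball_subset_ball (min_le_left _ _))))
    hηx hσ hησ hc hηc (hψc.mul hWc) hdec v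
  obtain ⟨B, hB⟩ := isCompact_Icc.exists_bound_of_continuousOn
    (s := Set.Icc (-Real.pi) Real.pi) hWc.continuousOn
  have hπ : -Real.pi ≤ Real.pi := by linarith [Real.pi_pos]
  have hB0 : 0 ≤ B := (norm_nonneg _).trans (hB 0 ⟨by linarith, by linarith⟩)
  refine ⟨C₁ + √(σ / (2 * c)) * (B * D), fun t n ht htn => ?_⟩
  have ht' : (0 : ℝ) < t := by exact_mod_cast ht
  set E : ℝ → ℂ := fun u => Complex.exp (t * (eta ν α (θ + Complex.I * u) - eta ν α θ -
    Complex.I * u * x)) with hE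
  set M : ℝ → ℂ := fun u => Complex.exp (ν * ∑ s ∈ Finset.range t,
    (Complex.exp (f α s (θ + Complex.I * u)) - xFun α (θ + Complex.I * u))) with hM
  have hEc : Continuous E := Complex.continuous_exp.comp (continuous_const.mul
      ((hηc.sub continuous_const).sub (by fun_prop)))
  have hMc : Continuous M := Complex.continuous_exp.comp (continuous_const.mul
      (continuous_finsetSum _ fun s _ => (hfc s).sub hxc))
  -- Writing e^{f_s} - 1 = (e^{f_s} - x) + (x - 1) and using n = t x and I(x) = x θ* - η(θ*), the
  -- integrand is E M W. Replacing M by ψ gives the Laplace integral; the error M - ψ is O(t^{-v})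
  -- uniformly and is integrated against a Gaussian bound for E.
  have hint : ∀ u : ℝ, (Real.exp (t * rate ν α x) : ℂ) *
      (Complex.exp (-(n * (θ + Complex.I * u))) * W (θ + Complex.I * u) *
        Complex.exp (ν * ∑ s ∈ Finset.range t, (Complex.exp (f α s (θ + Complex.I * u)) - 1))) =
      E u * (psi ν α (θ + Complex.I * u) * W (θ + Complex.I * u)) +
      E u * (W (θ + Complex.I * u) * (M u - psi ν α (θ + Complex.I * u))) := by
    intro u
    have hexp : (Real.exp (t * rate ν α x) : ℂ) * Complex.exp (-(n * (θ + Complex.I * u))) *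
        Complex.exp (ν * ∑ s ∈ Finset.range t, (Complex.exp (f α s (θ + Complex.I * u)) - 1)) =
        E u * M u := by
      rw [hE, hM, Complex.ofReal_exp, ← Complex.exp_add, ← Complex.exp_add, ← Complex.exp_add]
      congr 1
      have hn : (n : ℂ) = t * x := by exact_mod_cast htn.symm
      rw [hn, hrate, eta, eta, hxθ, Finset.sum_sub_distrib, Finset.sum_sub_distrib]
      simp only [Finset.sum_const, Finset.card_range, nsmul_eq_mul]
      push_cast
      ring
    calc _ = ((Real.exp (t * rate ν α x) : ℂ) * Complex.exp (-(n * (θ + Complex.I * u))) *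
        Complex.exp (ν * ∑ s ∈ Finset.range t, (Complex.exp (f α s (θ + Complex.I * u)) - 1))) *
          W (θ + Complex.I * u) := by ring
      _ = _ := by rw [hexp]; ring
  rw [← intervalIntegral.integral_const_mul]
  simp only [hint]
  have i1 : IntervalIntegrable (fun u : ℝ => E u * (psi ν α (θ + Complex.I * u) *
      W (θ + Complex.I * u))) volume (-Real.pi) Real.pi :=
    (hEc.mul (hψc.mul hWc)).intervalIntegrable _ _
  have i2 : IntervalIntegrable (fun u : ℝ => E u * (W (θ + Complex.I * u) *
      (M u - psi ν α (θ + Complex.I * u)))) volume (-Real.pi) Real.pi :=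
    (hEc.mul (hWc.mul (hMc.sub hψc))).intervalIntegrable _ _
  rw [intervalIntegral.integral_add i1 i2, mul_add, add_sub_right_comm]
  refine (norm_add_le _ _).trans ?_
  rw [add_div]
  refine add_le_add (hC₁ t ht) ?_
  have hJ : ‖∫ u : ℝ in (-Real.pi)..Real.pi,
      E u * (W (θ + Complex.I * u) * (M u - psi ν α (θ + Complex.I * u)))‖ ≤
      B * (D / (t : ℝ) ^ v) * √(Real.pi / (c * t)) := by
    have hle := intervalIntegral.norm_integral_le_of_norm_le hπ
      (f := fun u : ℝ => E u * (W (θ + Complex.I * u) * (M u - psi ν α (θ + Complex.I * u))))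
      (g := fun u => B * (D / (t : ℝ) ^ v) * Real.exp (-(c * t) * u ^ 2)) (μ := volume)
      (ae_of_all _ fun u hu => by
        rw [norm_mul, norm_mul]
        have e1 : ‖E u‖ ≤ Real.exp (-(c * t) * u ^ 2) := by
          simp only [hE]
          rw [Complex.exp_nat_mul, norm_pow]
          calc _ ≤ Real.exp (-c * u ^ 2) ^ t := by gcongr; exact hdec u hu
            _ = _ := by rw [← Real.exp_nat_mul]; ring_nf
        have e2 := hB u (Set.Ioc_subset_Icc_self hu)
        have e3 := hD (θ + Complex.I * u) (by simp) t ht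
        calc _ ≤ Real.exp (-(c * t) * u ^ 2) * (B * (D / (t : ℝ) ^ v)) :=
              mul_le_mul e1 (mul_le_mul e2 e3 (norm_nonneg _) hB0) (by positivity)
                (Real.exp_pos _).le
          _ = _ := by ring)
      ((by fun_prop : Continuous _).intervalIntegrable _ _)
    refine hle.trans ?_
    rw [intervalIntegral.integral_const_mul]
    have hD0 : 0 ≤ D / (t : ℝ) ^ v := (norm_nonneg _).trans (hD θ (by simp) t ht)
    exact mul_le_mul_of_nonneg_left (integral_gaussian_Icc_le (by positivity))
      (mul_nonneg hB0 hD0)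
  rw [norm_mul, Complex.norm_real, Real.norm_of_nonneg (Real.sqrt_nonneg _)]
  calc _ ≤ √(t * σ / (2 * Real.pi)) * (B * (D / (t : ℝ) ^ v) * √(Real.pi / (c * t))) := by
        gcongr
    _ = (√(t * σ / (2 * Real.pi)) * √(Real.pi / (c * t))) * (B * (D / (t : ℝ) ^ v)) := by ring
    _ = _ := by
        rw [← Real.sqrt_mul (by positivity)]
        have := Real.pi_pos
        rw [show (t : ℝ) * σ / (2 * Real.pi) * (Real.pi / (c * t)) = σ / (2 * c) by field_simp]
        ring

end

end DiscreteHawkes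

namespace DiscreteHawkes

/-! ### The expansions of the point and tail probabilities -/

theorem coeffA_zero (η ψ : ℂ → ℂ) (θ : ℂ) : coeffA η ψ θ 0 = ψ θ := by
  have h : tuples 0 = {Fin.elim0} := by
    ext m
    simp [mem_tuples, eq_iff_true_of_subsingleton]
  simp [coeffA, innerSum, h, tupleFactor]

/-- An expansion of `p / q` to order `v` in `1 / t`, with the leading term split off and the
remainder made explicit. -/
theorem exists_remainder {S : Set ℕ} {p q c : ℕ → ℂ} {C : ℝ} (v : ℕ)
    (hq : ∀ t ∈ S, 0 < t → q t ≠ 0)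
    (h : ∀ t ∈ S, 0 < t →
      ‖(q t)⁻¹ * p t - ∑ k ∈ Finset.range v, c k / (t : ℂ) ^ k‖ ≤ C / (t : ℝ) ^ v) :
    ∃ R : ℕ → ℂ, R =O[atTop ⊓ 𝓟 S] (fun t : ℕ => 1 / (t : ℝ) ^ v) ∧
      ∀ t ∈ S, 0 < t →
        p t = q t * (c 0 + ∑ k ∈ Finset.Ico 1 v, c k / (t : ℂ) ^ k + R t) := by
  refine ⟨fun t => (q t)⁻¹ * p t - (c 0 + ∑ k ∈ Finset.Ico 1 v, c k / (t : ℂ) ^ k), ?_, ?_⟩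
  · refine IsBigO.of_bound (C + ‖c 0‖) ?_
    rw [eventually_inf_principal]
    filter_upwards [eventually_gt_atTop 0] with t ht hS
    have ht' : (0 : ℝ) < t := by exact_mod_cast ht
    have hnorm : ‖1 / (t : ℝ) ^ v‖ = 1 / (t : ℝ) ^ v := Real.norm_of_nonneg (by positivity)
    have hb := h t hS ht
    rw [hnorm, mul_one_div, add_div]
    -- For v = 0 the hypothesis contains no term c 0 although the conclusion does; it is absorbed
    -- into the O(1) remainder, hence the extra ‖c 0‖ in the bound.
    rcases v with - | v
    · simp only [Finset.range_zero, Finset.sum_empty, sub_zero, pow_zero, div_one] at hb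
      simp only [zero_le, Finset.Ico_eq_empty_of_le, Finset.sum_empty, add_zero, pow_zero,
        div_one]
      exact (norm_sub_le _ _).trans (by linarith)
    · rw [Finset.range_eq_Ico, Finset.sum_eq_sum_Ico_succ_bot (Nat.succ_pos v), pow_zero,
        div_one] at hb
      have : 0 ≤ ‖c 0‖ / (t : ℝ) ^ (v + 1) := by positivity
      exact hb.trans (by linarith)
  · intro t hS ht
    rw [add_sub_cancel, mul_inv_cancel_left₀ (hq t hS ht)]

section
variable {α : ℕ → ℝ} {v : ℕ} {ν x : ℝ}

theorem exists_expansion (hν : 0 < ν) (hα : ∀ i, 0 ≤ α i) (hα0 : α 0 = 0) (hαs : Summable α)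
    (h1 : norm1 α ≤ 1) (hmom : Summable fun i : ℕ => (i : ℝ) ^ (v + 1) * α i) (hx : 0 < x)
    {W : ℂ → ℂ} {ρ : ℝ} (hρ : 0 < ρ)
    (hW : DifferentiableOn ℂ W (Metric.ball (thetaStar ν α x : ℂ) ρ))
    (hWc : Continuous fun u : ℝ => W (thetaStar ν α x + Complex.I * u))
    {p : ℕ → ℂ}
    (hp : ∀ t n : ℕ, (t : ℝ) * x = n →
      2 * (Real.pi : ℂ) * p t = ∫ u : ℝ in (-Real.pi)..Real.pi,
        Complex.exp (-(n * (thetaStar ν α x + Complex.I * u))) *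
          W (thetaStar ν α x + Complex.I * u) *
          Complex.exp (ν * ∑ s ∈ Finset.range t,
            (Complex.exp (f α s (thetaStar ν α x + Complex.I * u)) - 1))) :
    ∃ R : ℕ → ℂ, R =O[atTop ⊓ 𝓟 (latticeTimes x)] (fun t : ℕ => 1 / (t : ℝ) ^ v) ∧
      ∀ t ∈ latticeTimes x, 0 < t →
        p t = (Real.exp (-(t * rate ν α x)) : ℂ) *
          (Real.sqrt (iteratedDeriv 2 (rate ν α) x / (2 * Real.pi * t)) : ℂ) *
          (coeffA (eta ν α) (fun z => psi ν α z * W z) (thetaStar ν α x) 0 +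
            ∑ k ∈ Finset.Ico 1 v,
              coeffA (eta ν α) (fun z => psi ν α z * W z) (thetaStar ν α x) k / (t : ℂ) ^ k +
            R t) := by
  have hm := norm1_nonneg hα
  have hI : 0 < iteratedDeriv 2 (rate ν α) x := by
    rw [iteratedDeriv_two_rate hν hα hx]; positivity
  -- As η''(θ*) = 1 / I''(x), the Laplace normalisation, with the 2π of Fourier inversion, is the
  -- inverse of the prefactor in the theorem.
  have hsqrt : ∀ t : ℕ, 0 < t →
      (√(iteratedDeriv 2 (rate ν α) x / (2 * Real.pi * t)))⁻¹ =
        √(t * (x * (ν + norm1 α * x) ^ 2 / ν ^ 2) / (2 * Real.pi)) * (2 * Real.pi) := by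
    intro t ht
    have ht' : (0 : ℝ) < t := by exact_mod_cast ht
    have hπ := Real.pi_pos
    rw [← Real.sqrt_inv, ← Real.sqrt_sq (by positivity : (0 : ℝ) ≤ 2 * Real.pi),
      ← Real.sqrt_mul (by positivity), Real.sqrt_sq (by positivity : (0 : ℝ) ≤ 2 * Real.pi),
      iteratedDeriv_two_rate hν hα hx]
    congr 1
    field_simp
  obtain ⟨C, hC⟩ := saddle_expansion hν hα hα0 hαs h1 hmom hx hρ hW hWc
  refine exists_remainder (C := C) v (fun t _ ht => ?_) ?_
  · have ht' : (0 : ℝ) < t := by exact_mod_cast ht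
    have hs := Real.sqrt_pos.mpr (div_pos hI (by positivity : 0 < 2 * Real.pi * t))
    exact mul_ne_zero (by simp [Complex.exp_ne_zero]) (by exact_mod_cast hs.ne')
  · rintro t ⟨n, hn⟩ ht
    convert hC t n ht hn using 3
    rw [← hp t n hn, mul_inv, ← Complex.ofReal_inv, ← Complex.ofReal_inv, hsqrt t ht,
      ← Real.exp_neg, neg_neg]
    push_cast
    ring

/-- The condition x > ν / (1 - m) says X > 1, and log X ≥ 1 - 1 / X gives θ* ≥ (1 - m X)(X - 1) / X
> 0. -/
theorem thetaStar_pos (hν : 0 < ν) (hα : ∀ i, 0 ≤ α i) (h1 : norm1 α < 1)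
    (hx : ν / (1 - norm1 α) < x) : 0 < thetaStar ν α x := by
  have hm := norm1_nonneg hα
  have h1' : 0 < 1 - norm1 α := sub_pos.mpr h1
  have hx0 : 0 < x := (div_pos hν h1').trans hx
  have hX0 := saddleValue_pos hν hα hx0
  have hX : 1 < saddleValue ν α x := by
    rw [saddleValue, one_lt_div (by positivity)]
    rw [div_lt_iff₀ h1'] at hx
    linarith
  have hlt := mul_saddleValue_lt_one hν hα hx0
  have hlog := Real.one_sub_inv_le_log_of_pos hX0
  have hpos : 0 < (saddleValue ν α x)⁻¹ * ((1 - norm1 α * saddleValue ν α x) *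
      (saddleValue ν α x - 1)) :=
    mul_pos (inv_pos.mpr hX0) (mul_pos (sub_pos.mpr hlt) (sub_pos.mpr hX))
  have heq : (saddleValue ν α x)⁻¹ * ((1 - norm1 α * saddleValue ν α x) *
      (saddleValue ν α x - 1)) =
      1 - (saddleValue ν α x)⁻¹ - norm1 α * (saddleValue ν α x - 1) := by
    field_simp
  rw [thetaStar_eq]
  linarith

variable {Ω : Type*} [MeasurableSpace Ω] {P : Measure Ω} [IsProbabilityMeasure P]
  {X : ℕ → Ω → ℕ}

theorem exists_expansion_point (hν : 0 < ν) (hα : ∀ i, 0 ≤ α i) (hα0 : α 0 = 0)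
    (hαs : Summable α) (h1 : norm1 α ≤ 1)
    (hmom : Summable fun i : ℕ => (i : ℝ) ^ (v + 1) * α i) (hX : IsDiscreteHawkes P ν α X)
    (hx : 0 < x) :
    ∃ R : ℕ → ℂ, R =O[atTop ⊓ 𝓟 (latticeTimes x)] (fun t : ℕ => 1 / (t : ℝ) ^ v) ∧
      ∀ t ∈ latticeTimes x, 0 < t →
        (P.real {ω | (count X t ω : ℝ) = t * x} : ℂ) =
          (Real.exp (-(t * rate ν α x)) : ℂ) *
          (Real.sqrt (iteratedDeriv 2 (rate ν α) x / (2 * Real.pi * t)) : ℂ) *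
          (psi ν α (thetaStar ν α x) +
            ∑ k ∈ Finset.Ico 1 v,
              coeffA (eta ν α) (psi ν α) (thetaStar ν α x) k / (t : ℂ) ^ k + R t) := by
  have h := exists_expansion hν hα hα0 hαs h1 hmom hx (W := fun _ => 1) one_pos
    (by fun_prop) (by fun_prop)
    (p := fun t => (P.real {ω | (count X t ω : ℝ) = t * x} : ℂ)) fun t n hn => by
      simp only [hn, Nat.cast_inj, mul_one]
      exact point_inversion hν.le hα hX t n _
  simpa only [mul_one, coeffA_zero] using h

theorem exists_expansion_tail (hν : 0 < ν) (hα : ∀ i, 0 ≤ α i) (hα0 : α 0 = 0)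
    (hαs : Summable α) (h1 : norm1 α < 1)
    (hmom : Summable fun i : ℕ => (i : ℝ) ^ (v + 1) * α i) (hX : IsDiscreteHawkes P ν α X)
    (hx : ν / (1 - norm1 α) < x) :
    ∃ R : ℕ → ℂ, R =O[atTop ⊓ 𝓟 (latticeTimes x)] (fun t : ℕ => 1 / (t : ℝ) ^ v) ∧
      ∀ t ∈ latticeTimes x, 0 < t →
        (P.real {ω | (t : ℝ) * x ≤ count X t ω} : ℂ) =
          (Real.exp (-(t * rate ν α x)) : ℂ) *
          (Real.sqrt (iteratedDeriv 2 (rate ν α) x / (2 * Real.pi * t)) : ℂ) *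
          (1 / (1 - Complex.exp (-(thetaStar ν α x : ℂ)))) *
          (psi ν α (thetaStar ν α x) +
            ∑ k ∈ Finset.Ico 1 v,
              coeffB (eta ν α) (psi ν α) (thetaStar ν α x) k / (t : ℂ) ^ k + R t) := by
  have hx0 : 0 < x := (div_pos hν (sub_pos.mpr h1)).trans hx
  have hθ := thetaStar_pos hν hα h1 hx
  have hmem := thetaStar_mem hν hα hx0
  set θ := thetaStar ν α x with hθdef
  have hd : 1 - Complex.exp (-(θ : ℂ)) ≠ 0 := by simpa using one_sub_exp_neg_ne_zero hθ 0
  have hne : ∀ z : ℂ, 0 < z.re → 1 - Complex.exp (-z) ≠ 0 := fun z hz => by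
    simpa [mul_comm Complex.I] using one_sub_exp_neg_ne_zero hz z.im
  obtain ⟨R, hR, h⟩ := exists_expansion hν hα hα0 hαs h1.le hmom hx0
    -- The weight is normalised to 1 at θ*, so that the leading coefficient is ψ(θ*). On the disc of
    -- radius θ* around θ* the real part stays positive, so the poles of the weight are avoided.
    (W := fun z => (1 - Complex.exp (-(θ : ℂ))) / (1 - Complex.exp (-z))) hθ
    (DifferentiableOn.div (by fun_prop) (by fun_prop) fun z hz => hne z <| by
      have := (Complex.abs_re_le_norm (z - θ)).trans_lt (mem_ball_iff_norm.mp hz)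
      rw [Complex.sub_re, Complex.ofReal_re, abs_lt] at this
      linarith)
    (Continuous.div (by fun_prop) (by fun_prop) (one_sub_exp_neg_ne_zero hθ))
    (p := fun t => (1 - Complex.exp (-(θ : ℂ))) *
      (P.real {ω | (t : ℝ) * x ≤ count X t ω} : ℂ)) fun t n hn => by
      simp only [hn, Nat.cast_le]
      rw [mul_left_comm, tail_inversion hν.le hα hX t n hθ,
        ← intervalIntegral.integral_const_mul]
      congr 1 with u
      ring
  refine ⟨R, hR, fun t ht ht0 => ?_⟩
  have ht' := h t ht ht0
  simp only [← hθdef, ← coeffB_eq_coeffA hd (analyticOnNhd_psi ν hα hα0 hαs h1.le hmom _ hmem)]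
    at ht'
  rw [coeffB_eq_coeffA hd (analyticOnNhd_psi ν hα hα0 hαs h1.le hmom _ hmem) 0, coeffA_zero,
    div_self hd, mul_one] at ht'
  rw [← mul_right_inj' hd, ht']
  field_simp

end

end DiscreteHawkes

theorem mainTheorem1
    {Ω : Type*} [MeasurableSpace Ω] (P : Measure Ω) [IsProbabilityMeasure P]
    (ν : ℝ) (hν : 0 < ν)
    (α : ℕ → ℝ) (hα_nonneg : ∀ i, 0 ≤ α i) (hα_zero : α 0 = 0)
    (hα_summable : Summable α) (hα_norm : norm1 α ≤ 1)
    (v : ℕ) (hα_moment : Summable fun i : ℕ => (i : ℝ) ^ (v + 1) * α i)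
    (X : ℕ → Ω → ℕ) (hX : IsDiscreteHawkes P ν α X) :
    -- the limit function exists, solves its equation, and is analytic
    (∀ z ∈ closedHalfPlane α,
      Tendsto (fun s => f α s z) atTop (𝓝 (fInf α z)) ∧
      xFun α z = Complex.exp (z + norm1 α * (xFun α z - 1))) ∧
    AnalyticOnNhd ℂ (xFun α) (openHalfPlane α) ∧
    -- the series `φ` converges, and `φ` and `ψ` are analytic
    (∀ z ∈ openHalfPlane α, Summable fun i => Complex.exp (f α i z) - xFun α z) ∧
    AnalyticOnNhd ℂ (phi α) (openHalfPlane α) ∧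
    AnalyticOnNhd ℂ (psi ν α) (openHalfPlane α) ∧
    -- the second derivative of the rate function
    (∀ x : ℝ, 0 < x →
      iteratedDeriv 2 (rate ν α) x = ν ^ 2 / (x * (ν + norm1 α * x) ^ 2)) ∧
    -- point probabilities
    (∀ x : ℝ, 0 < x →
      ∃ R : ℕ → ℂ,
        R =O[atTop ⊓ 𝓟 (latticeTimes x)] (fun t : ℕ => 1 / (t : ℝ) ^ v) ∧
        ∀ t ∈ latticeTimes x, 0 < t →
          (P.real {ω | (count X t ω : ℝ) = t * x} : ℂ) =
            (Real.exp (-(t * rate ν α x)) : ℂ) *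
            (Real.sqrt (iteratedDeriv 2 (rate ν α) x / (2 * Real.pi * t)) : ℂ) *
            (psi ν α (thetaStar ν α x) +
              ∑ k ∈ Finset.Ico 1 v,
                coeffA (eta ν α) (psi ν α) (thetaStar ν α x) k / (t : ℂ) ^ k +
              R t)) ∧
    -- tail probabilities
    (norm1 α < 1 → ∀ x : ℝ, ν / (1 - norm1 α) < x →
      ∃ R : ℕ → ℂ,
        R =O[atTop ⊓ 𝓟 (latticeTimes x)] (fun t : ℕ => 1 / (t : ℝ) ^ v) ∧
        ∀ t ∈ latticeTimes x, 0 < t →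
          (P.real {ω | (t : ℝ) * x ≤ count X t ω} : ℂ) =
            (Real.exp (-(t * rate ν α x)) : ℂ) *
            (Real.sqrt (iteratedDeriv 2 (rate ν α) x / (2 * Real.pi * t)) : ℂ) *
            (1 / (1 - Complex.exp (-(thetaStar ν α x : ℂ)))) *
            (psi ν α (thetaStar ν α x) +
              ∑ k ∈ Finset.Ico 1 v,
                coeffB (eta ν α) (psi ν α) (thetaStar ν α x) k / (t : ℂ) ^ k +
              R t)) := by
  refine ⟨fun z hz => ⟨(tendsto_f hα_nonneg hα_zero hα_summable hα_norm hz).1,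
      xFun_eq hα_nonneg hα_zero hα_summable hα_norm hz⟩,
    analyticOnNhd_xFun hα_nonneg hα_zero hα_summable hα_norm hα_moment,
    fun z hz => summable_phi hα_nonneg hα_zero hα_summable hα_norm hα_moment hz,
    analyticOnNhd_phi hα_nonneg hα_zero hα_summable hα_norm hα_moment,
    analyticOnNhd_psi ν hα_nonneg hα_zero hα_summable hα_norm hα_moment,
    fun x hx => iteratedDeriv_two_rate hν hα_nonneg hx,
    fun x hx => exists_expansion_point hν hα_nonneg hα_zero hα_summable hα_norm hα_moment hX hx,
    fun hm x hx => exists_expansion_tail hν hα_nonneg hα_zero hα_summable hm hα_moment hX hx⟩
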